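/- Let $G$ be a Lie group with Lie algebra $\mathfrak g$ and a basis $(e_a)$ of $\mathfrak g$. Let $r:Q\to M$ be a smooth principal $G$-bundle (right action) with connection form $\Phi=\phi^a e_a\in\Omega^1_Q(\mathfrak g)$, $V=\ker\Phi$, and curvature $\omega=\omega^a e_a=d\Phi+\tfrac12[\Phi,\Phi]$. Let $\pi:X\to S$ be a $G$-equivariant smooth map of (left) $G$-manifolds with a smooth $G$-invariant horizontal distribution $H\subset TX$, i.e. $d\pi$ maps each $H_x$ isomorphically onto $T_{\pi(x)}S$. (In particular, $\pi$ may be a $G$-equivariant geometric family, that is, a fibre bundle with compact even-dimensional fibres, with an invariant horizontal distribution and an invariant vertical metric.) Write $T(X/S)=\ker d\pi$, let $P:TX\to T(X/S)$ be the projection with kernel $H$ and $h=1-P$, and let $T$ be the Frobenius tensor of $(\pi,H)$: the $T(X/S)$-valued $2$-form with $T(\eta,\zeta)=-P[h\eta,h\zeta]$. Let $G$ act on $Q\times X$ by $(z,x)\cdot g=(zg,g^{-1}x)$, let $q:Q\times X\to X_Q=Q\times_G X$ be the quotient map and $\pi_Q:X_Q\to S_Q=Q\times_G S$ the map induced by $\pi$.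 Let $\xi_a$ be the vector field generated by $e_a$ through the action on $Q\times X$, and also its component $x\mapsto\frac{d}{dt}\big|_{0}\exp(-te_a)x$ on $X$, and let $\iota_a$ be contraction with $\xi_a$. Forms on $Q$ and $X$ are pulled back to $Q\times X$, and repeated indices are summed. Put $H_Q=q_*(V\oplus H)$. Then $H_Q$ is a complement of $T(X_Q/S_Q)=\ker d\pi_Q$ in $TX_Q$ at every point, and for each $(z,x)$ the derivative of $x\mapsto[z,x]$ identifies $T(X/S)_x$ with $T(X_Q/S_Q)_{[z,x]}$. Let $T_Q$ be the Frobenius tensor of $(\pi_Q,H_Q)$, that is $T_Q(\eta,\zeta)=-P_Q[h_Q\eta,h_Q\zeta]$, where $P_Q$ is the projection onto $T(X_Q/S_Q)$ with kernel $H_Q$ and $h_Q=1-P_Q$. Under this identification, $$q^*T_Q \;=\; T-\phi^a\,\iota_aT+\tfrac12\,\phi^a\phi^b\,\iota_b\iota_aT-\omega^a\,P\xi_a$$ as $T(X/S)$-valued $2$-forms on $Q\times X$. The right-hand side is basic (it is $G$-invariant and annihilated by every $\iota_a$), and it is annihilated by contraction with vectors of $T(X/S)$. Moreover, let $E\to X$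 be a $G$-equivariant complex module over the Clifford algebra of $T(X/S)$ for a $G$-invariant vertical metric, with Clifford multiplication $c:T(X/S)\to\operatorname{End}(E)$, and let $c$ also denote the induced Clifford multiplication of $T(X_Q/S_Q)$ on $E_Q=Q\times_G E$, given by $[z,v]\cdot[z,e]=[z,c(v)e]$. Then, identifying $E_x$ with the fibre of $E_Q$ at $[z,x]$ through the injective map $e\mapsto[z,e]$, $$q^*c(T_Q) \;=\; c(T)-\phi^a\,\iota_a c(T)+\tfrac12\,\phi^a\phi^b\,\iota_b\iota_a c(T)-\omega^a\,c(P\xi_a)$$ as $\operatorname{End}(E)$-valued $2$-forms on $Q\times X$. -/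

import Mathlib

open scoped Manifold ContDiff Topology
open MulOpposite

/-- A smooth principal `G`-bundle `r : Q → M`: `G` acts smoothly on `Q` from the right
(`z · g` is written `op g • z`), preserving the fibres of the smooth map `r`, and `r` has smooth
`G`-equivariant local trivializations `r⁻¹(U) ≅ U × G` around every point. -/
structure IsPrincipalBundle
    (EG : Type*) [NormedAddCommGroup EG] [NormedSpace ℝ EG]
    (EQ : Type*) [NormedAddCommGroup EQ] [NormedSpace ℝ EQ]
    (EM : Type*) [NormedAddCommGroup EM] [NormedSpace ℝ EM]
    (G : Type*) [TopologicalSpace G] [ChartedSpace EG G] [Group G]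
    {Q : Type*} [TopologicalSpace Q] [ChartedSpace EQ Q] [MulAction Gᵐᵒᵖ Q]
    {M : Type*} [TopologicalSpace M] [ChartedSpace EM M] (r : Q → M) : Prop where
  smooth_proj : ContMDiff 𝓘(ℝ, EQ) 𝓘(ℝ, EM) ∞ r
  smooth_action : ContMDiff (𝓘(ℝ, EQ).prod 𝓘(ℝ, EG)) 𝓘(ℝ, EQ) ∞
    (fun p : Q × G => op p.2 • p.1)
  proj_action : ∀ (z : Q) (g : G), r (op g • z) = r z
  locally_trivial : ∀ m : M, ∃ e : Bundle.Trivialization G r, m ∈ e.baseSet ∧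
    ContMDiffOn 𝓘(ℝ, EQ) (𝓘(ℝ, EM).prod 𝓘(ℝ, EG)) ∞ e e.source ∧
    ContMDiffOn (𝓘(ℝ, EM).prod 𝓘(ℝ, EG)) 𝓘(ℝ, EQ) ∞ e.toOpenPartialHomeomorph.symm e.target ∧
    ∀ z ∈ e.source, ∀ g : G, (e (op g • z)).2 = (e z).2 * g

section Assoc

variable {EG : Type*} [NormedAddCommGroup EG] [NormedSpace ℝ EG]
  {EQ : Type*} [NormedAddCommGroup EQ] [NormedSpace ℝ EQ]
  {EM : Type*} [NormedAddCommGroup EM] [NormedSpace ℝ EM]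
  {G : Type*} [TopologicalSpace G] [ChartedSpace EG G] [Group G]
  {Q : Type*} [TopologicalSpace Q] [ChartedSpace EQ Q] [MulAction Gᵐᵒᵖ Q]
  {M : Type*} [TopologicalSpace M] [ChartedSpace EM M] {r : Q → M}
  (hr : IsPrincipalBundle EG EQ EM G r)
  (Y : Type*) [MulAction G Y]

/-- The orbit relation of the right action `(z, y) · g = (z · g, g⁻¹ • y)` of `G` on `Q × Y`. -/
def assocSetoid (G Q Y : Type*) [Group G] [MulAction Gᵐᵒᵖ Q] [MulAction G Y] :
    Setoid (Q × Y) where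
  r p p' := ∃ g : G, p' = (op g • p.1, g⁻¹ • p.2)
  iseqv :=
    { refl := fun p => ⟨1, by simp⟩
      symm := by
        rintro p p' ⟨g, rfl⟩
        refine ⟨g⁻¹, ?_⟩
        ext
        · simp only [smul_smul, ← op_mul, mul_inv_cancel, op_one, one_smul]
        · simp
      trans := by
        rintro p p' p'' ⟨g, rfl⟩ ⟨h, rfl⟩
        refine ⟨g * h, ?_⟩
        ext
        · simp only [smul_smul, ← op_mul]
        · simp only [smul_smul, mul_inv_rev] }

/-- The associated bundle `Y_Q = Q ×_G Y`. -/
def AssocSpace (_hr : IsPrincipalBundle EG EQ EM G r) (Y : Type*) [MulAction G Y] : Type _ :=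
  Quotient (assocSetoid G Q Y)

/-- The quotient map `q : Q × Y → Y_Q`. -/
def AssocSpace.mk {Y : Type*} [MulAction G Y] (p : Q × Y) : AssocSpace hr Y :=
  Quotient.mk (assocSetoid G Q Y) p

variable {Y} in
theorem AssocSpace.mk_eq_iff {p p' : Q × Y} :
    AssocSpace.mk hr p = AssocSpace.mk hr p' ↔ ∃ g : G, p' = (op g • p.1, g⁻¹ • p.2) :=
  Quotient.eq (r := assocSetoid G Q Y)

variable {Y} in
theorem AssocSpace.mk_surjective : Function.Surjective (AssocSpace.mk hr (Y := Y)) :=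
  Quotient.mk_surjective

variable {Y} in
theorem AssocSpace.mk_action (g : G) (p : Q × Y) :
    AssocSpace.mk hr (op g • p.1, g⁻¹ • p.2) = AssocSpace.mk hr p :=
  ((AssocSpace.mk_eq_iff hr).2 ⟨g, rfl⟩).symm

/-- The map `f_Q : Y_Q → Y'_Q`, `[z, y] ↦ [z, f y]`, induced by a `G`-equivariant map `f`. -/
def AssocSpace.map {Y Y' : Type*} [MulAction G Y] [MulAction G Y'] (f : Y → Y')
    (hf : ∀ (g : G) (y : Y), f (g • y) = g • f y) : AssocSpace hr Y → AssocSpace hr Y' :=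
  Quotient.map' (s₁ := assocSetoid G Q Y) (s₂ := assocSetoid G Q Y') (fun p => (p.1, f p.2)) (by
    rintro p p' ⟨g, rfl⟩
    exact ⟨g, by simp [hf]⟩)

/-- A local trivialization of `Q` around `m`. -/
noncomputable def IsPrincipalBundle.triv (m : M) : Bundle.Trivialization G r :=
  (hr.locally_trivial m).choose

theorem IsPrincipalBundle.mem_triv (m : M) : m ∈ (hr.triv m).baseSet :=
  (hr.locally_trivial m).choose_spec.1

theorem IsPrincipalBundle.triv_smooth (m : M) :
    ContMDiffOn 𝓘(ℝ, EQ) (𝓘(ℝ, EM).prod 𝓘(ℝ, EG)) ∞ (hr.triv m) (hr.triv m).source :=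
  (hr.locally_trivial m).choose_spec.2.1

theorem IsPrincipalBundle.triv_symm_smooth (m : M) :
    ContMDiffOn (𝓘(ℝ, EM).prod 𝓘(ℝ, EG)) 𝓘(ℝ, EQ) ∞
      (hr.triv m).toOpenPartialHomeomorph.symm (hr.triv m).target :=
  (hr.locally_trivial m).choose_spec.2.2.1

theorem IsPrincipalBundle.triv_action (m : M) {z : Q} (hz : r z ∈ (hr.triv m).baseSet) (g : G) :
    hr.triv m (op g • z) = (r z, (hr.triv m z).2 * g) := by
  have h := (hr.locally_trivial m).choose_spec.2.2.2 z ((hr.triv m).mem_source.2 hz) g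
  have h1 : r (op g • z) ∈ (hr.triv m).baseSet := by rwa [hr.proj_action]
  refine Prod.ext ?_ h
  rw [(hr.triv m).coe_fst' h1, hr.proj_action]

/-- The local section of `Q` with constant group component `1` in a local trivialization. -/
noncomputable def IsPrincipalBundle.sec (m n : M) : Q :=
  (hr.triv m).toOpenPartialHomeomorph.symm (n, 1)

theorem IsPrincipalBundle.proj_sec (m : M) {n : M} (hn : n ∈ (hr.triv m).baseSet) :
    r (hr.sec m n) = n :=
  (hr.triv m).proj_symm_apply' hn

theorem IsPrincipalBundle.triv_sec (m : M) {n : M} (hn : n ∈ (hr.triv m).baseSet) :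
    hr.triv m (hr.sec m n) = (n, 1) :=
  (hr.triv m).apply_symm_apply' hn

theorem IsPrincipalBundle.sec_action (m : M) {z : Q} (hz : r z ∈ (hr.triv m).baseSet) :
    op (hr.triv m z).2 • hr.sec m (r z) = z := by
  have h1 := hr.triv_action m (z := hr.sec m (r z)) (by rwa [hr.proj_sec m hz]) (hr.triv m z).2
  rw [hr.proj_sec m hz, hr.triv_sec m hz, one_mul] at h1
  have h2 : r (op (hr.triv m z).2 • hr.sec m (r z)) ∈ (hr.triv m).baseSet := by
    rwa [hr.proj_action, hr.proj_sec m hz]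
  have h3 : hr.triv m z = (r z, (hr.triv m z).2) := ((hr.triv m).mk_proj_snd' hz).symm
  exact (hr.triv m).injOn ((hr.triv m).mem_source.2 h2) ((hr.triv m).mem_source.2 hz)
    (h1.trans h3.symm)

/-- The underlying function of the local trivialization `[z, y] ↦ (r z, h • y)` of `Y_Q`, where
`z ↦ (r z, h)` is a local trivialization of `Q`. -/
noncomputable def AssocSpace.trivFun (m : M) (y : AssocSpace hr Y) : M × Y :=
  (r (Quotient.out y).1, (hr.triv m (Quotient.out y).1).2 • (Quotient.out y).2)

variable {Y} in
theorem AssocSpace.trivFun_mk (m : M) {p : Q × Y} (hp : r p.1 ∈ (hr.triv m).baseSet) :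
    AssocSpace.trivFun hr Y m (AssocSpace.mk hr p) = (r p.1, (hr.triv m p.1).2 • p.2) := by
  obtain ⟨g, hg⟩ : ∃ g : G, p = (op g • (Quotient.out (AssocSpace.mk hr p)).1,
      g⁻¹ • (Quotient.out (AssocSpace.mk hr p)).2) :=
    Quotient.mk_out (s := assocSetoid G Q Y) p
  unfold AssocSpace.trivFun
  generalize Quotient.out (AssocSpace.mk hr p) = o at hg
  subst hg
  simp only [hr.proj_action] at hp ⊢
  rw [hr.triv_action m hp]
  simp [smul_smul]

variable [TopologicalSpace Y]

/-- `Y_Q` carries the quotient topology. -/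
instance : TopologicalSpace (AssocSpace hr Y) :=
  inferInstanceAs (TopologicalSpace (Quotient (assocSetoid G Q Y)))

variable {Y} in
theorem AssocSpace.continuous_mk : Continuous (AssocSpace.mk hr (Y := Y)) :=
  continuous_quot_mk

variable {Y} in
theorem AssocSpace.isOpenMap_mk [ContinuousSMul G Y] :
    IsOpenMap (AssocSpace.mk hr (Y := Y)) := by
  intro s hs
  have hc := hr.smooth_action.continuous
  refine isOpen_coinduced.2 ?_
  have : AssocSpace.mk hr ⁻¹' (AssocSpace.mk hr '' s)
      = ⋃ g : G, (fun p : Q × Y => (op g • p.1, g⁻¹ • p.2)) ⁻¹' s := by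
    ext p
    simp only [Set.mem_preimage, Set.mem_image, Set.mem_iUnion]
    constructor
    · rintro ⟨p', hp', h⟩
      obtain ⟨g, rfl⟩ := (AssocSpace.mk_eq_iff hr).1 h.symm
      exact ⟨g, hp'⟩
    · rintro ⟨g, hg⟩
      exact ⟨_, hg, AssocSpace.mk_action hr g p⟩
  change IsOpen (AssocSpace.mk hr ⁻¹' (AssocSpace.mk hr '' s))
  rw [this]
  refine isOpen_iUnion fun g => hs.preimage ?_
  refine Continuous.prodMk ?_ (continuous_snd.const_smul g⁻¹)
  exact hc.comp (continuous_fst.prodMk continuous_const)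

variable {Y} in
/-- The projection `Y_Q → M`. -/
def AssocSpace.proj : AssocSpace hr Y → M :=
  Quotient.lift (s := assocSetoid G Q Y) (fun p => r p.1) (by
    rintro p p' ⟨g, rfl⟩
    exact (hr.proj_action _ _).symm)

variable {Y} in
theorem AssocSpace.continuous_proj : Continuous (AssocSpace.proj hr (Y := Y)) :=
  (hr.smooth_proj.continuous.comp continuous_fst).quotient_lift _

theorem IsPrincipalBundle.sec_smooth (m : M) :
    ContMDiffOn 𝓘(ℝ, EM) 𝓘(ℝ, EQ) ∞ (hr.sec m) (hr.triv m).baseSet := by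
  refine (hr.triv_symm_smooth m).comp (t := (hr.triv m).target)
    (contMDiffOn_id.prodMk contMDiffOn_const) ?_
  intro n hn
  exact (hr.triv m).mem_target.2 hn

variable {EY : Type*} [NormedAddCommGroup EY] [NormedSpace ℝ EY] [ChartedSpace EY Y]
  [ContMDiffSMul 𝓘(ℝ, EG) 𝓘(ℝ, EY) ∞ G Y]

/-- The local trivialization `[z, y] ↦ (r z, h • y)` of `Y_Q`, as a homeomorphism from an open
subset of `Y_Q` to an open subset of `M × Y`, with inverse `(n, y) ↦ [s n, y]` for the local
section `s` of `Q`. -/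
noncomputable def AssocSpace.triv (m : M) :
    OpenPartialHomeomorph (AssocSpace hr Y) (M × Y) where
  toFun := AssocSpace.trivFun hr Y m
  invFun p := AssocSpace.mk hr (hr.sec m p.1, p.2)
  source := AssocSpace.proj hr ⁻¹' (hr.triv m).baseSet
  target := (hr.triv m).baseSet ×ˢ Set.univ
  map_source' := by
    intro y hy
    obtain ⟨p, rfl⟩ := AssocSpace.mk_surjective hr y
    rw [AssocSpace.trivFun_mk hr m hy]
    exact ⟨hy, trivial⟩
  map_target' := by
    rintro ⟨n, y⟩ ⟨hn, -⟩
    change r (hr.sec m n) ∈ (hr.triv m).baseSet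
    rwa [hr.proj_sec m hn]
  left_inv' := by
    intro y hy
    obtain ⟨p, rfl⟩ := AssocSpace.mk_surjective hr y
    rw [AssocSpace.trivFun_mk hr m hy, AssocSpace.mk_eq_iff]
    refine ⟨(hr.triv m p.1).2, ?_⟩
    ext
    · exact (hr.sec_action m hy).symm
    · simp
  right_inv' := by
    rintro ⟨n, y⟩ ⟨hn, -⟩
    have h : r (hr.sec m n) ∈ (hr.triv m).baseSet := by rwa [hr.proj_sec m hn]
    rw [AssocSpace.trivFun_mk hr m (p := (hr.sec m n, y)) h]
    simp only [hr.proj_sec m hn, hr.triv_sec m hn, one_smul]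
  open_source := (hr.triv m).open_baseSet.preimage (AssocSpace.continuous_proj hr)
  open_target := (hr.triv m).open_baseSet.prod isOpen_univ
  continuousOn_toFun := by
    have : ContinuousSMul G Y :=
      ContMDiffSMul.continuousSMul (I := 𝓘(ℝ, EG)) (I' := 𝓘(ℝ, EY)) ∞
    rw [((hr.triv m).open_baseSet.preimage
      (AssocSpace.continuous_proj hr)).continuousOn_iff]
    intro y hy
    obtain ⟨p, rfl⟩ := AssocSpace.mk_surjective hr y
    have hp : r p.1 ∈ (hr.triv m).baseSet := hy
    refine (IsOpenQuotientMap.continuousAt_comp_iff (f := AssocSpace.mk hr)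
      ⟨AssocSpace.mk_surjective hr, AssocSpace.continuous_mk hr,
        AssocSpace.isOpenMap_mk hr⟩).1 ?_
    have hU : (fun p' : Q × Y => r p'.1) ⁻¹' (hr.triv m).baseSet ∈ 𝓝 p :=
      ((hr.triv m).open_baseSet.preimage
        (hr.smooth_proj.continuous.comp continuous_fst)).mem_nhds hp
    refine ContinuousAt.congr (f := fun p' : Q × Y => (r p'.1, (hr.triv m p'.1).2 • p'.2)) ?_
      (Filter.mem_of_superset hU fun p' hp' => (AssocSpace.trivFun_mk hr m hp').symm)
    have h1 : ContinuousAt (hr.triv m) p.1 :=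
      (hr.triv m).continuousAt ((hr.triv m).mem_source.2 hp)
    have h2 : ContinuousAt (fun p' : Q × Y => hr.triv m p'.1) p := h1.comp continuousAt_fst
    exact (hr.smooth_proj.continuous.continuousAt.comp continuousAt_fst).prodMk
      (h2.snd.smul continuousAt_snd)
  continuousOn_invFun :=
    (AssocSpace.continuous_mk hr).comp_continuousOn
      (((hr.sec_smooth m).continuousOn.comp continuousOn_fst fun _ h => h.1).prodMk
        continuousOn_snd)

/-- `Y_Q` is locally modelled on `M × Y` through its local trivializations. -/
@[reducible]
noncomputable def AssocSpace.chartedSpaceProd :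
    ChartedSpace (M × Y) (AssocSpace hr Y) where
  atlas := Set.range (AssocSpace.triv hr Y (EY := EY))
  chartAt y := AssocSpace.triv hr Y (EY := EY) (AssocSpace.proj hr y)
  mem_chart_source y := hr.mem_triv (AssocSpace.proj hr y)
  chart_mem_atlas _ := ⟨_, rfl⟩

/-- The smooth structure on `Y_Q`: the charts are the local trivializations followed by the charts
of `M × Y`. -/
noncomputable instance AssocSpace.chartedSpace :
    ChartedSpace (ModelProd EM EY) (AssocSpace hr Y) :=
  letI : ChartedSpace (M × Y) (AssocSpace hr Y) := AssocSpace.chartedSpaceProd hr Y (EY := EY)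
  ChartedSpace.comp (ModelProd EM EY) (M × Y) (AssocSpace hr Y)

theorem AssocSpace.triv_trans_smooth (m m' : M) :
    ContMDiffOn (𝓘(ℝ, EM).prod 𝓘(ℝ, EY)) (𝓘(ℝ, EM).prod 𝓘(ℝ, EY)) ∞
      ((AssocSpace.triv hr Y (EY := EY) m).symm ≫ₕ (AssocSpace.triv hr Y (EY := EY) m'))
      ((AssocSpace.triv hr Y (EY := EY) m).symm ≫ₕ (AssocSpace.triv hr Y (EY := EY) m')).source := by
  have hs : ∀ p ∈ ((AssocSpace.triv hr Y (EY := EY) m).symm ≫ₕ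
      (AssocSpace.triv hr Y (EY := EY) m')).source,
      p.1 ∈ (hr.triv m).baseSet ∧ p.1 ∈ (hr.triv m').baseSet := by
    rintro p hp
    rw [OpenPartialHomeomorph.trans_source] at hp
    have h1 : p.1 ∈ (hr.triv m).baseSet := hp.1.1
    have h2 : r (hr.sec m p.1) ∈ (hr.triv m').baseSet := hp.2
    rw [hr.proj_sec m h1] at h2
    exact ⟨h1, h2⟩
  have hsec : ContMDiffOn (𝓘(ℝ, EM).prod 𝓘(ℝ, EY)) 𝓘(ℝ, EQ) ∞
      (fun p : M × Y => hr.sec m p.1) ((AssocSpace.triv hr Y (EY := EY) m).symm ≫ₕ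
      (AssocSpace.triv hr Y (EY := EY) m')).source :=
    (hr.sec_smooth m).comp contMDiffOn_fst fun p hp => (hs p hp).1
  have htr : ContMDiffOn (𝓘(ℝ, EM).prod 𝓘(ℝ, EY)) (𝓘(ℝ, EM).prod 𝓘(ℝ, EG)) ∞
      (fun p : M × Y => hr.triv m' (hr.sec m p.1)) ((AssocSpace.triv hr Y (EY := EY) m).symm ≫ₕ
      (AssocSpace.triv hr Y (EY := EY) m')).source :=
    (hr.triv_smooth m').comp hsec fun p hp => by
      refine (hr.triv m').mem_source.2 ?_
      rw [hr.proj_sec m (hs p hp).1]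
      exact (hs p hp).2
  have hg := (contMDiff_snd (I := 𝓘(ℝ, EM)) (J := 𝓘(ℝ, EG)) (n := ∞)).comp_contMDiffOn htr
  refine (contMDiffOn_fst.prodMk (hg.smul contMDiffOn_snd)).congr ?_
  intro p hp
  obtain ⟨h1, h2⟩ := hs p hp
  change AssocSpace.trivFun hr Y m' (AssocSpace.mk hr (hr.sec m p.1, p.2)) = _
  have h3 : r (hr.sec m p.1) ∈ (hr.triv m').baseSet := by rwa [hr.proj_sec m h1]
  rw [AssocSpace.trivFun_mk hr m' (p := (hr.sec m p.1, p.2)) h3]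
  simp [hr.proj_sec m h1]

instance AssocSpace.isManifold [IsManifold 𝓘(ℝ, EM) ∞ M] [IsManifold 𝓘(ℝ, EY) ∞ Y] :
    IsManifold (𝓘(ℝ, EM).prod 𝓘(ℝ, EY)) ∞ (AssocSpace hr Y) := by
  refine isManifold_of_contDiffOn _ _ _ ?_
  rintro _ _ ⟨_, ⟨m, rfl⟩, c, hc, rfl⟩ ⟨_, ⟨m', rfl⟩, c', hc', rfl⟩
  have hsmooth := AssocSpace.triv_trans_smooth hr Y (EY := EY) m m'
  set A := AssocSpace.triv hr Y (EY := EY) m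
  set A' := AssocSpace.triv hr Y (EY := EY) m'
  have hc1 := contMDiffOn_symm_of_mem_maximalAtlas (I := 𝓘(ℝ, EM).prod 𝓘(ℝ, EY)) (n := ∞)
    (IsManifold.subset_maximalAtlas (I := 𝓘(ℝ, EM).prod 𝓘(ℝ, EY)) (n := ∞) hc)
  have hc2 := contMDiffOn_of_mem_maximalAtlas (I := 𝓘(ℝ, EM).prod 𝓘(ℝ, EY)) (n := ∞)
    (IsManifold.subset_maximalAtlas (I := 𝓘(ℝ, EM).prod 𝓘(ℝ, EY)) (n := ∞) hc')
  have key : ContMDiffOn (𝓘(ℝ, EM).prod 𝓘(ℝ, EY)) (𝓘(ℝ, EM).prod 𝓘(ℝ, EY)) ∞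
      ((A ≫ₕ c).symm ≫ₕ (A' ≫ₕ c')) ((A ≫ₕ c).symm ≫ₕ (A' ≫ₕ c')).source := by
    have h1 : ContMDiffOn (𝓘(ℝ, EM).prod 𝓘(ℝ, EY)) (𝓘(ℝ, EM).prod 𝓘(ℝ, EY)) ∞
      (c' ∘ (A.symm ≫ₕ A') ∘ c.symm) ((A ≫ₕ c).symm ≫ₕ (A' ≫ₕ c')).source := by
      refine hc2.comp (hsmooth.comp (hc1.mono ?_) ?_) ?_
      · intro x hx
        simp only [mfld_simps] at hx
        exact hx.1.1
      · intro x hx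
        simp only [mfld_simps] at hx ⊢
        exact ⟨hx.1.2, hx.2.1⟩
      · intro x hx
        simp only [mfld_simps] at hx ⊢
        exact hx.2.2
    exact h1
  rw [← contMDiffOn_iff_contDiffOn]
  refine (𝓘(ℝ, EM).prod 𝓘(ℝ, EY)).contMDiff.comp_contMDiffOn ?_
  exact key.comp ((𝓘(ℝ, EM).prod 𝓘(ℝ, EY)).contMDiffOn_symm.mono Set.inter_subset_right)
    fun x hx => hx.1

end Assoc

section Calculus

variable {E : Type*} [NormedAddCommGroup E] [NormedSpace ℝ E]
  {H : Type*} [TopologicalSpace H] (I : ModelWithCorners ℝ E H)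
  {X : Type*} [TopologicalSpace X] [ChartedSpace H X]

/-- The projection `V → p` with kernel `q`, for a direct sum decomposition `V = p ⊕ q`
(and `0` if `p` and `q` are not complementary). -/
noncomputable def projAlong {V : Type*} [AddCommGroup V] [Module ℝ V] (p q : Submodule ℝ V) :
    V →ₗ[ℝ] p :=
  open Classical in if h : IsCompl p q then Submodule.projectionOnto p q h else 0

/-- A smooth distribution: a family of tangent subspaces which locally has a smooth frame. -/
def IsSmoothDistribution (D : (x : X) → Submodule ℝ (TangentSpace I x)) [IsManifold I 1 X] :
    Prop :=
  ∀ x₀ : X, ∃ U ∈ 𝓝 x₀, ∃ (k : ℕ) (σ : Fin k → (x : X) → TangentSpace I x),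
    (∀ i, ContMDiffOn I I.tangent ∞ (fun x => (⟨x, σ i x⟩ : TangentBundle I X)) U) ∧
    ∀ x ∈ U, LinearIndependent ℝ (fun i => σ i x) ∧
      Submodule.span ℝ (Set.range fun i => σ i x) = D x

variable [IsManifold I 1 X]

/-- The Frobenius tensor `T(u, v) = -P[h U, h V]` of a decomposition `TX = Ver ⊕ Hor`, where
`h : TX → Hor` and `P : TX → Ver` are the projections and `U`, `V` are vector fields extending
the tangent vectors `u`, `v` (the value does not depend on the extensions). -/
noncomputable def frobeniusTensor (Ver Hor : (x : X) → Submodule ℝ (TangentSpace I x))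
    (x : X) (u v : TangentSpace I x) : Ver x :=
  -projAlong (Ver x) (Hor x) (VectorField.mlieBracket I
    (fun y => (projAlong (Hor y) (Ver y) (FiberBundle.extend E u y) : TangentSpace I y))
    (fun y => (projAlong (Hor y) (Ver y) (FiberBundle.extend E v y) : TangentSpace I y)) x)

/-- The exterior derivative `dα(u, v) = U(α(V)) - V(α(U)) - α([U, V])` of a `1`-form `α` with
values in `F`, where `U`, `V` are vector fields extending the tangent vectors `u`, `v` (the value
does not depend on the extensions). -/
noncomputable def extDerivOneForm {F : Type*} [NormedAddCommGroup F] [NormedSpace ℝ F]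
    (α : (x : X) → TangentSpace I x →ₗ[ℝ] F) (x : X) (u v : TangentSpace I x) : F :=
  mvfderiv I (fun y => α y (FiberBundle.extend E v y)) x u
    - mvfderiv I (fun y => α y (FiberBundle.extend E u y)) x v
    - α x (VectorField.mlieBracket I (FiberBundle.extend E u) (FiberBundle.extend E v) x)

/-- The vertical tangent space `T(X/S)_x = ker dπ_x`. -/
noncomputable def verticalSpace {E' : Type*} [NormedAddCommGroup E'] [NormedSpace ℝ E']
    {H' : Type*} [TopologicalSpace H'] (I' : ModelWithCorners ℝ E' H')
    {S : Type*} [TopologicalSpace S] [ChartedSpace H' S] (π : X → S) (x : X) :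
    Submodule ℝ (TangentSpace I x) :=
  LinearMap.ker (mfderiv I I' π x).toLinearMap

end Calculus

section Connection

variable {EG : Type*} [NormedAddCommGroup EG] [NormedSpace ℝ EG]
  {EQ : Type*} [NormedAddCommGroup EQ] [NormedSpace ℝ EQ]
  {G : Type*} [TopologicalSpace G] [ChartedSpace EG G] [Group G]
  {Q : Type*} [TopologicalSpace Q] [ChartedSpace EQ Q] [MulAction Gᵐᵒᵖ Q]

/-- A connection `1`-form `Φ` on a principal `G`-bundle with total space `Q`: a smooth `1`-form
with values in the Lie algebra `𝔤` of `G` which maps the fundamental vector field of `e ∈ 𝔤` to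
`e` and satisfies `R_g^* Φ = Ad(g⁻¹) Φ`. -/
structure IsPrincipalConnection [IsManifold 𝓘(ℝ, EQ) 1 Q]
    (Φ : (z : Q) → TangentSpace 𝓘(ℝ, EQ) z →ₗ[ℝ] GroupLieAlgebra 𝓘(ℝ, EG) G) : Prop where
  smooth : ContMDiff (M' := EG) 𝓘(ℝ, EQ).tangent 𝓘(ℝ, EG) ∞
    (fun w : TangentBundle 𝓘(ℝ, EQ) Q => Φ w.1 w.2)
  vertical : ∀ (z : Q) (e : GroupLieAlgebra 𝓘(ℝ, EG) G),
    Φ z (mfderiv 𝓘(ℝ, EG) 𝓘(ℝ, EQ) (fun g : G => op g • z) 1 e) = e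
  equivariant : ∀ (g : G) (z : Q) (w : TangentSpace 𝓘(ℝ, EQ) z),
    Φ (op g • z) (mfderiv 𝓘(ℝ, EQ) 𝓘(ℝ, EQ) (fun z' : Q => op g • z') z w)
      = mfderiv 𝓘(ℝ, EG) 𝓘(ℝ, EG) (fun h : G => g⁻¹ * h * g) 1 (Φ z w)

/-- The curvature `ω = dΦ + ½[Φ, Φ]`, i.e. `ω(u, v) = dΦ(u, v) + [Φ(u), Φ(v)]`. -/
noncomputable def curvatureForm [IsManifold 𝓘(ℝ, EQ) 1 Q]
    (Φ : (z : Q) → TangentSpace 𝓘(ℝ, EQ) z →ₗ[ℝ] GroupLieAlgebra 𝓘(ℝ, EG) G)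
    (z : Q) (u v : TangentSpace 𝓘(ℝ, EQ) z) : GroupLieAlgebra 𝓘(ℝ, EG) G :=
  let dΦ : GroupLieAlgebra 𝓘(ℝ, EG) G := extDerivOneForm 𝓘(ℝ, EQ) (F := EG) Φ z u v
  dΦ + ⁅Φ z u, Φ z v⁆

end Connection

section Formula

variable {V A ι : Type*} [AddCommGroup A] [Module ℝ A]

/-- The wedge product `(α ∧ β)(u, v) = α(u) β(v) - α(v) β(u)` of a scalar `1`-form and an
`A`-valued `1`-form, at a point. -/
def wedgeOneOne (α : V → ℝ) (β : V → A) (u v : V) : A :=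
  α u • β v - α v • β u

/-- The contraction `ι_ξ T = T(ξ, ·)`. -/
def contract {B : Type*} (ξ : V) (T : V → B) : B := T ξ

/-- The `A`-valued `2`-form
`T - φ^a ∧ ι_a T + ½ φ^a ∧ φ^b ι_b ι_a T - ω^a τ_a` at a point (summation over `a`, `b`), where
`ι_a` is the contraction with `ξ_a`. -/
noncomputable def frobeniusFormula [Fintype ι] (φ : ι → V → ℝ) (curv : ι → V → V → ℝ) (ξ : ι → V)
    (T : V → V → A) (τ : ι → A) (u v : V) : A :=
  T u v - ∑ a, wedgeOneOne (φ a) (contract (ξ a) T) u v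
    + (1 / 2 : ℝ) • ∑ a, ∑ b, wedgeOneOne (φ a) (φ b) u v • contract (ξ b) (contract (ξ a) T)
    - ∑ a, curv a u v • τ a

end Formula

section Family

variable {EG : Type*} [NormedAddCommGroup EG] [NormedSpace ℝ EG]
  {EQ : Type*} [NormedAddCommGroup EQ] [NormedSpace ℝ EQ]
  {EM : Type*} [NormedAddCommGroup EM] [NormedSpace ℝ EM]
  {EX : Type*} [NormedAddCommGroup EX] [NormedSpace ℝ EX]
  {ES : Type*} [NormedAddCommGroup ES] [NormedSpace ℝ ES]
  {G : Type*} [TopologicalSpace G] [ChartedSpace EG G] [Group G]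
  {Q : Type*} [TopologicalSpace Q] [ChartedSpace EQ Q] [MulAction Gᵐᵒᵖ Q]
  {M : Type*} [TopologicalSpace M] [ChartedSpace EM M] [IsManifold 𝓘(ℝ, EM) ∞ M]
  {X : Type*} [TopologicalSpace X] [ChartedSpace EX X] [IsManifold 𝓘(ℝ, EX) ∞ X]
  [MulAction G X] [ContMDiffSMul 𝓘(ℝ, EG) 𝓘(ℝ, EX) ∞ G X]
  {S : Type*} [TopologicalSpace S] [ChartedSpace ES S] [IsManifold 𝓘(ℝ, ES) ∞ S]
  [MulAction G S] [ContMDiffSMul 𝓘(ℝ, EG) 𝓘(ℝ, ES) ∞ G S]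

variable (EX ES G) in
/-- A `G`-equivariant smooth family `π : X → S` with a `G`-invariant horizontal distribution:
a smooth distribution `Hor` such that `dπ` maps each `Hor x` isomorphically onto the tangent
space of `S` (so that `π` is a submersion). -/
structure IsEquivariantFamily (π : X → S)
    (Hor : (x : X) → Submodule ℝ (TangentSpace 𝓘(ℝ, EX) x)) : Prop where
  smooth : ContMDiff 𝓘(ℝ, EX) 𝓘(ℝ, ES) ∞ π
  equivariant : ∀ (g : G) (x : X), π (g • x) = g • π x
  smooth_hor : IsSmoothDistribution 𝓘(ℝ, EX) Hor
  horizontal : ∀ x : X, Set.BijOn (mfderiv 𝓘(ℝ, EX) 𝓘(ℝ, ES) π x) (Hor x) Set.univ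
  invariant : ∀ (g : G) (x : X), ∀ v ∈ Hor x,
    mfderiv 𝓘(ℝ, EX) 𝓘(ℝ, EX) (fun x' : X => g • x') x v ∈ Hor (g • x)

/-- The vector field on `Q × X` generated by `e ∈ 𝔤`, i.e. the derivative at `g = 1` in the
direction `e` of `(z, x) · g = (z · g, g⁻¹ • x)`. -/
noncomputable def generatingField (p : Q × X) (e : GroupLieAlgebra 𝓘(ℝ, EG) G) :
    TangentSpace (𝓘(ℝ, EQ).prod 𝓘(ℝ, EX)) p :=
  mfderiv 𝓘(ℝ, EG) (𝓘(ℝ, EQ).prod 𝓘(ℝ, EX))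
    (fun g : G => ((op g • p.1, g⁻¹ • p.2) : Q × X)) 1 e

/-- The vector field on `X` generated by `e ∈ 𝔤`, i.e. the derivative at `g = 1` in the
direction `e` of `x · g = g⁻¹ • x`. -/
noncomputable def actionField (x : X) (e : GroupLieAlgebra 𝓘(ℝ, EG) G) :
    TangentSpace 𝓘(ℝ, EX) x :=
  mfderiv 𝓘(ℝ, EG) 𝓘(ℝ, EX) (fun g : G => g⁻¹ • x) 1 e

variable {r : Q → M} (hr : IsPrincipalBundle EG EQ EM G r)

/-- The horizontal distribution `H_Q = q_*(V ⊕ Hor)` on `X_Q`, where `V = ker Φ`. -/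
noncomputable def horizontalQ
    (Φ : (z : Q) → TangentSpace 𝓘(ℝ, EQ) z →ₗ[ℝ] GroupLieAlgebra 𝓘(ℝ, EG) G)
    (Hor : (x : X) → Submodule ℝ (TangentSpace 𝓘(ℝ, EX) x)) (y : AssocSpace hr X) :
    Submodule ℝ (TangentSpace (𝓘(ℝ, EM).prod 𝓘(ℝ, EX)) y) :=
  Submodule.span ℝ {w | ∃ (p : Q × X) (η : TangentSpace (𝓘(ℝ, EQ).prod 𝓘(ℝ, EX)) p),
    Φ p.1 (mfderiv (𝓘(ℝ, EQ).prod 𝓘(ℝ, EX)) 𝓘(ℝ, EQ) Prod.fst p η) = 0 ∧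
    mfderiv (𝓘(ℝ, EQ).prod 𝓘(ℝ, EX)) 𝓘(ℝ, EX) Prod.snd p η ∈ Hor p.2 ∧
    (⟨y, w⟩ : TangentBundle (𝓘(ℝ, EM).prod 𝓘(ℝ, EX)) (AssocSpace hr X)) =
      ⟨AssocSpace.mk hr p, mfderiv (𝓘(ℝ, EQ).prod 𝓘(ℝ, EX)) (𝓘(ℝ, EM).prod 𝓘(ℝ, EX))
        (AssocSpace.mk hr) p η⟩}

variable {π : X → S} {Hor : (x : X) → Submodule ℝ (TangentSpace 𝓘(ℝ, EX) x)}
  (hπ : IsEquivariantFamily EX ES G π Hor)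

/-- The vertical tangent space `T(X_Q/S_Q)` of the induced map `π_Q : X_Q → S_Q`. -/
noncomputable def verticalQ (y : AssocSpace hr X) :
    Submodule ℝ (TangentSpace (𝓘(ℝ, EM).prod 𝓘(ℝ, EX)) y) :=
  verticalSpace (𝓘(ℝ, EM).prod 𝓘(ℝ, EX)) (𝓘(ℝ, EM).prod 𝓘(ℝ, ES))
    (AssocSpace.map hr π hπ.equivariant) y

/-- The derivative `T_x X → T_{[z, x]} X_Q` of `x ↦ [z, x]` at `p = (z, x)`. On vertical vectors
it gives the identification of `T(X/S)_x` with `T(X_Q/S_Q)_{[z, x]}`. -/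
noncomputable def fiberDeriv (p : Q × X) : TangentSpace 𝓘(ℝ, EX) p.2 →L[ℝ]
    TangentSpace (𝓘(ℝ, EM).prod 𝓘(ℝ, EX)) (AssocSpace.mk hr p) :=
  mfderiv 𝓘(ℝ, EX) (𝓘(ℝ, EM).prod 𝓘(ℝ, EX)) (fun x : X => AssocSpace.mk hr (p.1, x)) p.2

/-- The Frobenius tensor `T_Q` of `π_Q : X_Q → S_Q` with the horizontal distribution `H_Q`. -/
noncomputable def frobeniusQ
    (Φ : (z : Q) → TangentSpace 𝓘(ℝ, EQ) z →ₗ[ℝ] GroupLieAlgebra 𝓘(ℝ, EG) G)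
    (y : AssocSpace hr X) (u v : TangentSpace (𝓘(ℝ, EM).prod 𝓘(ℝ, EX)) y) :
    verticalQ hr hπ y :=
  frobeniusTensor (𝓘(ℝ, EM).prod 𝓘(ℝ, EX)) (verticalQ hr hπ) (horizontalQ hr Φ Hor) y u v

/-- The value at `p = (z, x)` of the pullback to `Q × X` of the `1`-form `φ^a` on `Q`, where
`Φ = φ^a e_a` for a basis `e_a` of `𝔤`. -/
noncomputable def connectionCoeff {ι : Type*}
    (b : Module.Basis ι ℝ (GroupLieAlgebra 𝓘(ℝ, EG) G))
    (Φ : (z : Q) → TangentSpace 𝓘(ℝ, EQ) z →ₗ[ℝ] GroupLieAlgebra 𝓘(ℝ, EG) G) (p : Q × X) (a : ι)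
    (η : TangentSpace (𝓘(ℝ, EQ).prod 𝓘(ℝ, EX)) p) : ℝ :=
  b.coord a (Φ p.1 (mfderiv (𝓘(ℝ, EQ).prod 𝓘(ℝ, EX)) 𝓘(ℝ, EQ) Prod.fst p η))

/-- The value at `p = (z, x)` of the pullback to `Q × X` of the `2`-form `ω^a` on `Q`, where
`ω = ω^a e_a` is the curvature of `Φ`. -/
noncomputable def curvatureCoeff {ι : Type*} [IsManifold 𝓘(ℝ, EQ) ∞ Q]
    (b : Module.Basis ι ℝ (GroupLieAlgebra 𝓘(ℝ, EG) G))
    (Φ : (z : Q) → TangentSpace 𝓘(ℝ, EQ) z →ₗ[ℝ] GroupLieAlgebra 𝓘(ℝ, EG) G) (p : Q × X) (a : ι)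
    (η ζ : TangentSpace (𝓘(ℝ, EQ).prod 𝓘(ℝ, EX)) p) : ℝ :=
  b.coord a (curvatureForm Φ p.1
    (mfderiv (𝓘(ℝ, EQ).prod 𝓘(ℝ, EX)) 𝓘(ℝ, EQ) Prod.fst p η)
    (mfderiv (𝓘(ℝ, EQ).prod 𝓘(ℝ, EX)) 𝓘(ℝ, EQ) Prod.fst p ζ))

variable (ES) in
/-- The value at `p = (z, x)` of the pullback to `Q × X` of the Frobenius tensor `T` of
`π : X → S`. -/
noncomputable def frobeniusPullback (π : X → S)
    (Hor : (x : X) → Submodule ℝ (TangentSpace 𝓘(ℝ, EX) x)) (p : Q × X)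
    (η ζ : TangentSpace (𝓘(ℝ, EQ).prod 𝓘(ℝ, EX)) p) :
    verticalSpace 𝓘(ℝ, EX) 𝓘(ℝ, ES) π p.2 :=
  frobeniusTensor 𝓘(ℝ, EX) (verticalSpace 𝓘(ℝ, EX) 𝓘(ℝ, ES) π) Hor p.2
    (mfderiv (𝓘(ℝ, EQ).prod 𝓘(ℝ, EX)) 𝓘(ℝ, EX) Prod.snd p η)
    (mfderiv (𝓘(ℝ, EQ).prod 𝓘(ℝ, EX)) 𝓘(ℝ, EX) Prod.snd p ζ)

variable (ES) in
/-- The vertical projection `P ξ_a` of the vector field `ξ_a` on `X` generated by `e_a`. -/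
noncomputable def verticalGenerator {ι : Type*}
    (b : Module.Basis ι ℝ (GroupLieAlgebra 𝓘(ℝ, EG) G)) (π : X → S)
    (Hor : (x : X) → Submodule ℝ (TangentSpace 𝓘(ℝ, EX) x)) (x : X) (a : ι) :
    verticalSpace 𝓘(ℝ, EX) 𝓘(ℝ, ES) π x :=
  projAlong (verticalSpace 𝓘(ℝ, EX) 𝓘(ℝ, ES) π x) (Hor x) (actionField x (b a))

variable (ES) in
/-- The form `T - φ^a ι_a T + ½ φ^a φ^b ι_b ι_a T - ω^a P ξ_a` on `Q × X`, with values in the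
vertical tangent bundle `T(X/S)`, at the point `p`. -/
noncomputable def frobeniusRHS {ι : Type*} [Fintype ι] [IsManifold 𝓘(ℝ, EQ) ∞ Q]
    (b : Module.Basis ι ℝ (GroupLieAlgebra 𝓘(ℝ, EG) G))
    (Φ : (z : Q) → TangentSpace 𝓘(ℝ, EQ) z →ₗ[ℝ] GroupLieAlgebra 𝓘(ℝ, EG) G) (π : X → S)
    (Hor : (x : X) → Submodule ℝ (TangentSpace 𝓘(ℝ, EX) x)) (p : Q × X)
    (η ζ : TangentSpace (𝓘(ℝ, EQ).prod 𝓘(ℝ, EX)) p) :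
    verticalSpace 𝓘(ℝ, EX) 𝓘(ℝ, ES) π p.2 :=
  frobeniusFormula (connectionCoeff b Φ p) (curvatureCoeff b Φ p)
    (fun a => generatingField p (b a)) (frobeniusPullback ES π Hor p)
    (verticalGenerator ES b π Hor p.2) η ζ

end Family

section Clifford

variable {EG : Type*} [NormedAddCommGroup EG] [NormedSpace ℝ EG]
  {EQ : Type*} [NormedAddCommGroup EQ] [NormedSpace ℝ EQ]
  {EM : Type*} [NormedAddCommGroup EM] [NormedSpace ℝ EM]
  {EX : Type*} [NormedAddCommGroup EX] [NormedSpace ℝ EX]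
  {ES : Type*} [NormedAddCommGroup ES] [NormedSpace ℝ ES]
  {G : Type*} [TopologicalSpace G] [ChartedSpace EG G] [Group G]
  {Q : Type*} [TopologicalSpace Q] [ChartedSpace EQ Q] [MulAction Gᵐᵒᵖ Q]
  {M : Type*} [TopologicalSpace M] [ChartedSpace EM M] [IsManifold 𝓘(ℝ, EM) ∞ M]
  {X : Type*} [TopologicalSpace X] [ChartedSpace EX X] [IsManifold 𝓘(ℝ, EX) ∞ X]
  [MulAction G X] [ContMDiffSMul 𝓘(ℝ, EG) 𝓘(ℝ, EX) ∞ G X]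
  {S : Type*} [TopologicalSpace S] [ChartedSpace ES S] [IsManifold 𝓘(ℝ, ES) ∞ S]
  [MulAction G S] [ContMDiffSMul 𝓘(ℝ, EG) 𝓘(ℝ, ES) ∞ G S]

variable (EX ES G) in
/-- A `G`-equivariant module `E → X` over the vertical Clifford algebra of `π : X → S`: a
`G`-invariant metric on `T(X/S)`, complex vector spaces `E x` with a linear `G`-action covering
that on `X`, and a `G`-equivariant Clifford multiplication `c` with `c(v)² = -|v|²` (which, by the
universal property of the Clifford algebra, is the same as a module structure over it). -/
structure EquivariantCliffordModule (π : X → S) (E : X → Type*)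
    [∀ x, AddCommGroup (E x)] [∀ x, Module ℂ (E x)] where
  metric : (x : X) → LinearMap.BilinForm ℝ (verticalSpace 𝓘(ℝ, EX) 𝓘(ℝ, ES) π x)
  metric_symm : ∀ x v w, metric x v w = metric x w v
  metric_pos : ∀ x v, v ≠ 0 → 0 < metric x v v
  metric_invariant : ∀ (g : G) (x : X) (v w : verticalSpace 𝓘(ℝ, EX) 𝓘(ℝ, ES) π x)
    (v' w' : verticalSpace 𝓘(ℝ, EX) 𝓘(ℝ, ES) π (g • x)),
    (v' : TangentSpace 𝓘(ℝ, EX) (g • x))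
      = mfderiv 𝓘(ℝ, EX) 𝓘(ℝ, EX) (fun x' : X => g • x') x v →
    (w' : TangentSpace 𝓘(ℝ, EX) (g • x))
      = mfderiv 𝓘(ℝ, EX) 𝓘(ℝ, EX) (fun x' : X => g • x') x w →
    metric (g • x) v' w' = metric x v w
  act : (g : G) → (x : X) → E x →ₗ[ℂ] E (g • x)
  act_one : ∀ (x : X) (e : E x), (⟨(1 : G) • x, act 1 x e⟩ : Σ x, E x) = ⟨x, e⟩
  act_mul : ∀ (g h : G) (x : X) (e : E x), (⟨(g * h) • x, act (g * h) x e⟩ : Σ x, E x)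
    = ⟨g • h • x, act g (h • x) (act h x e)⟩
  c : (x : X) → verticalSpace 𝓘(ℝ, EX) 𝓘(ℝ, ES) π x →ₗ[ℝ] Module.End ℂ (E x)
  c_sq : ∀ x v (e : E x), c x v (c x v e) = -((metric x v v : ℂ) • e)
  c_equivariant : ∀ (g : G) (x : X) (v : verticalSpace 𝓘(ℝ, EX) 𝓘(ℝ, ES) π x)
    (v' : verticalSpace 𝓘(ℝ, EX) 𝓘(ℝ, ES) π (g • x)) (e : E x),
    (v' : TangentSpace 𝓘(ℝ, EX) (g • x))
      = mfderiv 𝓘(ℝ, EX) 𝓘(ℝ, EX) (fun x' : X => g • x') x v →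
    act g x (c x v e) = c (g • x) v' (act g x e)

variable {π : X → S} {E : X → Type*} [∀ x, AddCommGroup (E x)] [∀ x, Module ℂ (E x)]

/-- The total space of `E → X`. -/
def EquivariantCliffordModule.Total (_C : EquivariantCliffordModule EX ES G π E) : Type _ :=
  Σ x, E x

/-- The action of `G` on the total space of `E → X`. -/
instance EquivariantCliffordModule.mulAction (C : EquivariantCliffordModule EX ES G π E) :
    MulAction G C.Total where
  smul g e := ⟨g • e.1, C.act g e.1 e.2⟩
  one_smul e := C.act_one e.1 e.2
  mul_smul g h e := C.act_mul g h e.1 e.2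

variable {r : Q → M} (hr : IsPrincipalBundle EG EQ EM G r)
  {Hor : (x : X) → Submodule ℝ (TangentSpace 𝓘(ℝ, EX) x)}
  (hπ : IsEquivariantFamily EX ES G π Hor) (C : EquivariantCliffordModule EX ES G π E)

/-- The vector bundle `E_Q = Q ×_G E → X_Q`. -/
abbrev EquivariantCliffordModule.TotalQ : Type _ := AssocSpace hr C.Total

/-- The class `[z, e]` in `E_Q` of `z ∈ Q` and `e ∈ E x`. -/
def EquivariantCliffordModule.mkQ (p : Q × X) (e : E p.2) : C.TotalQ hr :=
  AssocSpace.mk hr ((p.1, ⟨p.2, e⟩) : Q × C.Total)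

open Classical in
/-- The Clifford multiplication of `T(X_Q/S_Q)` on `E_Q`: for `w ∈ T(X_Q/S_Q)` and `s ∈ E_Q` over
the same point `[z, x]` of `X_Q`, lift `w` to `v ∈ T(X/S)_x` and `s = [z, e]` with `e ∈ E x`, and
set `w · s = [z, c(v) e]` (and `w · s = s` if `w` and `s` lie over different points). -/
noncomputable def EquivariantCliffordModule.cQ (y : AssocSpace hr X) (w : verticalQ hr hπ y)
    (s : C.TotalQ hr) : C.TotalQ hr :=
  if h : ∃ (t : C.TotalQ hr) (p : Q × X) (v : verticalSpace 𝓘(ℝ, EX) 𝓘(ℝ, ES) π p.2) (e : E p.2),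
      (⟨y, w⟩ : TangentBundle (𝓘(ℝ, EM).prod 𝓘(ℝ, EX)) (AssocSpace hr X))
        = ⟨AssocSpace.mk hr p, fiberDeriv hr p v⟩ ∧
      s = C.mkQ hr p e ∧ t = C.mkQ hr p (C.c p.2 v e)
  then h.choose else s

/-- The form `c(T) - φ^a ι_a c(T) + ½ φ^a φ^b ι_b ι_a c(T) - ω^a c(P ξ_a)` on `Q × X`, with
values in the endomorphisms of `E`, at the point `p`. -/
noncomputable def EquivariantCliffordModule.frobeniusRHS {ι : Type*} [Fintype ι]
    [IsManifold 𝓘(ℝ, EQ) ∞ Q] (b : Module.Basis ι ℝ (GroupLieAlgebra 𝓘(ℝ, EG) G))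
    (Φ : (z : Q) → TangentSpace 𝓘(ℝ, EQ) z →ₗ[ℝ] GroupLieAlgebra 𝓘(ℝ, EG) G)
    (Hor : (x : X) → Submodule ℝ (TangentSpace 𝓘(ℝ, EX) x)) (p : Q × X)
    (η ζ : TangentSpace (𝓘(ℝ, EQ).prod 𝓘(ℝ, EX)) p) : Module.End ℂ (E p.2) :=
  frobeniusFormula (connectionCoeff b Φ p) (curvatureCoeff b Φ p)
    (fun a => generatingField p (b a))
    (fun η' ζ' => C.c p.2 (frobeniusPullback ES π Hor p η' ζ'))
    (fun a => C.c p.2 (verticalGenerator ES b π Hor p.2 a)) η ζ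

end Clifford

/-! Both sides are evaluated on `η`, `ζ` through a single Lie bracket on `Q × X`.

Write `w_Q`, `w_X` for the components of a tangent vector `w` of `Q × X` and `σ(w) = w_X -
ξ_{Φ(w_Q)}` (`connectionShift`). Then `w` is the sum of a vector in `V ⊕ H` (`horizontalPart`), of
`(0, P σ(w))`, and of the generating vector of `Φ(w_Q)`. The derivative of `q` kills the last
summand, and its kernel consists of generating vectors only. Hence `H_Q` is a complement of the
vertical space, and `P_Q q_* w` is the image of `P σ(w)` under the identification
(`projAlong_verticalQ_mfderiv_mk`).

The Frobenius tensor is `dP(h·, h·)`, with `P` read locally as a vector-valued `1`-form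
(`frobeniusTensor_eq_formDeriv`), and likewise `ω` is `dΦ` on horizontal parts (`curvatureForm_eq`).
Cartan's formula holds for the pullback under any map `f` (`formDeriv_mfderiv`), so if `f_* U` and
`f_* V` are horizontal, then `dP(f_* U, f_* V) = -P f_* [U, V]`. The fields `U`, `V` need not be
`f`-related to anything.

Extend `η`, `ζ`, take the parts in `V ⊕ H`, and let `B` be the bracket of the resulting fields. The
maps `q`, `pr_X`, `pr_Q` give `T_Q = -P_Q q_* B`, `T(ση, σζ) = -P B_X` and `ω(η, ζ) = -Φ(B_Q)`.
Therefore `T_Q = -P(B_X - ξ_{Φ(B_Q)}) = T(ση, σζ) - P ξ_{ω(η, ζ)}` (`frobeniusQ_mfderiv_mk`), and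
expanding the alternating bilinear `T` gives the stated form (`frobeniusFormula_eq`,
`frobeniusRHS_eq`).

Horizontality holds because `σ` and `ω` annihilate generating vectors. Invariance needs no
computation: the right-hand side is a pullback under `q`, and the identification of vertical spaces
is injective and compatible with translation. The Clifford formula follows by applying the linear
map `c`, once the multiplication on `E_Q` is known not to depend on representatives (`cQ_mk`). -/

set_option linter.unusedSectionVars false

/-! ### Smooth vector fields along a map. -/

section TangentAlong

open Bundle

variable {EZ : Type*} [NormedAddCommGroup EZ] [NormedSpace ℝ EZ]
  {HZ : Type*} [TopologicalSpace HZ] {J : ModelWithCorners ℝ EZ HZ}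
  {Z : Type*} [TopologicalSpace Z] [ChartedSpace HZ Z]
  {E : Type*} [NormedAddCommGroup E] [NormedSpace ℝ E]
  {H : Type*} [TopologicalSpace H] {I : ModelWithCorners ℝ E H}
  {X : Type*} [TopologicalSpace X] [ChartedSpace H X] [IsManifold I ∞ X]
  {E' : Type*} [NormedAddCommGroup E'] [NormedSpace ℝ E']
  {H' : Type*} [TopologicalSpace H'] {I' : ModelWithCorners ℝ E' H'}
  {X' : Type*} [TopologicalSpace X'] [ChartedSpace H' X'] [IsManifold I' ∞ X']
  {F : Type*} [NormedAddCommGroup F] [NormedSpace ℝ F]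
  {z₀ : Z} {b : Z → X}

/-- Smoothness of a vector field along a map, read in the trivialization of the tangent bundle. -/
theorem contMDiffAt_along_iff {s : (z : Z) → TangentSpace I (b z)}
    (hb : ContMDiffAt J I ∞ b z₀) :
    ContMDiffAt J I.tangent ∞ (fun z => (⟨b z, s z⟩ : TangentBundle I X)) z₀ ↔
      ContMDiffAt J 𝓘(ℝ, E) ∞ (fun z =>
        (trivializationAt E (TangentSpace I) (b z₀)).continuousLinearMapAt ℝ (b z) (s z)) z₀ := by
  rw [contMDiffAt_totalSpace]
  refine ⟨fun h => ?_, fun h => ⟨hb, ?_⟩⟩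
  · refine h.2.congr_of_eventuallyEq ?_
    filter_upwards [hb.continuousAt.preimage_mem_nhds
      ((trivializationAt E (TangentSpace I) (b z₀)).open_baseSet.mem_nhds
        (FiberBundle.mem_baseSet_trivializationAt' (b z₀)))] with z hz
    exact Trivialization.continuousLinearMapAt_apply_of_mem ℝ _ hz _
  · refine h.congr_of_eventuallyEq ?_
    filter_upwards [hb.continuousAt.preimage_mem_nhds
      ((trivializationAt E (TangentSpace I) (b z₀)).open_baseSet.mem_nhds
        (FiberBundle.mem_baseSet_trivializationAt' (b z₀)))] with z hz
    exact (Trivialization.continuousLinearMapAt_apply_of_mem ℝ _ hz _).symm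

theorem ContMDiffAt.base_along {s : (z : Z) → TangentSpace I (b z)}
    (hs : ContMDiffAt J I.tangent ∞ (fun z => (⟨b z, s z⟩ : TangentBundle I X)) z₀) :
    ContMDiffAt J I ∞ b z₀ :=
  (contMDiffAt_totalSpace.1 hs).1

theorem ContMDiffAt.add_along {s t : (z : Z) → TangentSpace I (b z)}
    (hs : ContMDiffAt J I.tangent ∞ (fun z => (⟨b z, s z⟩ : TangentBundle I X)) z₀)
    (ht : ContMDiffAt J I.tangent ∞ (fun z => (⟨b z, t z⟩ : TangentBundle I X)) z₀) :
    ContMDiffAt J I.tangent ∞ (fun z => (⟨b z, s z + t z⟩ : TangentBundle I X)) z₀ := by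
  have hb := hs.base_along
  rw [contMDiffAt_along_iff hb] at hs ht ⊢
  simp only [map_add]
  exact hs.add ht

theorem ContMDiffAt.neg_along {s : (z : Z) → TangentSpace I (b z)}
    (hs : ContMDiffAt J I.tangent ∞ (fun z => (⟨b z, s z⟩ : TangentBundle I X)) z₀) :
    ContMDiffAt J I.tangent ∞ (fun z => (⟨b z, -s z⟩ : TangentBundle I X)) z₀ := by
  have hb := hs.base_along
  rw [contMDiffAt_along_iff hb] at hs ⊢
  simp only [map_neg]
  exact hs.neg

theorem ContMDiffAt.sub_along {s t : (z : Z) → TangentSpace I (b z)}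
    (hs : ContMDiffAt J I.tangent ∞ (fun z => (⟨b z, s z⟩ : TangentBundle I X)) z₀)
    (ht : ContMDiffAt J I.tangent ∞ (fun z => (⟨b z, t z⟩ : TangentBundle I X)) z₀) :
    ContMDiffAt J I.tangent ∞ (fun z => (⟨b z, s z - t z⟩ : TangentBundle I X)) z₀ := by
  simpa only [sub_eq_add_neg] using hs.add_along ht.neg_along

theorem ContMDiffAt.sum_smul_along {ι : Type*} [Fintype ι] {c : ι → Z → ℝ}
    {s : ι → (z : Z) → TangentSpace I (b z)} (hb : ContMDiffAt J I ∞ b z₀)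
    (hc : ∀ i, ContMDiffAt J 𝓘(ℝ, ℝ) ∞ (c i) z₀)
    (hs : ∀ i, ContMDiffAt J I.tangent ∞ (fun z => (⟨b z, s i z⟩ : TangentBundle I X)) z₀) :
    ContMDiffAt J I.tangent ∞ (fun z => (⟨b z, ∑ i, c i z • s i z⟩ : TangentBundle I X)) z₀ := by
  simp only [contMDiffAt_along_iff hb] at hs ⊢
  simp only [map_sum, map_smul]
  exact contMDiffAt_finsetSum fun i _ => (hc i).smul (hs i)

theorem ContMDiffAt.zero_along (hb : ContMDiffAt J I ∞ b z₀) :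
    ContMDiffAt J I.tangent ∞
      (fun z => (⟨b z, (0 : TangentSpace I (b z))⟩ : TangentBundle I X)) z₀ := by
  rw [contMDiffAt_along_iff hb]
  simp only [map_zero]
  exact contMDiffAt_const

/-- The derivative of a smooth `f`, read in coordinates, depends smoothly on the base point. Most
fields needed later are obtained in this way, as the derivative of a smooth map applied to a simpler
field. -/
theorem ContMDiffAt.mfderiv_along {f : X → X'} {s : (z : Z) → TangentSpace I (b z)}
    (hf : ContMDiffAt I I' ∞ f (b z₀))
    (hs : ContMDiffAt J I.tangent ∞ (fun z => (⟨b z, s z⟩ : TangentBundle I X)) z₀) :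
    ContMDiffAt J I'.tangent ∞
      (fun z => (⟨f (b z), mfderiv I I' f (b z) (s z)⟩ : TangentBundle I' X')) z₀ := by
  have hb := hs.base_along
  have h := (hf.mfderiv_const (m := ∞) le_rfl).comp z₀ hb
  exact ContMDiffAt.clm_apply_of_inCoordinates (b₁ := b) (b₂ := fun z => f (b z))
    (ϕ := fun z => mfderiv I I' f (b z)) h hs (hf.comp z₀ hb)

theorem ContMDiffAt.mvfderiv_along {f : X → F} {s : (z : Z) → TangentSpace I (b z)}
    (hf : ContMDiffAt I 𝓘(ℝ, F) ∞ f (b z₀))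
    (hs : ContMDiffAt J I.tangent ∞ (fun z => (⟨b z, s z⟩ : TangentBundle I X)) z₀) :
    ContMDiffAt J 𝓘(ℝ, F) ∞ (fun z => mvfderiv I f (b z) (s z)) z₀ := by
  have h := hf.mfderiv_along hs
  have hb : ContMDiffAt J 𝓘(ℝ, F) ∞ (fun z => f (b z)) z₀ := hf.comp z₀ hs.base_along
  rw [contMDiffAt_along_iff hb] at h
  simp only [TangentBundle.continuousLinearMapAt_model_space] at h
  exact h

theorem ContMDiffAt.prodMk_along {b' : Z → X'} {s : (z : Z) → TangentSpace I (b z)}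
    {s' : (z : Z) → TangentSpace I' (b' z)}
    (hs : ContMDiffAt J I.tangent ∞ (fun z => (⟨b z, s z⟩ : TangentBundle I X)) z₀)
    (hs' : ContMDiffAt J I'.tangent ∞ (fun z => (⟨b' z, s' z⟩ : TangentBundle I' X')) z₀) :
    ContMDiffAt J (I.prod I').tangent ∞
      (fun z => (⟨(b z, b' z), (s z, s' z)⟩ : TangentBundle (I.prod I') (X × X'))) z₀ :=
  (contMDiff_equivTangentBundleProd_symm (n := ∞) (I := I) (I' := I') (M := X)
    (M' := X')).contMDiffAt.comp z₀ (hs.prodMk hs')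

theorem contMDiffAt_extend_along {x : X} (v : TangentSpace I x) :
    ContMDiffAt I I.tangent ∞
      (fun y => (⟨y, FiberBundle.extend E v y⟩ : TangentBundle I X)) x :=
  FiberBundle.contMDiffAt_extend (k := ∞) I E v

end TangentAlong

/-! ### The Lie bracket as a commutator of derivations. -/

section BracketCalculus

open Filter Set VectorField

variable {E : Type*} [NormedAddCommGroup E] [NormedSpace ℝ E] [CompleteSpace E]
  {H : Type*} [TopologicalSpace H] {I : ModelWithCorners ℝ E H} [I.Boundaryless]
  {X : Type*} [TopologicalSpace X] [ChartedSpace H X] [IsManifold I ∞ X]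
  {F : Type*} [NormedAddCommGroup F] [NormedSpace ℝ F]

/-- In the chart at `x` the field becomes its pullback and `g` becomes a function on `E`: the
inverse in the definition of the pullback cancels the derivative of the inverse chart. This reduces
second derivatives of `g` to calculus in `E`. -/
theorem mvfderiv_apply_extChartAt_symm {g : X → F} {x : X} (hg : ContMDiffAt I 𝓘(ℝ, F) 2 g x)
    (V : (x : X) → TangentSpace I x) :
    (fun y => mvfderiv I g ((extChartAt I x).symm y) (V ((extChartAt I x).symm y)))
      =ᶠ[𝓝 (extChartAt I x x)] fun y => fderiv ℝ (g ∘ (extChartAt I x).symm) y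
        (mpullbackWithin 𝓘(ℝ, E) I (extChartAt I x).symm V (range I) y) := by
  have h1 : ∀ᶠ y in 𝓝 (extChartAt I x x), MDifferentiableAt I 𝓘(ℝ, F) g
      ((extChartAt I x).symm y) := by
    have := ((contMDiffAt_iff_contMDiffAt_nhds (by simp)).1 hg).mono
      fun n hn => hn.mdifferentiableAt two_ne_zero
    exact (continuousAt_extChartAt_symm x).eventually (by simpa using this)
  filter_upwards [h1, extChartAt_target_mem_nhds x] with y hy hyt
  have hs := mdifferentiableWithinAt_extChartAt_symm (I := I) hyt
  have hi := isInvertible_mfderivWithin_extChartAt_symm (I := I) hyt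
  have hc := mfderiv_comp_mfderivWithin y hy hs (by
    rw [I.range_eq_univ]; exact uniqueMDiffWithinAt_univ _)
  have hc' : fderiv ℝ (g ∘ (extChartAt I x).symm) y = (mfderiv I 𝓘(ℝ, F) g _).comp
      (mfderivWithin 𝓘(ℝ, E) I (extChartAt I x).symm (range I) y) := by
    rw [← hc, I.range_eq_univ, mfderivWithin_univ, mfderiv_eq_fderiv]
  refine Eq.trans ?_ (DFunLike.congr_fun hc' _).symm
  exact (congrArg (mfderiv I 𝓘(ℝ, F) g _) (hi.self_apply_inverse _)).symm

theorem differentiableAt_mpullbackWithin_extChartAt_symm {x : X} {V : (x : X) → TangentSpace I x}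
    (hV : MDifferentiableAt I I.tangent (fun y => (⟨y, V y⟩ : TangentBundle I X)) x) :
    DifferentiableAt ℝ (F := E) (mpullbackWithin 𝓘(ℝ, E) I (extChartAt I x).symm V (range I))
      (extChartAt I x x) := by
  have := (mdifferentiableWithinAt_univ.2
    hV).differentiableWithinAt_mpullbackWithin_vectorField
  have hs : (extChartAt I x).symm ⁻¹' univ ∩ range I = univ := by
    rw [I.range_eq_univ, preimage_univ, univ_inter]
  exact differentiableWithinAt_univ.1 (this.mono hs.ge)

theorem contDiffAt_comp_extChartAt_symm {g : X → F} {x : X} {n : WithTop ℕ∞}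
    (hg : ContMDiffAt I 𝓘(ℝ, F) n g x) :
    ContDiffAt ℝ n (g ∘ (extChartAt I x).symm) (extChartAt I x x) := by
  have h := (contMDiffAt_iff.1 hg).2
  rw [I.range_eq_univ] at h
  exact contDiffWithinAt_univ.1 h

theorem mdifferentiableAt_of_comp_extChartAt_symm {g : X → F} {x : X}
    (hg : DifferentiableAt ℝ (g ∘ (extChartAt I x).symm) (extChartAt I x x)) :
    MDifferentiableAt I 𝓘(ℝ, F) g x :=
  mdifferentiableWithinAt_univ.1
    (DifferentiableWithinAt.mdifferentiableWithinAt_of_comp_extChartAt_symm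
      hg.differentiableWithinAt)

theorem mdifferentiableAt_mvfderiv_apply {g : X → F} {x : X} (hg : ContMDiffAt I 𝓘(ℝ, F) 2 g x)
    {V : (x : X) → TangentSpace I x}
    (hV : MDifferentiableAt I I.tangent (fun y => (⟨y, V y⟩ : TangentBundle I X)) x) :
    MDifferentiableAt I 𝓘(ℝ, F) (fun y => mvfderiv I g y (V y)) x := by
  refine mdifferentiableAt_of_comp_extChartAt_symm ?_
  refine DifferentiableAt.congr_of_eventuallyEq ?_ (mvfderiv_apply_extChartAt_symm hg V)
  exact (((contDiffAt_comp_extChartAt_symm hg).fderiv_right (m := 1)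
    (by norm_num)).differentiableAt one_ne_zero).clm_apply
      (differentiableAt_mpullbackWithin_extChartAt_symm hV)

theorem mvfderiv_eq_fderiv_extChartAt {g : X → F} {x : X} (hg : MDifferentiableAt I 𝓘(ℝ, F) g x)
    (v : TangentSpace I x) :
    mvfderiv I g x v = fderiv ℝ (g ∘ (extChartAt I x).symm) (extChartAt I x x) v := by
  rw [hg.mvfderiv, I.range_eq_univ, fderivWithin_univ]
  rfl

/-- The Lie bracket of vector fields acts on functions as the commutator. -/
theorem mvfderiv_mlieBracket {g : X → F} {x : X} (hg : ContMDiffAt I 𝓘(ℝ, F) 2 g x)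
    {U V : (x : X) → TangentSpace I x}
    (hU : MDifferentiableAt I I.tangent (fun y => (⟨y, U y⟩ : TangentBundle I X)) x)
    (hV : MDifferentiableAt I I.tangent (fun y => (⟨y, V y⟩ : TangentBundle I X)) x) :
    mvfderiv I g x (mlieBracket I U V x) =
      mvfderiv I (fun y => mvfderiv I g y (V y)) x (U x)
        - mvfderiv I (fun y => mvfderiv I g y (U y)) x (V x) := by
  set U' : E → E := mpullbackWithin 𝓘(ℝ, E) I (extChartAt I x).symm U (range I) with hU'
  set V' : E → E := mpullbackWithin 𝓘(ℝ, E) I (extChartAt I x).symm V (range I) with hV'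
  set G := g ∘ (extChartAt I x).symm with hG
  set y := extChartAt I x x with hy
  -- The chart at `x` has identity derivative at `x` itself, so the pulled-back fields keep their
  -- values there.
  have hval : ∀ W : (x : X) → TangentSpace I x,
      (mpullbackWithin 𝓘(ℝ, E) I (extChartAt I x).symm W (range I) y : E) = W x := by
    intro W
    have h2 : (extChartAt I x).symm y = x := extChartAt_to_inv x
    have h3 : (fun z => (W z : E)) ((extChartAt I x).symm y) = (fun z => (W z : E)) x := by rw [h2]
    exact (congrArg (fun e : E => (mfderivWithin 𝓘(ℝ, E) I (extChartAt I x).symm (range I)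
      (extChartAt I x x)).inverse e) h3).trans
      (mfderivWithin_extChartAt_symm_inverse_apply (I := I) (W x))
  have hbr : (mlieBracket I U V x : E) = fderiv ℝ V' y (U' y) - fderiv ℝ U' y (V' y) := by
    have h2 : ∀ w : E, (mfderiv I 𝓘(ℝ, E) (extChartAt I x) x).inverse w = w := fun w =>
      (isInvertible_mfderiv_extChartAt (mem_extChartAt_source x)).inverse_apply_eq.2
        (DFunLike.congr_fun (mfderiv_extChartAt_self (I := I) (x := x)) w).symm
    refine (h2 _).trans ?_
    have hs : (extChartAt I x).symm ⁻¹' univ ∩ range I = univ := by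
      rw [I.range_eq_univ, preimage_univ, univ_inter]
    change lieBracketWithin ℝ U' V' ((extChartAt I x).symm ⁻¹' univ ∩ range I) y = _
    rw [hs, lieBracketWithin_univ]
    rfl
  have hG1 : DifferentiableAt ℝ (fderiv ℝ G) y :=
    ((contDiffAt_comp_extChartAt_symm hg).fderiv_right (m := 1)
      (by norm_num)).differentiableAt one_ne_zero
  -- Product rule in the chart: a second derivative of `G` plus `dG` applied to the derivative of
  -- the field.
  have hterm : ∀ W W' : (x : X) → TangentSpace I x,
      MDifferentiableAt I I.tangent (fun y => (⟨y, W y⟩ : TangentBundle I X)) x →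
      mvfderiv I (fun y => mvfderiv I g y (W y)) x (W' x) =
        fderiv ℝ (fderiv ℝ G) y (W' x) (W x) + fderiv ℝ G y (fderiv ℝ (F := E)
          (mpullbackWithin 𝓘(ℝ, E) I (extChartAt I x).symm W (range I)) y (W' x)) := by
    intro W W' hW
    rw [mvfderiv_eq_fderiv_extChartAt (mdifferentiableAt_mvfderiv_apply hg hW)]
    have he : fderiv ℝ ((fun y => mvfderiv I g y (W y)) ∘ (extChartAt I x).symm) y = _ :=
      (mvfderiv_apply_extChartAt_symm hg W).fderiv_eq
    refine (DFunLike.congr_fun he (W' x)).trans ?_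
    have := fderiv_clm_apply hG1 (differentiableAt_mpullbackWithin_extChartAt_symm hW)
    refine (DFunLike.congr_fun this (W' x)).trans ?_
    refine (add_comm _ _).trans ?_
    refine congrArg₂ (· + ·) ?_ rfl
    exact congrArg (fderiv ℝ (fderiv ℝ G) y (W' x)) (hval W)
  rw [hterm V U hV, hterm U V hU, mvfderiv_eq_fderiv_extChartAt
    (hg.mdifferentiableAt two_ne_zero)]
  refine (congrArg (fderiv ℝ G y) hbr).trans ?_
  -- The second-derivative terms cancel in the commutator by symmetry, leaving `dG` applied to the
  -- coordinate bracket.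
  have hsymm : fderiv ℝ (fderiv ℝ G) y (U x) (V x) = fderiv ℝ (fderiv ℝ G) y (V x) (U x) :=
    (contDiffAt_comp_extChartAt_symm hg).isSymmSndFDerivAt (by simp) (U x) (V x)
  refine (map_sub (fderiv ℝ G y) _ _).trans ?_
  have hU2 : (U' y : E) = U x := hval U
  have hV2 : (V' y : E) = V x := hval V
  rw [hU2, hV2, hsymm]
  exact (add_sub_add_left_eq_sub _ _ _).symm

end BracketCalculus

/-! ### Exterior derivative of a `1`-form and Cartan's formula for pullbacks. -/

section OneForm

open Filter Set VectorField Bundle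

variable {E : Type*} [NormedAddCommGroup E] [NormedSpace ℝ E] [FiniteDimensional ℝ E]
  {H : Type*} [TopologicalSpace H] {I : ModelWithCorners ℝ E H}
  {Y : Type*} [TopologicalSpace Y] [ChartedSpace H Y] [IsManifold I ∞ Y]
  {F : Type*} [NormedAddCommGroup F] [NormedSpace ℝ F]

section

variable {K : Type*} [NormedAddCommGroup K] [NormedSpace ℝ K]
  {L : Type*} [TopologicalSpace L] {J : ModelWithCorners ℝ K L}
  {N : Type*} [TopologicalSpace N] [ChartedSpace L N]

theorem MDifferentiableAt.hasMVFDerivAt_sum {κ : Type*} (s : Finset κ) {h : κ → N → F} {p : N}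
    (hh : ∀ j, MDifferentiableAt J 𝓘(ℝ, F) (h j) p) :
    MDifferentiableAt J 𝓘(ℝ, F) (fun n => ∑ j ∈ s, h j n) p ∧ ∀ w,
      mvfderiv J (fun n => ∑ j ∈ s, h j n) p w = ∑ j ∈ s, mvfderiv J (h j) p w := by
  classical
  induction s using Finset.induction_on with
  | empty => exact ⟨by simpa using mdifferentiableAt_const, fun w => by simp [mvfderiv_const]⟩
  | insert a s ha ih =>
    simp only [Finset.sum_insert ha]
    exact ⟨(hh a).add ih.1, fun w => by
      rw [mvfderiv_fun_add (hh a) ih.1, add_apply, ih.2]⟩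

theorem mvfderiv_comp_apply' {f : N → Y} {g : Y → F} {p : N}
    (hg : MDifferentiableAt I 𝓘(ℝ, F) g (f p)) (hf : MDifferentiableAt J I f p)
    (w : TangentSpace J p) :
    mvfderiv J (fun n => g (f n)) p w = mvfderiv I g (f p) (mfderiv J I f p w) :=
  mfderiv_comp_apply p hg hf w

end

/-- Near `y` the chosen extension of a vector has constant coordinates in the trivialization at `y`,
so the extended basis vectors form the coordinate frame. -/
theorem extend_eq_symmL {y y' : Y} (hy' : y' ∈ (chartAt H y).source) (v : TangentSpace I y) :
    FiberBundle.extend E v y' = (trivializationAt E (TangentSpace I) y).symmL ℝ y' v := by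
  have h1 : (trivializationAt E (TangentSpace I) y ⟨y, v⟩).2 = v := by
    rw [← Trivialization.continuousLinearMapAt_apply_of_mem ℝ _
      (FiberBundle.mem_baseSet_trivializationAt' y),
      TangentBundle.continuousLinearMapAt_trivializationAt (mem_chart_source H y),
      mfderiv_extChartAt_self]
    rfl
  change (trivializationAt E (TangentSpace I) y).symm y' _ = _
  rw [h1]
  exact (Trivialization.symmL_apply (R := ℝ) (trivializationAt E (TangentSpace I) y)
    (show y' ∈ (trivializationAt E (TangentSpace I) y).baseSet from hy') (v : E)).symm

/-- A coordinate vector of `E`, seen as a tangent vector. -/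
noncomputable def coordVector (I : ModelWithCorners ℝ E H) (y : Y)
    (j : Fin (Module.finrank ℝ E)) : TangentSpace I y :=
  (Module.finBasis ℝ E j : E)

/-- The coordinates of a tangent vector. -/
noncomputable def tangentCoord (I : ModelWithCorners ℝ E H) (y : Y)
    (j : Fin (Module.finrank ℝ E)) : TangentSpace I y →ₗ[ℝ] ℝ :=
  (Module.finBasis ℝ E).coord j

/-- The exterior derivative of a `1`-form, as a bilinear map, in coordinates. -/
noncomputable def formDeriv (α : (y : Y) → TangentSpace I y →ₗ[ℝ] F) (y : Y) :
    TangentSpace I y →ₗ[ℝ] TangentSpace I y →ₗ[ℝ] F :=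
  LinearMap.mk₂ ℝ (fun u v => ∑ j,
    (tangentCoord I y j v •
        mvfderiv I (fun y' => α y' (FiberBundle.extend E (coordVector I y j) y')) y u
      - tangentCoord I y j u •
        mvfderiv I (fun y' => α y' (FiberBundle.extend E (coordVector I y j) y')) y v))
    (fun u u' v => by
      rw [← Finset.sum_add_distrib]
      refine Finset.sum_congr rfl fun j _ => ?_
      simp only [map_add, smul_add, add_smul]; abel)
    (fun c u v => by
      rw [Finset.smul_sum]
      refine Finset.sum_congr rfl fun j _ => ?_
      simp only [map_smul, smul_sub, smul_smul, smul_eq_mul, mul_comm])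
    (fun u v v' => by
      rw [← Finset.sum_add_distrib]
      refine Finset.sum_congr rfl fun j _ => ?_
      simp only [map_add, smul_add, add_smul]; abel)
    (fun c u v => by
      rw [Finset.smul_sum]
      refine Finset.sum_congr rfl fun j _ => ?_
      simp only [map_smul, smul_sub, smul_smul, smul_eq_mul, mul_comm])

/-- The sum is `(∑ da_j ∧ dx_j)(u, v)`, with `a_j` the coefficients of `α` in the coordinate frame
of the chart at `y`. Bilinearity is built in here, while in `extDerivOneForm` it is hidden by the
choice of extensions. -/
theorem formDeriv_apply (α : (y : Y) → TangentSpace I y →ₗ[ℝ] F) (y : Y) (u v : TangentSpace I y) :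
    formDeriv α y u v = ∑ j,
    (tangentCoord I y j v •
        mvfderiv I (fun y' => α y' (FiberBundle.extend E (coordVector I y j) y')) y u
      - tangentCoord I y j u •
        mvfderiv I (fun y' => α y' (FiberBundle.extend E (coordVector I y j) y')) y v) :=
  rfl

/-- This is `α = ∑ a_j dx_j` on the whole chart domain, as needed for differentiating it. -/
theorem form_apply_eq_sum (α : (y : Y) → TangentSpace I y →ₗ[ℝ] F) {y y' : Y}
    (hy' : y' ∈ (chartAt H y).source) (w : TangentSpace I y') :
    α y' w = ∑ j, (Module.finBasis ℝ E).coord j (mvfderiv I (extChartAt I y) y' w) •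
      α y' (FiberBundle.extend E (coordVector I y j) y') := by
  have hb : y' ∈ (trivializationAt E (TangentSpace I) y).baseSet := hy'
  set T := trivializationAt E (TangentSpace I) y
  have h1 : T.symmL ℝ y' (T.continuousLinearMapAt ℝ y' w) = w :=
    T.symmL_continuousLinearMapAt hb w
  have h2 : T.continuousLinearMapAt ℝ y' w = mvfderiv I (extChartAt I y) y' w :=
    DFunLike.congr_fun (TangentBundle.continuousLinearMapAt_trivializationAt (𝕜 := ℝ) hy') w
  rw [h2] at h1
  conv_lhs => rw [← h1, ← (Module.finBasis ℝ E).sum_repr (mvfderiv I (extChartAt I y) y' w)]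
  rw [map_sum, map_sum]
  refine Finset.sum_congr rfl fun j _ => ?_
  rw [map_smul, map_smul, extend_eq_symmL hy']
  rfl

variable {K : Type*} [NormedAddCommGroup K] [NormedSpace ℝ K] [CompleteSpace K]
  {L : Type*} [TopologicalSpace L] {J : ModelWithCorners ℝ K L} [J.Boundaryless]
  {N : Type*} [TopologicalSpace N] [ChartedSpace L N] [IsManifold J ∞ N]

/-- Cartan's formula for the pullback of a `1`-form `α` under a map `f`. -/
theorem formDeriv_mfderiv {α : (y : Y) → TangentSpace I y →ₗ[ℝ] F} {f : N → Y} {p : N}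
    (hα : ∀ e : TangentSpace I (f p),
      MDifferentiableAt I 𝓘(ℝ, F) (fun y' => α y' (FiberBundle.extend E e y')) (f p))
    (hf : ContMDiffAt J I 2 f p) {U V : (n : N) → TangentSpace J n}
    (hU : MDifferentiableAt J J.tangent (fun n => (⟨n, U n⟩ : TangentBundle J N)) p)
    (hV : MDifferentiableAt J J.tangent (fun n => (⟨n, V n⟩ : TangentBundle J N)) p) :
    formDeriv α (f p) (mfderiv J I f p (U p)) (mfderiv J I f p (V p)) =
      mvfderiv J (fun n => α (f n) (mfderiv J I f n (V n))) p (U p)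
        - mvfderiv J (fun n => α (f n) (mfderiv J I f n (U n))) p (V p)
        - α (f p) (mfderiv J I f p (mlieBracket J U V p)) := by
  set B := Module.finBasis ℝ E
  set x : Fin (Module.finrank ℝ E) → Y → ℝ := fun j y' => B.coord j (extChartAt I (f p) y')
  set a : Fin (Module.finrank ℝ E) → Y → F := fun j y' =>
    α y' (FiberBundle.extend E (coordVector I (f p) j) y')
  have hx : ∀ j y', y' ∈ (chartAt H (f p)).source → ∀ w : TangentSpace I y',
      MDifferentiableAt I 𝓘(ℝ, ℝ) (x j) y' ∧
      mvfderiv I (x j) y' w = B.coord j (mvfderiv I (extChartAt I (f p)) y' w) := by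
    intro j y' hy' w
    have h1 : MDifferentiableAt I 𝓘(ℝ, E) (extChartAt I (f p)) y' := mdifferentiableAt_extChartAt hy'
    set c : E →L[ℝ] ℝ := LinearMap.toContinuousLinearMap (B.coord j)
    have h2 : MDifferentiableAt 𝓘(ℝ, E) 𝓘(ℝ, ℝ) c (extChartAt I (f p) y') :=
      c.differentiableAt.mdifferentiableAt
    refine ⟨h2.comp y' h1, ?_⟩
    have h3 := mvfderiv_comp_apply' (g := c) h2 h1 w
    refine h3.trans ?_
    have h4 : mvfderiv 𝓘(ℝ, E) c (extChartAt I (f p) y') = c := by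
      refine Eq.trans ?_ (c.fderiv (x := extChartAt I (f p) y'))
      exact mfderiv_eq_fderiv
    exact DFunLike.congr_fun h4 _
  have hxf : ∀ j, ContMDiffAt J 𝓘(ℝ, ℝ) 2 (fun n => x j (f n)) p := by
    intro j
    have h1 : ContMDiffAt I 𝓘(ℝ, E) 2 (extChartAt I (f p)) (f p) := contMDiffAt_extChartAt
    exact (LinearMap.toContinuousLinearMap (B.coord j)).contDiff.contMDiff.contMDiffAt.comp p
      (h1.comp p hf)
  have hfn : ∀ᶠ n in 𝓝 p, MDifferentiableAt J I f n ∧ f n ∈ (chartAt H (f p)).source :=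
    (((contMDiffAt_iff_contMDiffAt_nhds (by simp)).1 hf).mono
      fun n hn => hn.mdifferentiableAt two_ne_zero).and
      (hf.continuousAt.preimage_mem_nhds (chart_source_mem_nhds H (f p)))
  -- Near `p`, the pullback of `α` is `∑ (a_j ∘ f) d(x_j ∘ f)`. From here on only functions on `N`
  -- are differentiated.
  have hW : ∀ W : (n : N) → TangentSpace J n,
      (fun n => α (f n) (mfderiv J I f n (W n))) =ᶠ[𝓝 p]
        fun n => ∑ j, mvfderiv J (fun n => x j (f n)) n (W n) • a j (f n) := by
    intro W
    filter_upwards [hfn] with n hn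
    rw [form_apply_eq_sum α hn.2]
    refine Finset.sum_congr rfl fun j _ => ?_
    rw [mvfderiv_comp_apply' (hx j _ hn.2 0).1 hn.1, (hx j _ hn.2 _).2]
  have hfp := hf.mdifferentiableAt two_ne_zero
  have hder : ∀ W W' : (n : N) → TangentSpace J n,
      MDifferentiableAt J J.tangent (fun n => (⟨n, W n⟩ : TangentBundle J N)) p →
      mvfderiv J (fun n => α (f n) (mfderiv J I f n (W n))) p (W' p) =
        ∑ j, (mvfderiv J (fun n => mvfderiv J (fun n => x j (f n)) n (W n)) p (W' p) • a j (f p)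
          + mvfderiv J (fun n => x j (f n)) p (W p) •
            mvfderiv I (a j) (f p) (mfderiv J I f p (W' p))) := by
    intro W W' hW0
    have h1 : ∀ j, MDifferentiableAt J 𝓘(ℝ, ℝ)
        (fun n => mvfderiv J (fun n => x j (f n)) n (W n)) p := fun j =>
      mdifferentiableAt_mvfderiv_apply (hxf j) hW0
    have h2 : ∀ j, MDifferentiableAt J 𝓘(ℝ, F) (fun n => a j (f n)) p := fun j =>
      (hα (coordVector I (f p) j)).comp p hfp
    have h3 : mvfderiv J (fun n => α (f n) (mfderiv J I f n (W n))) p = _ :=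
      (hW W).mfderiv_eq
    refine (DFunLike.congr_fun h3 (W' p)).trans ?_
    refine ((MDifferentiableAt.hasMVFDerivAt_sum Finset.univ
      (fun j => (h1 j).smul (h2 j))).2 (W' p)).trans ?_
    refine Finset.sum_congr rfl fun j _ => ?_
    rw [mvfderiv_smul (h1 j) (h2 j), add_apply, smul_apply, ContinuousLinearMap.smulRight_apply, add_comm,
      mvfderiv_comp_apply' (hα (coordVector I (f p) j)) hfp]
  have hbr : α (f p) (mfderiv J I f p (mlieBracket J U V p)) =
      ∑ j : Fin (Module.finrank ℝ E),
        (mvfderiv J (fun n => x j (f n)) p (mlieBracket J U V p) • a j (f p) : F) :=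
    (hW (mlieBracket J U V)).self_of_nhds
  rw [formDeriv_apply, hder V U hV, hder U V hU, hbr, ← Finset.sum_sub_distrib,
    ← Finset.sum_sub_distrib]
  refine Finset.sum_congr rfl fun j _ => ?_
  have hc : ∀ w : TangentSpace J p, mvfderiv J (fun n => x j (f n)) p w =
      tangentCoord I (f p) j (mfderiv J I f p w) := by
    intro w
    rw [mvfderiv_comp_apply' (hx j _ (mem_chart_source H _) 0).1 hfp,
      (hx j _ (mem_chart_source H _) _).2]
    have : mvfderiv I (extChartAt I (f p)) (f p) (mfderiv J I f p w) = mfderiv J I f p w :=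
      DFunLike.congr_fun (mfderiv_extChartAt_self (I := I) (x := f p)) _
    rw [this]
    rfl
  -- The bracket term absorbs the iterated derivatives of `x_j ∘ f`; what is left is the product of
  -- `da_j` and `dx_j`, antisymmetrized.
  rw [mvfderiv_mlieBracket (hxf j) hU hV, hc, hc, sub_smul]
  abel

end OneForm

/-! ### The Frobenius tensor as the exterior derivative of the vertical projection. -/

section Frobenius

open Filter Set VectorField Bundle

section Projection

variable {V : Type*} [AddCommGroup V] [Module ℝ V] {p q : Submodule ℝ V}

theorem projAlong_eq_zero (h : IsCompl p q) {v : V} : projAlong p q v = 0 ↔ v ∈ q := by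
  rw [projAlong, dif_pos h, Submodule.projectionOnto_apply_eq_zero_iff]

theorem projAlong_eq_self (h : IsCompl p q) {v : V} (hv : v ∈ p) :
    (projAlong p q v : V) = v := by
  rw [projAlong, dif_pos h, Submodule.projectionOnto_apply_left h ⟨v, hv⟩]

theorem projAlong_add_projAlong (h : IsCompl p q) (v : V) :
    (projAlong p q v : V) + projAlong q p v = v := by
  have h1 : v - projAlong p q v ∈ q := by
    rw [← projAlong_eq_zero h, map_sub, sub_eq_zero]
    exact Subtype.ext (projAlong_eq_self h (projAlong p q v).2).symm
  have h2 : projAlong q p v = v - projAlong p q v := by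
    have := projAlong_eq_self h.symm h1
    rwa [map_sub, (projAlong_eq_zero h.symm).2 (projAlong p q v).2, sub_zero] at this
  rw [h2]; abel

/-- A decomposition `v = a + b` determines the two projections of `v`. -/
theorem projAlong_eq_of_sub_mem (h : IsCompl p q) {v a : V} (ha : a ∈ p) (hb : v - a ∈ q) :
    (projAlong p q v : V) = a := by
  have h1 := (projAlong_eq_zero h).2 hb
  rw [map_sub, sub_eq_zero] at h1
  rw [h1, projAlong_eq_self h ha]

end Projection

variable {E : Type*} [NormedAddCommGroup E] [NormedSpace ℝ E] [FiniteDimensional ℝ E]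
  {H : Type*} [TopologicalSpace H] {I : ModelWithCorners ℝ E H}
  {Y : Type*} [TopologicalSpace Y] [ChartedSpace H Y] [IsManifold I ∞ Y]
  {F : Type*} [NormedAddCommGroup F] [NormedSpace ℝ F]

theorem mdifferentiableAt_extend' {y : Y} (u : TangentSpace I y) :
    MDifferentiableAt I I.tangent
      (fun y' => (⟨y', FiberBundle.extend E u y'⟩ : TangentBundle I Y)) y :=
  (contMDiffAt_extend_along u).mdifferentiableAt (by simp)

/-- Cartan's formula for the identity map and the extensions used in the definition of
`extDerivOneForm`. -/
theorem extDerivOneForm_eq_formDeriv [I.Boundaryless] {α : (y : Y) → TangentSpace I y →ₗ[ℝ] F}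
    {y : Y} (hα : ∀ e : TangentSpace I y,
      MDifferentiableAt I 𝓘(ℝ, F) (fun y' => α y' (FiberBundle.extend E e y')) y)
    (u v : TangentSpace I y) :
    extDerivOneForm I α y u v = formDeriv α y u v := by
  have h := formDeriv_mfderiv (J := I) (f := fun y : Y => y) (p := y) hα contMDiffAt_id
    (mdifferentiableAt_extend' u) (mdifferentiableAt_extend' v)
  have hid : ∀ (y' : Y) (w : TangentSpace I y'), mfderiv I I (fun y : Y => y) y' w = w :=
    fun y' w => DFunLike.congr_fun mfderiv_id w
  simp only [hid, FiberBundle.extend_apply_self] at h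
  exact h.symm

variable {Ver Hor : (y : Y) → Submodule ℝ (TangentSpace I y)}

/-- The projection onto `Ver` with kernel `Hor`, as a `1`-form near `y` with values in the model
space. -/
noncomputable def projForm (Ver Hor : (y : Y) → Submodule ℝ (TangentSpace I y)) (y y' : Y) :
    TangentSpace I y' →ₗ[ℝ] E :=
  ((trivializationAt E (TangentSpace I) y).continuousLinearMapAt ℝ y').toLinearMap ∘ₗ
    (Ver y').subtype ∘ₗ projAlong (Ver y') (Hor y')

theorem projForm_self (y : Y) (w : TangentSpace I y) :
    projForm Ver Hor y y w = (projAlong (Ver y) (Hor y) w : TangentSpace I y) := by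
  have h : (trivializationAt E (TangentSpace I) y).continuousLinearMapAt ℝ y =
      mfderiv I 𝓘(ℝ, E) (extChartAt I y) y :=
    TangentBundle.continuousLinearMapAt_trivializationAt (mem_chart_source H y)
  rw [mfderiv_extChartAt_self] at h
  exact DFunLike.congr_fun h _

theorem projForm_eq_zero (hc : ∀ y, IsCompl (Ver y) (Hor y)) {y y' : Y} {w : TangentSpace I y'}
    (hw : w ∈ Hor y') : projForm Ver Hor y y' w = 0 := by
  change (trivializationAt E (TangentSpace I) y).continuousLinearMapAt ℝ y'
    (projAlong (Ver y') (Hor y') w : TangentSpace I y') = 0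
  rw [(projAlong_eq_zero (hc y')).2 hw, ZeroMemClass.coe_zero, map_zero]

theorem mdifferentiableAt_projForm {y : Y}
    {W : (y : Y) → TangentSpace I y} (hW : MDifferentiableAt I I.tangent
      (fun y' => (⟨y', projAlong (Ver y') (Hor y') (W y')⟩ : TangentBundle I Y)) y) :
    MDifferentiableAt I 𝓘(ℝ, E) (fun y' => projForm Ver Hor y y' (W y')) y := by
  have h := (mdifferentiableAt_section I (F := E) (E := TangentSpace I)
    (s := fun y' => (projAlong (Ver y') (Hor y') (W y') : TangentSpace I y'))).1 hW
  refine h.congr_of_eventuallyEq ?_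
  filter_upwards [(trivializationAt E (TangentSpace I) y).open_baseSet.mem_nhds
    (FiberBundle.mem_baseSet_trivializationAt' y)] with y' hy'
  exact Trivialization.continuousLinearMapAt_apply_of_mem ℝ _ hy' _

variable {K : Type*} [NormedAddCommGroup K] [NormedSpace ℝ K] [CompleteSpace K]
  {L : Type*} [TopologicalSpace L] {J : ModelWithCorners ℝ K L} [J.Boundaryless]
  {N : Type*} [TopologicalSpace N] [ChartedSpace L N] [IsManifold J ∞ N]

/-- For vector fields `U`, `V` which a map `f` sends to horizontal vectors,
`dP(f_* U, f_* V) = -P(f_* [U, V])`. -/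
theorem formDeriv_projForm {f : N → Y} {p : N} (hc : ∀ y, IsCompl (Ver y) (Hor y))
    (hP : ∀ e : TangentSpace I (f p), MDifferentiableAt I I.tangent (fun y' =>
      (⟨y', projAlong (Ver y') (Hor y') (FiberBundle.extend E e y')⟩ : TangentBundle I Y)) (f p))
    (hf : ContMDiffAt J I 2 f p) {U V : (n : N) → TangentSpace J n}
    (hU : MDifferentiableAt J J.tangent (fun n => (⟨n, U n⟩ : TangentBundle J N)) p)
    (hV : MDifferentiableAt J J.tangent (fun n => (⟨n, V n⟩ : TangentBundle J N)) p)
    (hUh : ∀ᶠ n in 𝓝 p, mfderiv J I f n (U n) ∈ Hor (f n))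
    (hVh : ∀ᶠ n in 𝓝 p, mfderiv J I f n (V n) ∈ Hor (f n)) :
    formDeriv (projForm Ver Hor (f p)) (f p) (mfderiv J I f p (U p)) (mfderiv J I f p (V p)) =
      -projForm Ver Hor (f p) (f p) (mfderiv J I f p (mlieBracket J U V p)) := by
  have h := formDeriv_mfderiv (α := projForm Ver Hor (f p))
    (fun e => mdifferentiableAt_projForm (hP e)) hf hU hV
  -- The function `P(f_* W)` vanishes on a neighbourhood, so its derivative vanishes; only the
  -- bracket term of Cartan's formula survives.
  have h0 : ∀ W W' : (n : N) → TangentSpace J n, (∀ᶠ n in 𝓝 p, mfderiv J I f n (W n) ∈ Hor (f n)) →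
      mvfderiv J (fun n => projForm Ver Hor (f p) (f n) (mfderiv J I f n (W n))) p (W' p) = 0 := by
    intro W W' hW
    have he : (fun n => projForm Ver Hor (f p) (f n) (mfderiv J I f n (W n)))
        =ᶠ[𝓝 p] fun _ => (0 : E) := hW.mono fun n hn => projForm_eq_zero hc hn
    have h1 : mvfderiv J (fun n => projForm Ver Hor (f p) (f n) (mfderiv J I f n (W n))) p =
      mvfderiv J (fun _ => (0 : E)) p := he.mfderiv_eq
    rw [h1, mvfderiv_const]
    rfl
  rw [h, h0 V U hVh, h0 U V hUh, sub_zero, zero_sub]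

/-- The identity `T = dP(h·, h·)`: the fields in the definition of `T` are horizontal, so the
derivative terms of `dP` drop out. In particular `T` is bilinear and depends on the two vectors
only. -/
theorem frobeniusTensor_eq_formDeriv [I.Boundaryless] {y : Y} (hc : ∀ y, IsCompl (Ver y) (Hor y))
    (hP : ∀ e : TangentSpace I y, MDifferentiableAt I I.tangent (fun y' =>
      (⟨y', projAlong (Ver y') (Hor y') (FiberBundle.extend E e y')⟩ : TangentBundle I Y)) y)
    (u v : TangentSpace I y) :
    (frobeniusTensor I Ver Hor y u v : TangentSpace I y) =
      formDeriv (projForm Ver Hor y) y (projAlong (Hor y) (Ver y) u : TangentSpace I y)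
        (projAlong (Hor y) (Ver y) v : TangentSpace I y) := by
  have hid : ∀ (y' : Y) (w : TangentSpace I y'), mfderiv I I (fun y : Y => y) y' w = w :=
    fun y' w => DFunLike.congr_fun mfderiv_id w
  have hh : ∀ u : TangentSpace I y, MDifferentiableAt I I.tangent (fun y' =>
      (⟨y', projAlong (Hor y') (Ver y') (FiberBundle.extend E u y')⟩ : TangentBundle I Y)) y := by
    intro u
    have h1 := mdifferentiableAt_sub_section (mdifferentiableAt_extend' u) (hP u)
    refine h1.congr_of_eventuallyEq (Eventually.of_forall fun y' => ?_)
    refine congrArg (fun w => (⟨y', w⟩ : TangentBundle I Y)) ?_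
    exact eq_sub_of_add_eq' (projAlong_add_projAlong (hc y') _)
  have h := formDeriv_projForm (J := I) (f := fun y : Y => y) (p := y) hc hP contMDiffAt_id
    (hh u) (hh v) (Eventually.of_forall fun y' => by rw [hid]; exact Subtype.coe_prop _)
    (Eventually.of_forall fun y' => by rw [hid]; exact Subtype.coe_prop _)
  simp only [hid, FiberBundle.extend_apply_self, projForm_self] at h
  exact h.symm

/-- Computes `T` upstairs, from fields on `N` whose images are horizontal but which need not descend
to `Y`. It will be used for both `q` and the projection to `X`, with the same pair of fields. -/
theorem frobeniusTensor_mfderiv [I.Boundaryless] {f : N → Y} {p : N}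
    (hc : ∀ y, IsCompl (Ver y) (Hor y))
    (hP : ∀ e : TangentSpace I (f p), MDifferentiableAt I I.tangent (fun y' =>
      (⟨y', projAlong (Ver y') (Hor y') (FiberBundle.extend E e y')⟩ : TangentBundle I Y)) (f p))
    (hf : ContMDiffAt J I 2 f p) {U V : (n : N) → TangentSpace J n}
    (hU : MDifferentiableAt J J.tangent (fun n => (⟨n, U n⟩ : TangentBundle J N)) p)
    (hV : MDifferentiableAt J J.tangent (fun n => (⟨n, V n⟩ : TangentBundle J N)) p)
    (hUh : ∀ᶠ n in 𝓝 p, mfderiv J I f n (U n) ∈ Hor (f n))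
    (hVh : ∀ᶠ n in 𝓝 p, mfderiv J I f n (V n) ∈ Hor (f n)) {u v : TangentSpace I (f p)}
    (hu : (projAlong (Hor (f p)) (Ver (f p)) u : TangentSpace I (f p)) = mfderiv J I f p (U p))
    (hv : (projAlong (Hor (f p)) (Ver (f p)) v : TangentSpace I (f p)) = mfderiv J I f p (V p)) :
    frobeniusTensor I Ver Hor (f p) u v =
      -projAlong (Ver (f p)) (Hor (f p)) (mfderiv J I f p (mlieBracket J U V p)) := by
  refine Subtype.ext ?_
  rw [frobeniusTensor_eq_formDeriv hc hP, hu, hv]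
  refine (formDeriv_projForm hc hP hf hU hV hUh hVh).trans ?_
  rw [projForm_self]
  rfl

end Frobenius

/-! ### Smoothness of the projections attached to a horizontal distribution. -/

section Submersion

open Filter Set

variable {E : Type*} [NormedAddCommGroup E] [NormedSpace ℝ E]
  {H : Type*} [TopologicalSpace H] {I : ModelWithCorners ℝ E H}
  {X : Type*} [TopologicalSpace X] [ChartedSpace H X]
  {E' : Type*} [NormedAddCommGroup E'] [NormedSpace ℝ E']
  {H' : Type*} [TopologicalSpace H'] {I' : ModelWithCorners ℝ E' H'}
  {S : Type*} [TopologicalSpace S] [ChartedSpace H' S]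
  {π : X → S} {Hor : (x : X) → Submodule ℝ (TangentSpace I x)}

theorem mem_verticalSpace {x : X} {v : TangentSpace I x} :
    v ∈ verticalSpace I I' π x ↔ mfderiv I I' π x v = 0 :=
  LinearMap.mem_ker

theorem isCompl_verticalSpace {x : X} (h : BijOn (mfderiv I I' π x) (Hor x) univ) :
    IsCompl (verticalSpace I I' π x) (Hor x) := by
  constructor
  · rw [Submodule.disjoint_def]
    intro v hv hv'
    refine h.injOn hv' (Hor x).zero_mem ?_
    rw [mem_verticalSpace.1 hv, map_zero]
  · rw [codisjoint_iff, Submodule.eq_top_iff']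
    intro v
    obtain ⟨w, hw, hwv⟩ := h.surjOn (mem_univ (mfderiv I I' π x v))
    rw [Submodule.mem_sup]
    refine ⟨v - w, ?_, w, hw, sub_add_cancel v w⟩
    rw [mem_verticalSpace, map_sub, hwv, sub_self]

/-- For a smooth horizontal distribution `Hor` of a map `π`, the projection onto `Hor` along
`ker dπ` is smooth. -/
theorem ContMDiffAt.projAlong_hor_along [IsManifold I ∞ X] [IsManifold I' ∞ S]
    [FiniteDimensional ℝ E'] {EZ : Type*} [NormedAddCommGroup EZ] [NormedSpace ℝ EZ]
    {HZ : Type*} [TopologicalSpace HZ] {J : ModelWithCorners ℝ EZ HZ}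
    {Z : Type*} [TopologicalSpace Z] [ChartedSpace HZ Z] {z₀ : Z} {b : Z → X}
    {s : (z : Z) → TangentSpace I (b z)}
    (hπ : ContMDiff I I' ∞ π) (hHor : IsSmoothDistribution I Hor)
    (h : ∀ x, BijOn (mfderiv I I' π x) (Hor x) univ)
    (hs : ContMDiffAt J I.tangent ∞ (fun z => (⟨b z, s z⟩ : TangentBundle I X)) z₀) :
    ContMDiffAt J I.tangent ∞ (fun z => (⟨b z, projAlong (Hor (b z))
      (verticalSpace I I' π (b z)) (s z)⟩ : TangentBundle I X)) z₀ := by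
  have hb := hs.base_along
  set x₀ := b z₀
  obtain ⟨U, hU, k, σ, hσ, hσU⟩ := hHor x₀
  have hσ' : ∀ i, ContMDiffAt I I.tangent ∞ (fun x => (⟨x, σ i x⟩ : TangentBundle I X)) x₀ :=
    fun i => (hσ i).contMDiffAt hU
  -- Composing `π` with a fixed chart puts `dπ` into the fixed space `E'`.
  set g : X → E' := fun x => extChartAt I' (π x₀) (π x) with hg
  have hgs : ContMDiffAt I 𝓘(ℝ, E') ∞ g x₀ := contMDiffAt_extChartAt.comp x₀ hπ.contMDiffAt
  -- The matrix of `dπ` in the local frame `σ` of `Hor`. It is invertible because `dπ` is bijective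
  -- on `Hor`.
  set B : X → (Fin k → ℝ) →L[ℝ] E' := fun x => ∑ i,
    (ContinuousLinearMap.proj (R := ℝ) (φ := fun _ : Fin k => ℝ) i).smulRight
      (mvfderiv I g x (σ i x)) with hB
  have hBs : ContMDiffAt I 𝓘(ℝ, (Fin k → ℝ) →L[ℝ] E') ∞ B x₀ := by
    refine contMDiffAt_finsetSum fun i _ => ?_
    have h1 : ContMDiffAt I 𝓘(ℝ, E') ∞ (fun x => mvfderiv I g x (σ i x)) x₀ :=
      ContMDiffAt.mvfderiv_along (b := fun x => x) hgs (hσ' i)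
    exact (ContinuousLinearMap.smulRightL ℝ (Fin k → ℝ) E'
      (ContinuousLinearMap.proj (R := ℝ) (φ := fun _ : Fin k => ℝ) i)).contMDiff.contMDiffAt.comp
        x₀ h1
  have hBapp : ∀ x c, B x c = mvfderiv I g x (∑ i, c i • σ i x) := by
    intro x c
    simp only [hB, map_sum, map_smul]
    simp
  set W : Set X := U ∩ π ⁻¹' (chartAt H' (π x₀)).source with hW
  have hWn : W ∈ 𝓝 x₀ := inter_mem hU
    (hπ.continuous.continuousAt.preimage_mem_nhds (chart_source_mem_nhds H' _))
  have hdg : ∀ x ∈ W, ∀ v : TangentSpace I x,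
      mvfderiv I g x v = mfderiv I' 𝓘(ℝ, E') (extChartAt I' (π x₀)) (π x) (mfderiv I I' π x v) := by
    intro x hx v
    exact mfderiv_comp_apply x (mdifferentiableAt_extChartAt hx.2)
      (hπ.contMDiffAt.mdifferentiableAt (by simp)) v
  have hφ : ∀ x ∈ W, Function.Bijective
      (mfderiv I' 𝓘(ℝ, E') (extChartAt I' (π x₀)) (π x)) := by
    intro x hx
    obtain ⟨e, he⟩ := isInvertible_mfderiv_extChartAt (I := I') (x := π x₀) (y := π x)
      (by rw [extChartAt_source]; exact hx.2)
    rw [← he]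
    exact e.bijective
  have hmem : ∀ x ∈ W, ∀ c : Fin k → ℝ, ∑ i, c i • σ i x ∈ Hor x := by
    intro x hx c
    rw [← (hσU x hx.1).2]
    exact Submodule.sum_mem _ fun i _ =>
      Submodule.smul_mem _ _ (Submodule.subset_span (mem_range_self i))
  have hBbij : ∀ x ∈ W, Function.Bijective (B x) := by
    intro x hx
    constructor
    · rw [injective_iff_map_eq_zero]
      intro c hc
      rw [hBapp, hdg x hx] at hc
      have h1 : mfderiv I I' π x (∑ i, c i • σ i x) = 0 :=
        (hφ x hx).1 (hc.trans (map_zero _).symm)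
      have h2 : ∑ i, c i • σ i x = 0 :=
        (h x).injOn (hmem x hx c) (Hor x).zero_mem (h1.trans (map_zero _).symm)
      funext i
      exact Fintype.linearIndependent_iff.1 (hσU x hx.1).1 c h2 i
    · intro w
      obtain ⟨w', hw'⟩ := (hφ x hx).2 w
      obtain ⟨v, hv, hvw⟩ := (h x).surjOn (mem_univ w')
      have hv' : v ∈ Submodule.span ℝ (range fun i => σ i x) := by
        rw [(hσU x hx.1).2]; exact hv
      obtain ⟨c, hc⟩ := (Submodule.mem_span_range_iff_exists_fun ℝ).1 hv'
      exact ⟨c, by rw [hBapp, hdg x hx, hc, hvw, hw']⟩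
  have hBinv : ∀ x ∈ W, (B x).IsInvertible := fun x hx =>
    ⟨(LinearEquiv.ofBijective (B x).toLinearMap (hBbij x hx)).toContinuousLinearEquiv, rfl⟩
  -- Frame coefficients of the horizontal lift of `dπ(s)`, which is the horizontal projection of
  -- `s`; they are smooth since inversion of operators is.
  set c : Fin k → Z → ℝ := fun i z => (B (b z)).inverse (mvfderiv I g (b z) (s z)) i with hc
  have hcs : ∀ i, ContMDiffAt J 𝓘(ℝ, ℝ) ∞ (c i) z₀ := by
    have h1 : ContMDiffAt J 𝓘(ℝ, (Fin k → ℝ) →L[ℝ] E') ∞ (fun z => B (b z)) z₀ := hBs.comp z₀ hb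
    have h2 : ContMDiffAt J 𝓘(ℝ, E' →L[ℝ] (Fin k → ℝ)) ∞ (fun z => (B (b z)).inverse) z₀ :=
      ((hBinv x₀ (mem_of_mem_nhds hWn)).contDiffAt_map_inverse (n := ∞)).contMDiffAt.comp z₀ h1
    have h3 := h2.clm_apply (ContMDiffAt.mvfderiv_along hgs hs)
    intro i
    exact (ContinuousLinearMap.proj (R := ℝ)
      (φ := fun _ : Fin k => ℝ) i).contMDiff.contMDiffAt.comp z₀ h3
  have hfin := ContMDiffAt.sum_smul_along hb hcs (s := fun i z => σ i (b z))
    fun i => (hσ' i).comp z₀ hb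
  refine hfin.congr_of_eventuallyEq ?_
  filter_upwards [hb.continuousAt.preimage_mem_nhds hWn] with z hz
  refine congrArg (fun w => (⟨b z, w⟩ : TangentBundle I X)) ?_
  refine projAlong_eq_of_sub_mem (isCompl_verticalSpace (h (b z))).symm (hmem _ hz _) ?_
  have h1 : B (b z) (fun i => c i z) = mvfderiv I g (b z) (s z) :=
    (hBinv _ hz).self_apply_inverse _
  rw [hBapp, hdg _ hz, hdg _ hz] at h1
  rw [mem_verticalSpace, map_sub, sub_eq_zero]
  exact ((hφ _ hz).1 h1).symm

theorem ContMDiffAt.projAlong_ver_along [IsManifold I ∞ X] [IsManifold I' ∞ S]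
    [FiniteDimensional ℝ E'] {EZ : Type*} [NormedAddCommGroup EZ] [NormedSpace ℝ EZ]
    {HZ : Type*} [TopologicalSpace HZ] {J : ModelWithCorners ℝ EZ HZ}
    {Z : Type*} [TopologicalSpace Z] [ChartedSpace HZ Z] {z₀ : Z} {b : Z → X}
    {s : (z : Z) → TangentSpace I (b z)}
    (hπ : ContMDiff I I' ∞ π) (hHor : IsSmoothDistribution I Hor)
    (h : ∀ x, BijOn (mfderiv I I' π x) (Hor x) univ)
    (hs : ContMDiffAt J I.tangent ∞ (fun z => (⟨b z, s z⟩ : TangentBundle I X)) z₀) :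
    ContMDiffAt J I.tangent ∞ (fun z => (⟨b z, projAlong (verticalSpace I I' π (b z))
      (Hor (b z)) (s z)⟩ : TangentBundle I X)) z₀ := by
  refine (hs.sub_along (hs.projAlong_hor_along hπ hHor h)).congr_of_eventuallyEq
    (Eventually.of_forall fun z => ?_)
  refine congrArg (fun w => (⟨b z, w⟩ : TangentBundle I X)) ?_
  exact eq_sub_of_add_eq (projAlong_add_projAlong (isCompl_verticalSpace (h (b z))) _)

end Submersion

/-! ### The quotient map `Q × Y → Y_Q`: smoothness, local sections, and its kernel. -/

section AssocGeometry

open Filter Set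

variable {EG : Type*} [NormedAddCommGroup EG] [NormedSpace ℝ EG]
  {EQ : Type*} [NormedAddCommGroup EQ] [NormedSpace ℝ EQ]
  {EM : Type*} [NormedAddCommGroup EM] [NormedSpace ℝ EM]
  {EY : Type*} [NormedAddCommGroup EY] [NormedSpace ℝ EY]
  {G : Type*} [TopologicalSpace G] [ChartedSpace EG G] [Group G]
  {Q : Type*} [TopologicalSpace Q] [ChartedSpace EQ Q] [MulAction Gᵐᵒᵖ Q]
  {M : Type*} [TopologicalSpace M] [ChartedSpace EM M] [IsManifold 𝓘(ℝ, EM) ∞ M]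
  {r : Q → M} (hr : IsPrincipalBundle EG EQ EM G r)
  {Y : Type*} [TopologicalSpace Y] [ChartedSpace EY Y] [IsManifold 𝓘(ℝ, EY) ∞ Y]
  [MulAction G Y] [ContMDiffSMul 𝓘(ℝ, EG) 𝓘(ℝ, EY) ∞ G Y]

/-- A chart of `Y_Q` is by construction a local trivialization followed by a chart of `M × Y`;
undoing the latter recovers the trivialization. -/
theorem AssocSpace.contMDiffAt_triv (y : AssocSpace hr Y) :
    ContMDiffAt (𝓘(ℝ, EM).prod 𝓘(ℝ, EY)) (𝓘(ℝ, EM).prod 𝓘(ℝ, EY)) ∞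
      (AssocSpace.triv hr Y (EY := EY) (AssocSpace.proj hr y)) y := by
  set A := AssocSpace.triv hr Y (EY := EY) (AssocSpace.proj hr y) with hA
  have hc : chartAt (ModelProd EM EY) y = A ≫ₕ chartAt (ModelProd EM EY) (A y) := rfl
  have hy : y ∈ A.source := hr.mem_triv (AssocSpace.proj hr y)
  have h1 : ContMDiffAt (𝓘(ℝ, EM).prod 𝓘(ℝ, EY)) (𝓘(ℝ, EM).prod 𝓘(ℝ, EY)) ∞
      (chartAt (ModelProd EM EY) y) y :=
    contMDiffOn_chart.contMDiffAt (chart_source_mem_nhds _ y)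
  have h2 : ContMDiffAt (𝓘(ℝ, EM).prod 𝓘(ℝ, EY)) (𝓘(ℝ, EM).prod 𝓘(ℝ, EY)) ∞
      (chartAt (ModelProd EM EY) (A y)).symm (chartAt (ModelProd EM EY) y y) :=
    contMDiffOn_chart_symm.contMDiffAt (chart_target_mem_nhds _ (A y))
  refine (h2.comp y h1).congr_of_eventuallyEq ?_
  filter_upwards [chart_source_mem_nhds (ModelProd EM EY) y] with y' hy'
  rw [hc] at hy' ⊢
  exact ((chartAt (ModelProd EM EY) (A y)).left_inv hy'.2).symm

theorem AssocSpace.contMDiffAt_triv_symm (y : AssocSpace hr Y) :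
    ContMDiffAt (𝓘(ℝ, EM).prod 𝓘(ℝ, EY)) (𝓘(ℝ, EM).prod 𝓘(ℝ, EY)) ∞
      (AssocSpace.triv hr Y (EY := EY) (AssocSpace.proj hr y)).symm
      (AssocSpace.triv hr Y (EY := EY) (AssocSpace.proj hr y) y) := by
  set A := AssocSpace.triv hr Y (EY := EY) (AssocSpace.proj hr y) with hA
  have hc : chartAt (ModelProd EM EY) y = A ≫ₕ chartAt (ModelProd EM EY) (A y) := rfl
  have h1 : ContMDiffAt (𝓘(ℝ, EM).prod 𝓘(ℝ, EY)) (𝓘(ℝ, EM).prod 𝓘(ℝ, EY)) ∞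
      (chartAt (ModelProd EM EY) (A y)) (A y) :=
    contMDiffOn_chart.contMDiffAt (chart_source_mem_nhds _ (A y))
  have h2 : ContMDiffAt (𝓘(ℝ, EM).prod 𝓘(ℝ, EY)) (𝓘(ℝ, EM).prod 𝓘(ℝ, EY)) ∞
      (chartAt (ModelProd EM EY) y).symm (chartAt (ModelProd EM EY) (A y) (A y)) :=
    contMDiffOn_chart_symm.contMDiffAt (chart_target_mem_nhds _ y)
  refine (h2.comp (A y) h1).congr_of_eventuallyEq ?_
  filter_upwards [chart_source_mem_nhds (ModelProd EM EY) (A y)] with y' hy'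
  rw [hc]
  exact congrArg A.symm ((chartAt (ModelProd EM EY) (A y)).left_inv hy').symm

/-- In a local trivialization the quotient map is `(z, y) ↦ (r z, h(z) • y)`, with `h` the group
component of `z`. -/
theorem AssocSpace.contMDiff_mk :
    ContMDiff (𝓘(ℝ, EQ).prod 𝓘(ℝ, EY)) (𝓘(ℝ, EM).prod 𝓘(ℝ, EY)) ∞
      (AssocSpace.mk hr (Y := Y)) := by
  intro p
  set m := r p.1
  set A := AssocSpace.triv hr Y (EY := EY) m with hA
  have hU : (fun p' : Q × Y => r p'.1) ⁻¹' (hr.triv m).baseSet ∈ 𝓝 p :=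
    ((hr.triv m).open_baseSet.preimage
      (hr.smooth_proj.continuous.comp continuous_fst)).mem_nhds (hr.mem_triv m)
  have h2 : ContMDiffAt (𝓘(ℝ, EQ).prod 𝓘(ℝ, EY)) (𝓘(ℝ, EM).prod 𝓘(ℝ, EG)) ∞
      (fun p' : Q × Y => hr.triv m p'.1) p :=
    ((hr.triv_smooth m).contMDiffAt ((hr.triv m).open_source.mem_nhds
      ((hr.triv m).mem_source.2 (hr.mem_triv m)))).comp p contMDiffAt_fst
  have h3 : ContMDiffAt (𝓘(ℝ, EQ).prod 𝓘(ℝ, EY)) (𝓘(ℝ, EM).prod 𝓘(ℝ, EY)) ∞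
      (fun p' : Q × Y => (r p'.1, (hr.triv m p'.1).2 • p'.2)) p :=
    (hr.smooth_proj.contMDiffAt.comp p contMDiffAt_fst).prodMk
      ((contMDiffAt_snd.comp p h2).smul contMDiffAt_snd)
  have h4 : ContMDiffAt (𝓘(ℝ, EM).prod 𝓘(ℝ, EY)) (𝓘(ℝ, EM).prod 𝓘(ℝ, EY)) ∞ A.symm
      (r p.1, (hr.triv m p.1).2 • p.2) := by
    have := AssocSpace.contMDiffAt_triv_symm (EY := EY) hr (AssocSpace.mk hr p)
    have h5 : A (AssocSpace.mk hr p) = (r p.1, (hr.triv m p.1).2 • p.2) :=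
      AssocSpace.trivFun_mk hr m (hr.mem_triv m)
    rw [← h5]
    exact this
  refine (h4.comp p h3).congr_of_eventuallyEq ?_
  filter_upwards [hU] with p' hp'
  have h6 : A (AssocSpace.mk hr p') = (r p'.1, (hr.triv m p'.1).2 • p'.2) :=
    AssocSpace.trivFun_mk hr m hp'
  refine (A.left_inv (x := AssocSpace.mk hr p') hp').symm.trans ?_
  exact congrArg A.symm h6

/-- The quotient map `Q × Y → Y_Q` has a smooth local section `τ` through every point `p`, and
near `p` every point is carried to the section by a smoothly varying group element. -/
theorem AssocSpace.exists_local_section [LieGroup 𝓘(ℝ, EG) ∞ G] (p : Q × Y) :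
    ∃ (τ : AssocSpace hr Y → Q × Y) (γ : Q × Y → G),
      ContMDiffAt (𝓘(ℝ, EM).prod 𝓘(ℝ, EY)) (𝓘(ℝ, EQ).prod 𝓘(ℝ, EY)) ∞ τ (AssocSpace.mk hr p) ∧
      ContMDiffAt (𝓘(ℝ, EQ).prod 𝓘(ℝ, EY)) 𝓘(ℝ, EG) ∞ γ p ∧
      τ (AssocSpace.mk hr p) = p ∧ γ p = 1 ∧
      (∀ᶠ y in 𝓝 (AssocSpace.mk hr p), AssocSpace.mk hr (τ y) = y) ∧
      ∀ᶠ p' in 𝓝 p, p' = (op (γ p') • (τ (AssocSpace.mk hr p')).1,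
        (γ p')⁻¹ • (τ (AssocSpace.mk hr p')).2) := by
  set m := r p.1 with hm
  set A := AssocSpace.triv hr Y (EY := EY) m with hA
  set g₀ := (hr.triv m p.1).2 with hg₀
  have hAp : ∀ {p' : Q × Y}, r p'.1 ∈ (hr.triv m).baseSet →
      A (AssocSpace.mk hr p') = (r p'.1, (hr.triv m p'.1).2 • p'.2) :=
    fun hp' => AssocSpace.trivFun_mk hr m hp'
  have hmm := hr.mem_triv m
  have hAs : ContMDiffAt (𝓘(ℝ, EM).prod 𝓘(ℝ, EY)) (𝓘(ℝ, EM).prod 𝓘(ℝ, EY)) ∞ A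
      (AssocSpace.mk hr p) := AssocSpace.contMDiffAt_triv (EY := EY) hr (AssocSpace.mk hr p)
  have h1 : ContMDiffAt (𝓘(ℝ, EM).prod 𝓘(ℝ, EY)) 𝓘(ℝ, EQ) ∞
      (fun y => hr.sec m (A y).1) (AssocSpace.mk hr p) := by
    have h2 : ContMDiffAt 𝓘(ℝ, EM) 𝓘(ℝ, EQ) ∞ (hr.sec m) (A (AssocSpace.mk hr p)).1 := by
      rw [hAp hmm]
      exact (hr.sec_smooth m).contMDiffAt ((hr.triv m).open_baseSet.mem_nhds hmm)
    exact ContMDiffAt.comp (AssocSpace.mk hr p) (f := fun y => (A y).1) h2 hAs.fst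
  have hUY : ∀ᶠ y in 𝓝 (AssocSpace.mk hr p), y ∈ A.source :=
    A.open_source.mem_nhds hmm
  -- The section with group component `1` is translated by `g₀`, the group component of `p`, so that
  -- it passes through `p`. The factor `g₀⁻¹` in `γ` compensates for this and makes `γ p = 1`.
  refine ⟨fun y => (op g₀ • hr.sec m (A y).1, g₀⁻¹ • (A y).2),
    fun p' => g₀⁻¹ * (hr.triv m p'.1).2, ?_, ?_, ?_, inv_mul_cancel _, ?_, ?_⟩
  · exact (hr.smooth_action.contMDiffAt.comp _ (h1.prodMk contMDiffAt_const)).prodMk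
      ((contMDiffAt_const (I' := 𝓘(ℝ, EG))).smul hAs.snd)
  · have h2 : ContMDiffAt (𝓘(ℝ, EQ).prod 𝓘(ℝ, EY)) (𝓘(ℝ, EM).prod 𝓘(ℝ, EG)) ∞
        (fun p' : Q × Y => hr.triv m p'.1) p :=
      ((hr.triv_smooth m).contMDiffAt ((hr.triv m).open_source.mem_nhds
        ((hr.triv m).mem_source.2 hmm))).comp p contMDiffAt_fst
    exact contMDiffAt_const.mul (contMDiffAt_snd.comp p h2)
  · simp only [hAp hmm]
    rw [hg₀, hr.sec_action m hmm, inv_smul_smul]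
  · filter_upwards [hUY] with y hy
    rw [AssocSpace.mk_action hr g₀ (hr.sec m (A y).1, (A y).2)]
    exact A.left_inv hy
  · have hU : ∀ᶠ p' in 𝓝 p, r p'.1 ∈ (hr.triv m).baseSet :=
      ((hr.triv m).open_baseSet.preimage
        (hr.smooth_proj.continuous.comp continuous_fst)).mem_nhds hmm
    filter_upwards [hU] with p' hp'
    rw [hAp hp']
    refine Prod.ext ?_ ?_
    · simp only [smul_smul, ← op_mul, mul_inv_cancel_left]
      exact (hr.sec_action m hp').symm
    · simp [smul_smul]

theorem contMDiff_orbitAction [LieGroup 𝓘(ℝ, EG) ∞ G]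
    (hr : IsPrincipalBundle EG EQ EM G r) :
    ContMDiff ((𝓘(ℝ, EQ).prod 𝓘(ℝ, EY)).prod 𝓘(ℝ, EG)) (𝓘(ℝ, EQ).prod 𝓘(ℝ, EY)) ∞
      (fun P : (Q × Y) × G => ((op P.2 • P.1.1, P.2⁻¹ • P.1.2) : Q × Y)) :=
  (hr.smooth_action.comp ((contMDiff_fst.comp contMDiff_fst).prodMk contMDiff_snd)).prodMk
    (((contMDiff_inv 𝓘(ℝ, EG) ∞).comp contMDiff_snd).smul (contMDiff_snd.comp contMDiff_fst))

theorem contMDiff_orbitMap [LieGroup 𝓘(ℝ, EG) ∞ G]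
    (hr : IsPrincipalBundle EG EQ EM G r) (p : Q × Y) :
    ContMDiff 𝓘(ℝ, EG) (𝓘(ℝ, EQ).prod 𝓘(ℝ, EY)) ∞
      (fun g : G => ((op g • p.1, g⁻¹ • p.2) : Q × Y)) :=
  (contMDiff_orbitAction hr).comp (contMDiff_const.prodMk contMDiff_id)

theorem contMDiff_orbitTranslation [LieGroup 𝓘(ℝ, EG) ∞ G]
    (hr : IsPrincipalBundle EG EQ EM G r) (g : G) :
    ContMDiff (𝓘(ℝ, EQ).prod 𝓘(ℝ, EY)) (𝓘(ℝ, EQ).prod 𝓘(ℝ, EY)) ∞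
      (fun p : Q × Y => ((op g • p.1, g⁻¹ • p.2) : Q × Y)) :=
  (contMDiff_orbitAction hr).comp (contMDiff_id.prodMk contMDiff_const)

/-- The quotient map is constant along orbits. -/
theorem mfderiv_mk_generatingField [LieGroup 𝓘(ℝ, EG) ∞ G] (p : Q × Y)
    (e : GroupLieAlgebra 𝓘(ℝ, EG) G) :
    mfderiv (𝓘(ℝ, EQ).prod 𝓘(ℝ, EY)) (𝓘(ℝ, EM).prod 𝓘(ℝ, EY)) (AssocSpace.mk hr) p
      (generatingField p e) = 0 := by
  have h := mfderiv_comp_apply_of_eq (x := (1 : G)) (y := p) (g := AssocSpace.mk hr (Y := Y))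
    ((AssocSpace.contMDiff_mk hr).contMDiffAt.mdifferentiableAt (by simp))
    ((contMDiff_orbitMap (EY := EY) hr p).contMDiffAt.mdifferentiableAt (by simp))
    (by simp) e
  refine h.symm.trans ?_
  have hconst : AssocSpace.mk hr ∘ (fun g : G => ((op g • p.1, g⁻¹ • p.2) : Q × Y)) =
      fun _ => AssocSpace.mk hr p := funext fun g => AssocSpace.mk_action hr g p
  rw [hconst, mfderiv_const]
  rfl

variable (EQ) in
/-- The fundamental vector field of `e ∈ 𝔤` on `Q` at a point, as a linear function of `e`. -/
noncomputable def fundamentalField (z : Q) : GroupLieAlgebra 𝓘(ℝ, EG) G →ₗ[ℝ]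
    TangentSpace 𝓘(ℝ, EQ) z :=
  (mfderiv 𝓘(ℝ, EG) 𝓘(ℝ, EQ) (fun g : G => op g • z) 1).toLinearMap

theorem mfderiv_fst_generatingField [LieGroup 𝓘(ℝ, EG) ∞ G]
    (hr : IsPrincipalBundle EG EQ EM G r) (p : Q × Y)
    (e : GroupLieAlgebra 𝓘(ℝ, EG) G) :
    mfderiv (𝓘(ℝ, EQ).prod 𝓘(ℝ, EY)) 𝓘(ℝ, EQ) Prod.fst p (generatingField p e) =
      fundamentalField EQ p.1 e :=
  (mfderiv_comp_apply_of_eq (x := (1 : G)) (y := p) mdifferentiableAt_fst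
    ((contMDiff_orbitMap (EY := EY) hr p).contMDiffAt.mdifferentiableAt (by simp))
    (by simp) e).symm

theorem mfderiv_snd_generatingField [LieGroup 𝓘(ℝ, EG) ∞ G]
    (hr : IsPrincipalBundle EG EQ EM G r) (p : Q × Y)
    (e : GroupLieAlgebra 𝓘(ℝ, EG) G) :
    mfderiv (𝓘(ℝ, EQ).prod 𝓘(ℝ, EY)) 𝓘(ℝ, EY) Prod.snd p (generatingField p e) =
      actionField p.2 e :=
  (mfderiv_comp_apply_of_eq (x := (1 : G)) (y := p) mdifferentiableAt_snd
    ((contMDiff_orbitMap (EY := EY) hr p).contMDiffAt.mdifferentiableAt (by simp))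
    (by simp) e).symm

/-- A smooth local section of `Q × Y → Y_Q` splits tangent vectors of `Q × Y` into a part tangent
to the section and a part tangent to the orbit. -/
theorem AssocSpace.exists_mfderiv_local_section [LieGroup 𝓘(ℝ, EG) ∞ G] (p : Q × Y) :
    ∃ τ : AssocSpace hr Y → Q × Y,
      ContMDiffAt (𝓘(ℝ, EM).prod 𝓘(ℝ, EY)) (𝓘(ℝ, EQ).prod 𝓘(ℝ, EY)) ∞ τ (AssocSpace.mk hr p) ∧
      τ (AssocSpace.mk hr p) = p ∧
      (∀ᶠ y in 𝓝 (AssocSpace.mk hr p), AssocSpace.mk hr (τ y) = y) ∧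
      ∀ w : TangentSpace (𝓘(ℝ, EQ).prod 𝓘(ℝ, EY)) p, ∃ e : GroupLieAlgebra 𝓘(ℝ, EG) G,
        w = mfderiv (𝓘(ℝ, EM).prod 𝓘(ℝ, EY)) (𝓘(ℝ, EQ).prod 𝓘(ℝ, EY)) τ (AssocSpace.mk hr p)
          (mfderiv (𝓘(ℝ, EQ).prod 𝓘(ℝ, EY)) (𝓘(ℝ, EM).prod 𝓘(ℝ, EY)) (AssocSpace.mk hr) p w)
          + generatingField p e := by
  obtain ⟨τ, γ, hτ, hγ, hτp, hγp, hs, hd⟩ := AssocSpace.exists_local_section (EY := EY) hr p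
  -- Near `p` the identity is the action applied to `(τ ∘ q, γ)`. Differentiating at `(p, 1)` gives
  -- one term from `τ ∘ q` and one orbit term, with Lie algebra element `dγ(w)`.
  refine ⟨τ, hτ, hτp, hs, fun w => ⟨mfderiv (𝓘(ℝ, EQ).prod 𝓘(ℝ, EY)) 𝓘(ℝ, EG) γ p w, ?_⟩⟩
  set a : (Q × Y) × G → Q × Y := fun P => (op P.2 • P.1.1, P.2⁻¹ • P.1.2) with ha
  have hmk := (AssocSpace.contMDiff_mk (EY := EY) hr).contMDiffAt (x := p)
  set σ : Q × Y → Q × Y := fun p' => τ (AssocSpace.mk hr p') with hσ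
  have hσs : ContMDiffAt (𝓘(ℝ, EQ).prod 𝓘(ℝ, EY)) (𝓘(ℝ, EQ).prod 𝓘(ℝ, EY)) ∞ σ p :=
    hτ.comp p hmk
  have hσp : (σ p, γ p) = (p, 1) := Prod.ext hτp hγp
  have h1 : mfderiv (𝓘(ℝ, EQ).prod 𝓘(ℝ, EY)) (𝓘(ℝ, EQ).prod 𝓘(ℝ, EY)) (fun p' : Q × Y => p') p w
      = w := DFunLike.congr_fun mfderiv_id w
  have h2 : (fun p' : Q × Y => p') =ᶠ[𝓝 p] a ∘ fun p' => (σ p', γ p') := hd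
  have has : MDifferentiableAt ((𝓘(ℝ, EQ).prod 𝓘(ℝ, EY)).prod 𝓘(ℝ, EG))
      (𝓘(ℝ, EQ).prod 𝓘(ℝ, EY)) a (p, 1) :=
    (contMDiff_orbitAction hr).contMDiffAt.mdifferentiableAt (by simp)
  have h3 := mfderiv_comp_apply_of_eq (x := p) (y := (p, (1 : G))) has
    ((hσs.prodMk hγ).mdifferentiableAt (by simp)) hσp w
  have h4 : mfderiv (𝓘(ℝ, EQ).prod 𝓘(ℝ, EY)) ((𝓘(ℝ, EQ).prod 𝓘(ℝ, EY)).prod 𝓘(ℝ, EG))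
      (fun p' => (σ p', γ p')) p w =
      (mfderiv (𝓘(ℝ, EQ).prod 𝓘(ℝ, EY)) (𝓘(ℝ, EQ).prod 𝓘(ℝ, EY)) σ p w,
        mfderiv (𝓘(ℝ, EQ).prod 𝓘(ℝ, EY)) 𝓘(ℝ, EG) γ p w) :=
    DFunLike.congr_fun (mfderiv_prodMk (hσs.mdifferentiableAt (by simp))
      (hγ.mdifferentiableAt (by simp))) w
  have h5 := mfderiv_prod_eq_add_apply (p := (p, (1 : G))) (v := mfderiv (𝓘(ℝ, EQ).prod 𝓘(ℝ, EY))
    ((𝓘(ℝ, EQ).prod 𝓘(ℝ, EY)).prod 𝓘(ℝ, EG)) (fun p' => (σ p', γ p')) p w) has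
  have h6 : mfderiv (𝓘(ℝ, EQ).prod 𝓘(ℝ, EY)) (𝓘(ℝ, EQ).prod 𝓘(ℝ, EY)) σ p w =
      mfderiv (𝓘(ℝ, EM).prod 𝓘(ℝ, EY)) (𝓘(ℝ, EQ).prod 𝓘(ℝ, EY)) τ (AssocSpace.mk hr p)
        (mfderiv (𝓘(ℝ, EQ).prod 𝓘(ℝ, EY)) (𝓘(ℝ, EM).prod 𝓘(ℝ, EY)) (AssocSpace.mk hr) p w) :=
    mfderiv_comp_apply p (hτ.mdifferentiableAt (by simp)) (hmk.mdifferentiableAt (by simp)) w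
  have h7 : (fun z : Q × Y => a (z, 1)) = fun z => z := by
    funext z; simp [ha]
  refine h1.symm.trans ?_
  refine (DFunLike.congr_fun h2.mfderiv_eq w).trans (h3.trans (h5.trans ?_))
  refine congrArg₂ (· + ·) ?_ ?_
  · refine Eq.trans ?_ h6
    refine (congrArg (fun f => mfderiv (𝓘(ℝ, EQ).prod 𝓘(ℝ, EY)) (𝓘(ℝ, EQ).prod 𝓘(ℝ, EY)) f p _)
      h7).trans ?_
    refine (DFunLike.congr_fun mfderiv_id _).trans ?_
    exact congrArg Prod.fst h4
  · exact congrArg (mfderiv 𝓘(ℝ, EG) (𝓘(ℝ, EQ).prod 𝓘(ℝ, EY))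
      (fun g : G => ((op g • p.1, g⁻¹ • p.2) : Q × Y)) 1) (congrArg Prod.snd h4)

end AssocGeometry

/-! ### Tangent vectors of a product and their components. -/

section TangentPair

variable {E : Type*} [NormedAddCommGroup E] [NormedSpace ℝ E]
  {H : Type*} [TopologicalSpace H] {I : ModelWithCorners ℝ E H}
  {N : Type*} [TopologicalSpace N] [ChartedSpace H N]
  {E' : Type*} [NormedAddCommGroup E'] [NormedSpace ℝ E']
  {H' : Type*} [TopologicalSpace H'] {I' : ModelWithCorners ℝ E' H'}
  {N' : Type*} [TopologicalSpace N'] [ChartedSpace H' N']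

/-- A pair of tangent vectors, as a tangent vector of the product. -/
def tangentPair (I : ModelWithCorners ℝ E H) (I' : ModelWithCorners ℝ E' H') (p : N × N') :
    TangentSpace I p.1 × TangentSpace I' p.2 →ₗ[ℝ] TangentSpace (I.prod I') p :=
  LinearMap.id (R := ℝ) (M := E × E')

theorem mfderiv_fst_tangentPair (p : N × N') (w : TangentSpace I p.1 × TangentSpace I' p.2) :
    mfderiv (I.prod I') I Prod.fst p (tangentPair I I' p w) = w.1 :=
  DFunLike.congr_fun mfderiv_fst _

theorem mfderiv_snd_tangentPair (p : N × N') (w : TangentSpace I p.1 × TangentSpace I' p.2) :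
    mfderiv (I.prod I') I' Prod.snd p (tangentPair I I' p w) = w.2 :=
  DFunLike.congr_fun mfderiv_snd _

theorem tangentPair_eta (p : N × N') (w : TangentSpace (I.prod I') p) :
    tangentPair I I' p (mfderiv (I.prod I') I Prod.fst p w, mfderiv (I.prod I') I' Prod.snd p w) =
      w :=
  congrArg₂ (fun (a : E) (b : E') => (a, b)) (DFunLike.congr_fun mfderiv_fst w)
    (DFunLike.congr_fun mfderiv_snd w)

theorem tangent_prod_ext {p : N × N'} {w w' : TangentSpace (I.prod I') p}
    (h1 : mfderiv (I.prod I') I Prod.fst p w = mfderiv (I.prod I') I Prod.fst p w')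
    (h2 : mfderiv (I.prod I') I' Prod.snd p w = mfderiv (I.prod I') I' Prod.snd p w') : w = w' := by
  rw [← tangentPair_eta p w, h1, h2, tangentPair_eta]

end TangentPair

/-! ### Vertical and horizontal spaces of `X_Q` described upstairs on `Q × X`. -/

section FamilyGeometry

open Filter Set

variable {EG : Type*} [NormedAddCommGroup EG] [NormedSpace ℝ EG]
  {EQ : Type*} [NormedAddCommGroup EQ] [NormedSpace ℝ EQ]
  {EM : Type*} [NormedAddCommGroup EM] [NormedSpace ℝ EM]
  {EX : Type*} [NormedAddCommGroup EX] [NormedSpace ℝ EX]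
  {ES : Type*} [NormedAddCommGroup ES] [NormedSpace ℝ ES]
  {G : Type*} [TopologicalSpace G] [ChartedSpace EG G] [Group G] [LieGroup 𝓘(ℝ, EG) ∞ G]
  {Q : Type*} [TopologicalSpace Q] [ChartedSpace EQ Q] [IsManifold 𝓘(ℝ, EQ) ∞ Q]
  [MulAction Gᵐᵒᵖ Q]
  {M : Type*} [TopologicalSpace M] [ChartedSpace EM M] [IsManifold 𝓘(ℝ, EM) ∞ M]
  {r : Q → M} (hr : IsPrincipalBundle EG EQ EM G r)
  {X : Type*} [TopologicalSpace X] [ChartedSpace EX X] [IsManifold 𝓘(ℝ, EX) ∞ X]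
  [MulAction G X] [ContMDiffSMul 𝓘(ℝ, EG) 𝓘(ℝ, EX) ∞ G X]
  {S : Type*} [TopologicalSpace S] [ChartedSpace ES S] [IsManifold 𝓘(ℝ, ES) ∞ S]
  [MulAction G S] [ContMDiffSMul 𝓘(ℝ, EG) 𝓘(ℝ, ES) ∞ G S]

variable (EQ EX) in
/-- The generating vector field, as a linear function of the Lie algebra element. -/
noncomputable def generatingLinear (p : Q × X) : GroupLieAlgebra 𝓘(ℝ, EG) G →ₗ[ℝ]
    TangentSpace (𝓘(ℝ, EQ).prod 𝓘(ℝ, EX)) p :=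
  (mfderiv 𝓘(ℝ, EG) (𝓘(ℝ, EQ).prod 𝓘(ℝ, EX))
    (fun g : G => ((op g • p.1, g⁻¹ • p.2) : Q × X)) 1).toLinearMap

variable (EX) in
/-- The action field at a point, as a linear function of the Lie algebra element. -/
noncomputable def actionLinear (x : X) : GroupLieAlgebra 𝓘(ℝ, EG) G →ₗ[ℝ]
    TangentSpace 𝓘(ℝ, EX) x :=
  (mfderiv 𝓘(ℝ, EG) 𝓘(ℝ, EX) (fun g : G => g⁻¹ • x) 1).toLinearMap

theorem generatingLinear_apply (p : Q × X) (e : GroupLieAlgebra 𝓘(ℝ, EG) G) :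
    generatingLinear EQ EX p e = generatingField p e := rfl

theorem actionLinear_apply (x : X) (e : GroupLieAlgebra 𝓘(ℝ, EG) G) :
    actionLinear EX x e = actionField x e := rfl

/-- In the splitting given by a local section, the part tangent to the section factors through the
derivative of `q`, so only the orbit part remains. -/
theorem exists_generatingField_of_mfderiv_mk_eq_zero {p : Q × X}
    {w : TangentSpace (𝓘(ℝ, EQ).prod 𝓘(ℝ, EX)) p}
    (hw : mfderiv (𝓘(ℝ, EQ).prod 𝓘(ℝ, EX)) (𝓘(ℝ, EM).prod 𝓘(ℝ, EX)) (AssocSpace.mk hr) p w = 0) :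
    ∃ e : GroupLieAlgebra 𝓘(ℝ, EG) G, w = generatingField p e := by
  obtain ⟨τ, -, -, -, h⟩ := AssocSpace.exists_mfderiv_local_section (EY := EX) hr p
  obtain ⟨e, he⟩ := h w
  rw [hw, map_zero] at he
  exact ⟨e, he.trans (zero_add _)⟩

theorem mfderiv_mk_mfderiv_section {p : Q × X} {τ : AssocSpace hr X → Q × X}
    (hτ : ContMDiffAt (𝓘(ℝ, EM).prod 𝓘(ℝ, EX)) (𝓘(ℝ, EQ).prod 𝓘(ℝ, EX)) ∞ τ (AssocSpace.mk hr p))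
    (hp : τ (AssocSpace.mk hr p) = p)
    (hs : ∀ᶠ y in 𝓝 (AssocSpace.mk hr p), AssocSpace.mk hr (τ y) = y)
    (u : TangentSpace (𝓘(ℝ, EM).prod 𝓘(ℝ, EX)) (AssocSpace.mk hr p)) :
    mfderiv (𝓘(ℝ, EQ).prod 𝓘(ℝ, EX)) (𝓘(ℝ, EM).prod 𝓘(ℝ, EX)) (AssocSpace.mk hr) p
      (mfderiv (𝓘(ℝ, EM).prod 𝓘(ℝ, EX)) (𝓘(ℝ, EQ).prod 𝓘(ℝ, EX)) τ (AssocSpace.mk hr p) u) =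
      u := by
  have h1 := mfderiv_comp_apply_of_eq (x := AssocSpace.mk hr p) (y := p)
    ((AssocSpace.contMDiff_mk (EY := EX) hr).contMDiffAt.mdifferentiableAt (by simp))
    (hτ.mdifferentiableAt (by simp)) hp u
  have h2 : AssocSpace.mk hr ∘ τ =ᶠ[𝓝 (AssocSpace.mk hr p)] id := hs
  refine h1.symm.trans ((DFunLike.congr_fun h2.mfderiv_eq u).trans ?_)
  exact DFunLike.congr_fun mfderiv_id u

theorem mfderiv_mk_surjective (p : Q × X) : Function.Surjective
    (mfderiv (𝓘(ℝ, EQ).prod 𝓘(ℝ, EX)) (𝓘(ℝ, EM).prod 𝓘(ℝ, EX)) (AssocSpace.mk hr) p) := by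
  obtain ⟨τ, hτ, hp, hs, -⟩ := AssocSpace.exists_mfderiv_local_section (EY := EX) hr p
  exact fun u => ⟨_, mfderiv_mk_mfderiv_section hr hτ hp hs u⟩

theorem fiberDeriv_eq (p : Q × X) (v : TangentSpace 𝓘(ℝ, EX) p.2) :
    fiberDeriv hr p v = mfderiv (𝓘(ℝ, EQ).prod 𝓘(ℝ, EX)) (𝓘(ℝ, EM).prod 𝓘(ℝ, EX))
      (AssocSpace.mk hr) p (tangentPair 𝓘(ℝ, EQ) 𝓘(ℝ, EX) p (0, v)) := by
  have h1 := mfderiv_comp_apply_of_eq (x := p.2) (y := p) (f := fun x : X => (p.1, x))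
    ((AssocSpace.contMDiff_mk (EY := EX) hr).contMDiffAt.mdifferentiableAt (by simp))
    (mdifferentiableAt_const.prodMk mdifferentiableAt_id) rfl v
  refine h1.trans (congrArg _ ?_)
  exact DFunLike.congr_fun mfderiv_prod_right v

variable {Φ : (z : Q) → TangentSpace 𝓘(ℝ, EQ) z →ₗ[ℝ] GroupLieAlgebra 𝓘(ℝ, EG) G}

theorem connection_generatingField (hr : IsPrincipalBundle EG EQ EM G r)
    (hΦ : IsPrincipalConnection Φ) (p : Q × X) (e : GroupLieAlgebra 𝓘(ℝ, EG) G) :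
    Φ p.1 (mfderiv (𝓘(ℝ, EQ).prod 𝓘(ℝ, EX)) 𝓘(ℝ, EQ) Prod.fst p (generatingField p e)) = e := by
  rw [mfderiv_fst_generatingField hr]
  exact hΦ.vertical p.1 e

/-- If `(0, v)` is killed, it is a generating vector for some `e`. Evaluating `Φ` on its
`Q`-component, which is zero, gives `e = 0`, hence `v = 0`. -/
theorem fiberDeriv_injective (hΦ : IsPrincipalConnection Φ) (p : Q × X) : Function.Injective (fiberDeriv (EX := EX) hr p) := by
  rw [injective_iff_map_eq_zero]
  intro v hv
  rw [fiberDeriv_eq] at hv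
  obtain ⟨e, he⟩ := exists_generatingField_of_mfderiv_mk_eq_zero hr hv
  have h1 := connection_generatingField (EX := EX) hr hΦ p e
  rw [← he, mfderiv_fst_tangentPair, map_zero] at h1
  have h2 := congrArg (mfderiv (𝓘(ℝ, EQ).prod 𝓘(ℝ, EX)) 𝓘(ℝ, EX) Prod.snd p) he
  rw [mfderiv_snd_tangentPair, ← h1, ← generatingLinear_apply, map_zero, map_zero] at h2
  exact h2

/-- The derivative of the quotient map is unchanged under translation along the orbits. -/
theorem mfderiv_mk_orbitTranslation (g : G) (p : Q × X)
    (w : TangentSpace (𝓘(ℝ, EQ).prod 𝓘(ℝ, EX)) p) :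
    (⟨AssocSpace.mk hr (op g • p.1, g⁻¹ • p.2),
      mfderiv (𝓘(ℝ, EQ).prod 𝓘(ℝ, EX)) (𝓘(ℝ, EM).prod 𝓘(ℝ, EX)) (AssocSpace.mk hr)
        (op g • p.1, g⁻¹ • p.2)
        (mfderiv (𝓘(ℝ, EQ).prod 𝓘(ℝ, EX)) (𝓘(ℝ, EQ).prod 𝓘(ℝ, EX))
          (fun p' : Q × X => (op g • p'.1, g⁻¹ • p'.2)) p w)⟩ :
      TangentBundle (𝓘(ℝ, EM).prod 𝓘(ℝ, EX)) (AssocSpace hr X)) =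
    ⟨AssocSpace.mk hr p, mfderiv (𝓘(ℝ, EQ).prod 𝓘(ℝ, EX)) (𝓘(ℝ, EM).prod 𝓘(ℝ, EX))
      (AssocSpace.mk hr) p w⟩ := by
  have h1 := tangentMap_comp_at (I := 𝓘(ℝ, EQ).prod 𝓘(ℝ, EX)) (I' := 𝓘(ℝ, EQ).prod 𝓘(ℝ, EX))
    (I'' := 𝓘(ℝ, EM).prod 𝓘(ℝ, EX)) (f := fun p' : Q × X => (op g • p'.1, g⁻¹ • p'.2))
    (g := AssocSpace.mk hr (Y := X)) ⟨p, w⟩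
    ((AssocSpace.contMDiff_mk (EY := EX) hr).contMDiffAt.mdifferentiableAt (by simp))
    ((contMDiff_orbitTranslation (EY := EX) hr g).contMDiffAt.mdifferentiableAt (by simp))
  have h2 : AssocSpace.mk hr ∘ (fun p' : Q × X => (op g • p'.1, g⁻¹ • p'.2)) =
      AssocSpace.mk hr := funext fun p' => AssocSpace.mk_action hr g p'
  rw [h2] at h1
  exact h1.symm

theorem mfderiv_fst_orbitTranslation (hr : IsPrincipalBundle EG EQ EM G r) (g : G) (p : Q × X)
    (w : TangentSpace (𝓘(ℝ, EQ).prod 𝓘(ℝ, EX)) p) :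
    mfderiv (𝓘(ℝ, EQ).prod 𝓘(ℝ, EX)) 𝓘(ℝ, EQ) Prod.fst (op g • p.1, g⁻¹ • p.2)
      (mfderiv (𝓘(ℝ, EQ).prod 𝓘(ℝ, EX)) (𝓘(ℝ, EQ).prod 𝓘(ℝ, EX))
        (fun p' : Q × X => (op g • p'.1, g⁻¹ • p'.2)) p w) =
      mfderiv 𝓘(ℝ, EQ) 𝓘(ℝ, EQ) (fun z' : Q => op g • z') p.1
        (mfderiv (𝓘(ℝ, EQ).prod 𝓘(ℝ, EX)) 𝓘(ℝ, EQ) Prod.fst p w) := by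
  have hg : ContMDiff 𝓘(ℝ, EQ) 𝓘(ℝ, EQ) ∞ (fun z : Q => op g • z) :=
    hr.smooth_action.comp (contMDiff_id.prodMk contMDiff_const)
  exact (mfderiv_comp_apply p mdifferentiableAt_fst
    ((contMDiff_orbitTranslation (EY := EX) hr g).contMDiffAt.mdifferentiableAt (by simp)) w).symm.trans
    (mfderiv_comp_apply p (g := fun z : Q => op g • z) (hg.contMDiffAt.mdifferentiableAt (by simp))
      mdifferentiableAt_fst w)

theorem mfderiv_snd_orbitTranslation (hr : IsPrincipalBundle EG EQ EM G r) (g : G) (p : Q × X)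
    (w : TangentSpace (𝓘(ℝ, EQ).prod 𝓘(ℝ, EX)) p) :
    mfderiv (𝓘(ℝ, EQ).prod 𝓘(ℝ, EX)) 𝓘(ℝ, EX) Prod.snd (op g • p.1, g⁻¹ • p.2)
      (mfderiv (𝓘(ℝ, EQ).prod 𝓘(ℝ, EX)) (𝓘(ℝ, EQ).prod 𝓘(ℝ, EX))
        (fun p' : Q × X => (op g • p'.1, g⁻¹ • p'.2)) p w) =
      mfderiv 𝓘(ℝ, EX) 𝓘(ℝ, EX) (fun x' : X => g⁻¹ • x') p.2
        (mfderiv (𝓘(ℝ, EQ).prod 𝓘(ℝ, EX)) 𝓘(ℝ, EX) Prod.snd p w) := by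
  have hg : ContMDiff 𝓘(ℝ, EX) 𝓘(ℝ, EX) ∞ (fun x : X => g⁻¹ • x) :=
    (contMDiff_const (I' := 𝓘(ℝ, EG))).smul contMDiff_id
  exact (mfderiv_comp_apply p mdifferentiableAt_snd
    ((contMDiff_orbitTranslation (EY := EX) hr g).contMDiffAt.mdifferentiableAt (by simp)) w).symm.trans
    (mfderiv_comp_apply p (g := fun x : X => g⁻¹ • x) (hg.contMDiffAt.mdifferentiableAt (by simp))
      mdifferentiableAt_snd w)

variable {π : X → S} {Hor : (x : X) → Submodule ℝ (TangentSpace 𝓘(ℝ, EX) x)}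

theorem IsEquivariantFamily.mfderiv_actionField (hπ : IsEquivariantFamily EX ES G π Hor) (x : X)
    (e : GroupLieAlgebra 𝓘(ℝ, EG) G) :
    mfderiv 𝓘(ℝ, EX) 𝓘(ℝ, ES) π x (actionField x e) = actionField (π x) e := by
  have h1 : ContMDiff 𝓘(ℝ, EG) 𝓘(ℝ, EX) ∞ (fun g : G => g⁻¹ • x) :=
    (contMDiff_inv 𝓘(ℝ, EG) ∞).smul contMDiff_const
  have h2 := mfderiv_comp_apply_of_eq (x := (1 : G)) (y := x)
    (hπ.smooth.contMDiffAt.mdifferentiableAt (by simp))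
    (h1.contMDiffAt.mdifferentiableAt (by simp)) (by simp) e
  have h3 : π ∘ (fun g : G => g⁻¹ • x) = fun g => g⁻¹ • π x :=
    funext fun g => hπ.equivariant _ _
  rw [h3] at h2
  exact h2.symm

/-- Near `[p]` the induced map is `q_S ∘ (id × π) ∘ τ` for a local section `τ`, with `q_S` the
quotient map of `Q × S`. -/
theorem mdifferentiableAt_assocMap (hπ : IsEquivariantFamily EX ES G π Hor) (p : Q × X) :
    MDifferentiableAt (𝓘(ℝ, EM).prod 𝓘(ℝ, EX)) (𝓘(ℝ, EM).prod 𝓘(ℝ, ES))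
      (AssocSpace.map hr π hπ.equivariant) (AssocSpace.mk hr p) := by
  obtain ⟨τ, hτ, -, hs, -⟩ := AssocSpace.exists_mfderiv_local_section (EY := EX) hr p
  have h1 : ContMDiff (𝓘(ℝ, EQ).prod 𝓘(ℝ, EX)) (𝓘(ℝ, EM).prod 𝓘(ℝ, ES)) ∞
      (fun p : Q × X => AssocSpace.mk hr (p.1, π p.2)) :=
    (AssocSpace.contMDiff_mk (EY := ES) hr).comp
      (contMDiff_fst.prodMk (hπ.smooth.comp contMDiff_snd))
  have h2 := (h1.contMDiffAt.comp _ hτ).mdifferentiableAt (by simp)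
  refine h2.congr_of_eventuallyEq ?_
  filter_upwards [hs] with y hy
  conv_lhs => rw [← hy]
  rfl

theorem mfderiv_assocMap (hπ : IsEquivariantFamily EX ES G π Hor) (p : Q × X)
    (w : TangentSpace (𝓘(ℝ, EQ).prod 𝓘(ℝ, EX)) p) :
    mfderiv (𝓘(ℝ, EM).prod 𝓘(ℝ, EX)) (𝓘(ℝ, EM).prod 𝓘(ℝ, ES))
      (AssocSpace.map hr π hπ.equivariant) (AssocSpace.mk hr p)
      (mfderiv (𝓘(ℝ, EQ).prod 𝓘(ℝ, EX)) (𝓘(ℝ, EM).prod 𝓘(ℝ, EX)) (AssocSpace.mk hr) p w) =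
    mfderiv (𝓘(ℝ, EQ).prod 𝓘(ℝ, ES)) (𝓘(ℝ, EM).prod 𝓘(ℝ, ES)) (AssocSpace.mk hr) (p.1, π p.2)
      (tangentPair 𝓘(ℝ, EQ) 𝓘(ℝ, ES) (p.1, π p.2)
        (mfderiv (𝓘(ℝ, EQ).prod 𝓘(ℝ, EX)) 𝓘(ℝ, EQ) Prod.fst p w,
          mfderiv 𝓘(ℝ, EX) 𝓘(ℝ, ES) π p.2
            (mfderiv (𝓘(ℝ, EQ).prod 𝓘(ℝ, EX)) 𝓘(ℝ, EX) Prod.snd p w))) := by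
  have hmk := (AssocSpace.contMDiff_mk (EY := EX) hr).contMDiffAt (x := p)
  have hfst := mdifferentiableAt_fst (I := 𝓘(ℝ, EQ)) (I' := 𝓘(ℝ, EX)) (x := p)
  have hsnd := mdifferentiableAt_snd (I := 𝓘(ℝ, EQ)) (I' := 𝓘(ℝ, EX)) (x := p)
  have hπp := hπ.smooth.contMDiffAt.mdifferentiableAt (x := p.2) (by simp)
  have h1 := mfderiv_comp_apply p (mdifferentiableAt_assocMap hr hπ p)
    (hmk.mdifferentiableAt (by simp)) w
  have h2 := mfderiv_comp_apply p (g := AssocSpace.mk hr (Y := S))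
    (f := fun p : Q × X => (p.1, π p.2))
    ((AssocSpace.contMDiff_mk (EY := ES) hr).contMDiffAt.mdifferentiableAt (by simp))
    (hfst.prodMk (hπp.comp p hsnd)) w
  refine h1.symm.trans (h2.trans (congrArg _ ?_))
  refine (DFunLike.congr_fun (mfderiv_prodMk hfst (hπp.comp p hsnd)) w).trans ?_
  exact congrArg (fun v => tangentPair 𝓘(ℝ, EQ) 𝓘(ℝ, ES) (p.1, π p.2)
    (mfderiv (𝓘(ℝ, EQ).prod 𝓘(ℝ, EX)) 𝓘(ℝ, EQ) Prod.fst p w, v)) (mfderiv_comp_apply p hπp hsnd w)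

/-- A lift `w` of a vertical vector goes under `id × π` to a generating vector of `Q × S`.
Equivariance of `π` makes the generating vector of the same `e` on `Q × X` lie above it; subtracting
it does not change the image in `X_Q` and leaves `(0, v)` with `v` vertical. -/
theorem mem_verticalQ (hπ : IsEquivariantFamily EX ES G π Hor) {p : Q × X}
    {u : TangentSpace (𝓘(ℝ, EM).prod 𝓘(ℝ, EX)) (AssocSpace.mk hr p)} :
    u ∈ verticalQ hr hπ (AssocSpace.mk hr p) ↔
      ∃ v ∈ verticalSpace 𝓘(ℝ, EX) 𝓘(ℝ, ES) π p.2, fiberDeriv hr p v = u := by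
  constructor
  · intro hu
    obtain ⟨w, rfl⟩ := mfderiv_mk_surjective hr p u
    have h1 := mem_verticalSpace.1 hu
    rw [mfderiv_assocMap hr hπ] at h1
    obtain ⟨e, he⟩ := exists_generatingField_of_mfderiv_mk_eq_zero hr h1
    have h2 := congrArg (mfderiv (𝓘(ℝ, EQ).prod 𝓘(ℝ, ES)) 𝓘(ℝ, EQ) Prod.fst (p.1, π p.2)) he
    have h3 := congrArg (mfderiv (𝓘(ℝ, EQ).prod 𝓘(ℝ, ES)) 𝓘(ℝ, ES) Prod.snd (p.1, π p.2)) he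
    rw [mfderiv_fst_tangentPair, mfderiv_fst_generatingField hr] at h2
    rw [mfderiv_snd_tangentPair, mfderiv_snd_generatingField hr] at h3
    refine ⟨mfderiv (𝓘(ℝ, EQ).prod 𝓘(ℝ, EX)) 𝓘(ℝ, EX) Prod.snd p w - actionField p.2 e, ?_, ?_⟩
    · rw [mem_verticalSpace, map_sub, hπ.mfderiv_actionField, sub_eq_zero]
      exact h3
    · have h4 : tangentPair 𝓘(ℝ, EQ) 𝓘(ℝ, EX) p
          (0, mfderiv (𝓘(ℝ, EQ).prod 𝓘(ℝ, EX)) 𝓘(ℝ, EX) Prod.snd p w - actionField p.2 e) =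
          w - generatingField p e := by
        apply tangent_prod_ext
        · rw [mfderiv_fst_tangentPair, map_sub, mfderiv_fst_generatingField hr]
          exact (sub_eq_zero.2 h2).symm
        · rw [mfderiv_snd_tangentPair, map_sub, mfderiv_snd_generatingField hr]
      rw [fiberDeriv_eq, h4, map_sub, mfderiv_mk_generatingField, sub_zero]
  · rintro ⟨v, hv, rfl⟩
    refine mem_verticalSpace.2 ?_
    rw [fiberDeriv_eq, mfderiv_assocMap hr hπ, mfderiv_fst_tangentPair, mfderiv_snd_tangentPair,
      mem_verticalSpace.1 hv, Prod.mk_zero_zero, map_zero]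
    exact map_zero _

/-- The definition of `H_Q` takes a span over all representatives of the point. Invariance of `ker
Φ` and `Hor` moves every lift to the given `p`, and the lifts at `p` already form a subspace. -/
theorem mem_horizontalQ (hΦ : IsPrincipalConnection Φ) (hπ : IsEquivariantFamily EX ES G π Hor)
    {p : Q × X} {u : TangentSpace (𝓘(ℝ, EM).prod 𝓘(ℝ, EX)) (AssocSpace.mk hr p)} :
    u ∈ horizontalQ hr Φ Hor (AssocSpace.mk hr p) ↔
      ∃ w : TangentSpace (𝓘(ℝ, EQ).prod 𝓘(ℝ, EX)) p,
        Φ p.1 (mfderiv (𝓘(ℝ, EQ).prod 𝓘(ℝ, EX)) 𝓘(ℝ, EQ) Prod.fst p w) = 0 ∧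
        mfderiv (𝓘(ℝ, EQ).prod 𝓘(ℝ, EX)) 𝓘(ℝ, EX) Prod.snd p w ∈ Hor p.2 ∧
        mfderiv (𝓘(ℝ, EQ).prod 𝓘(ℝ, EX)) (𝓘(ℝ, EM).prod 𝓘(ℝ, EX)) (AssocSpace.mk hr) p w = u := by
  constructor
  · intro hu
    refine Submodule.span_induction ?_ ⟨0, ?_, ?_, ?_⟩ ?_ ?_ hu
    · rintro u ⟨p', w, hw1, hw2, h⟩
      have hp : AssocSpace.mk hr p' = AssocSpace.mk hr p :=
        (congrArg Bundle.TotalSpace.proj h).symm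
      obtain ⟨g, rfl⟩ := (AssocSpace.mk_eq_iff hr).1 hp
      refine ⟨mfderiv (𝓘(ℝ, EQ).prod 𝓘(ℝ, EX)) (𝓘(ℝ, EQ).prod 𝓘(ℝ, EX))
        (fun p : Q × X => (op g • p.1, g⁻¹ • p.2)) p' w, ?_, ?_, ?_⟩
      · rw [mfderiv_fst_orbitTranslation hr]
        refine (hΦ.equivariant g p'.1 _).trans ?_
        rw [hw1]
        exact map_zero _
      · rw [mfderiv_snd_orbitTranslation hr]
        exact hπ.invariant _ _ _ hw2
      · have h1 := h.trans (mfderiv_mk_orbitTranslation hr g p' w).symm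
        exact (eq_of_heq (Bundle.TotalSpace.mk.inj h1).2).symm
    · rw [map_zero, map_zero]
    · rw [map_zero]; exact zero_mem _
    · rw [map_zero]
    · rintro _ _ - - ⟨w, h1, h2, rfl⟩ ⟨w', h1', h2', rfl⟩
      refine ⟨w + w', ?_, ?_, map_add _ _ _⟩
      · rw [map_add, map_add, h1, h1', add_zero]
      · rw [map_add]; exact add_mem h2 h2'
    · rintro c _ - ⟨w, h1, h2, rfl⟩
      refine ⟨c • w, ?_, ?_, map_smul _ _ _⟩
      · rw [map_smul, map_smul, h1, smul_zero]
      · rw [map_smul]; exact Submodule.smul_mem _ _ h2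
  · rintro ⟨w, h1, h2, rfl⟩
    exact Submodule.subset_span ⟨p, w, h1, h2, rfl⟩

end FamilyGeometry

/-! ### The splitting of `T(Q × X)` and the projections along `H_Q`. -/

section FamilySmooth

open Filter Set

variable {EG : Type*} [NormedAddCommGroup EG] [NormedSpace ℝ EG]
  {EQ : Type*} [NormedAddCommGroup EQ] [NormedSpace ℝ EQ]
  {EM : Type*} [NormedAddCommGroup EM] [NormedSpace ℝ EM]
  {EX : Type*} [NormedAddCommGroup EX] [NormedSpace ℝ EX]
  {ES : Type*} [NormedAddCommGroup ES] [NormedSpace ℝ ES]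
  {G : Type*} [TopologicalSpace G] [ChartedSpace EG G] [Group G] [LieGroup 𝓘(ℝ, EG) ∞ G]
  {Q : Type*} [TopologicalSpace Q] [ChartedSpace EQ Q] [IsManifold 𝓘(ℝ, EQ) ∞ Q]
  [MulAction Gᵐᵒᵖ Q]
  {M : Type*} [TopologicalSpace M] [ChartedSpace EM M] [IsManifold 𝓘(ℝ, EM) ∞ M]
  {r : Q → M} (hr : IsPrincipalBundle EG EQ EM G r)
  {X : Type*} [TopologicalSpace X] [ChartedSpace EX X] [IsManifold 𝓘(ℝ, EX) ∞ X]
  [MulAction G X] [ContMDiffSMul 𝓘(ℝ, EG) 𝓘(ℝ, EX) ∞ G X]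
  {S : Type*} [TopologicalSpace S] [ChartedSpace ES S] [IsManifold 𝓘(ℝ, ES) ∞ S]
  [MulAction G S] [ContMDiffSMul 𝓘(ℝ, EG) 𝓘(ℝ, ES) ∞ G S]


variable {Φ : (z : Q) → TangentSpace 𝓘(ℝ, EQ) z →ₗ[ℝ] GroupLieAlgebra 𝓘(ℝ, EG) G}
  {π : X → S} {Hor : (x : X) → Submodule ℝ (TangentSpace 𝓘(ℝ, EX) x)}

section Splitting

/-- The linear map `w ↦ dpr_X(w) - ξ(Φ(dpr_Q(w)))` from `T(Q × X)` to `TX`. It vanishes on the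
generating fields. -/
noncomputable def connectionShift
    (Φ : (z : Q) → TangentSpace 𝓘(ℝ, EQ) z →ₗ[ℝ] GroupLieAlgebra 𝓘(ℝ, EG) G) (p : Q × X) :
    TangentSpace (𝓘(ℝ, EQ).prod 𝓘(ℝ, EX)) p →ₗ[ℝ] TangentSpace 𝓘(ℝ, EX) p.2 :=
  (mfderiv (𝓘(ℝ, EQ).prod 𝓘(ℝ, EX)) 𝓘(ℝ, EX) Prod.snd p).toLinearMap -
    actionLinear EX p.2 ∘ₗ Φ p.1 ∘ₗ
      (mfderiv (𝓘(ℝ, EQ).prod 𝓘(ℝ, EX)) 𝓘(ℝ, EQ) Prod.fst p).toLinearMap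

theorem connectionShift_apply (p : Q × X) (w : TangentSpace (𝓘(ℝ, EQ).prod 𝓘(ℝ, EX)) p) :
    connectionShift Φ p w = mfderiv (𝓘(ℝ, EQ).prod 𝓘(ℝ, EX)) 𝓘(ℝ, EX) Prod.snd p w -
      actionField p.2
        (Φ p.1 (mfderiv (𝓘(ℝ, EQ).prod 𝓘(ℝ, EX)) 𝓘(ℝ, EQ) Prod.fst p w)) :=
  rfl

variable (ES) in
/-- The part of a tangent vector of `Q × X` in `ker Φ ⊕ Hor`. -/
noncomputable def horizontalPart
    (Φ : (z : Q) → TangentSpace 𝓘(ℝ, EQ) z →ₗ[ℝ] GroupLieAlgebra 𝓘(ℝ, EG) G) (π : X → S)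
    (Hor : (x : X) → Submodule ℝ (TangentSpace 𝓘(ℝ, EX) x)) (p : Q × X)
    (w : TangentSpace (𝓘(ℝ, EQ).prod 𝓘(ℝ, EX)) p) : TangentSpace (𝓘(ℝ, EQ).prod 𝓘(ℝ, EX)) p :=
  tangentPair 𝓘(ℝ, EQ) 𝓘(ℝ, EX) p
    (mfderiv (𝓘(ℝ, EQ).prod 𝓘(ℝ, EX)) 𝓘(ℝ, EQ) Prod.fst p w -
      fundamentalField EQ p.1 (Φ p.1 (mfderiv (𝓘(ℝ, EQ).prod 𝓘(ℝ, EX)) 𝓘(ℝ, EQ) Prod.fst p w)),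
    (projAlong (Hor p.2) (verticalSpace 𝓘(ℝ, EX) 𝓘(ℝ, ES) π p.2) (connectionShift Φ p w) :
      TangentSpace 𝓘(ℝ, EX) p.2))

theorem mfderiv_mk_horizontalPart_mem (hΦ : IsPrincipalConnection Φ)
    (hπ : IsEquivariantFamily EX ES G π Hor) (p : Q × X)
    (w : TangentSpace (𝓘(ℝ, EQ).prod 𝓘(ℝ, EX)) p) :
    mfderiv (𝓘(ℝ, EQ).prod 𝓘(ℝ, EX)) (𝓘(ℝ, EM).prod 𝓘(ℝ, EX)) (AssocSpace.mk hr) p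
      (horizontalPart ES Φ π Hor p w) ∈ horizontalQ hr Φ Hor (AssocSpace.mk hr p) := by
  refine (mem_horizontalQ hr hΦ hπ).2 ⟨_, ?_, ?_, rfl⟩
  · rw [horizontalPart, mfderiv_fst_tangentPair, map_sub, sub_eq_zero]
    exact (hΦ.vertical _ _).symm
  · rw [horizontalPart, mfderiv_snd_tangentPair]
    exact Subtype.coe_prop _

/-- Upstairs `w` has a third summand, the generating vector of `Φ(w_Q)`, which disappears in the
quotient. Subtracting it from `w_X` is what produces `connectionShift`. -/
theorem mfderiv_mk_eq_add (hπ : IsEquivariantFamily EX ES G π Hor) (p : Q × X)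
    (w : TangentSpace (𝓘(ℝ, EQ).prod 𝓘(ℝ, EX)) p) :
    mfderiv (𝓘(ℝ, EQ).prod 𝓘(ℝ, EX)) (𝓘(ℝ, EM).prod 𝓘(ℝ, EX)) (AssocSpace.mk hr) p w =
      mfderiv (𝓘(ℝ, EQ).prod 𝓘(ℝ, EX)) (𝓘(ℝ, EM).prod 𝓘(ℝ, EX)) (AssocSpace.mk hr) p
        (horizontalPart ES Φ π Hor p w) +
      fiberDeriv hr p (projAlong (verticalSpace 𝓘(ℝ, EX) 𝓘(ℝ, ES) π p.2) (Hor p.2)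
        (connectionShift Φ p w) : TangentSpace 𝓘(ℝ, EX) p.2) := by
  set e := Φ p.1 (mfderiv (𝓘(ℝ, EQ).prod 𝓘(ℝ, EX)) 𝓘(ℝ, EQ) Prod.fst p w) with he
  have h1 : w = horizontalPart ES Φ π Hor p w + tangentPair 𝓘(ℝ, EQ) 𝓘(ℝ, EX) p
      (0, (projAlong (verticalSpace 𝓘(ℝ, EX) 𝓘(ℝ, ES) π p.2) (Hor p.2)
        (connectionShift Φ p w) : TangentSpace 𝓘(ℝ, EX) p.2)) + generatingField p e := by
    apply tangent_prod_ext
    · rw [map_add, map_add, mfderiv_fst_tangentPair, horizontalPart, mfderiv_fst_tangentPair,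
        mfderiv_fst_generatingField hr, add_zero, sub_add_cancel]
    · rw [map_add, map_add, mfderiv_snd_tangentPair, horizontalPart, mfderiv_snd_tangentPair,
        mfderiv_snd_generatingField hr,
        projAlong_add_projAlong (isCompl_verticalSpace (hπ.horizontal p.2)).symm,
        connectionShift_apply, sub_add_cancel]
  conv_lhs => rw [h1]
  rw [map_add, map_add, mfderiv_mk_generatingField, add_zero, fiberDeriv_eq]

theorem isCompl_verticalQ_horizontalQ (hΦ : IsPrincipalConnection Φ)
    (hπ : IsEquivariantFamily EX ES G π Hor) (y : AssocSpace hr X) :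
    IsCompl (verticalQ hr hπ y) (horizontalQ hr Φ Hor y) := by
  obtain ⟨p, rfl⟩ := AssocSpace.mk_surjective hr y
  constructor
  · rw [Submodule.disjoint_def]
    intro u hu hu'
    obtain ⟨v, hv, rfl⟩ := (mem_verticalQ hr hπ).1 hu
    obtain ⟨w, hw1, hw2, hw⟩ := (mem_horizontalQ hr hΦ hπ).1 hu'
    rw [fiberDeriv_eq, ← sub_eq_zero, ← map_sub] at hw
    obtain ⟨e, he⟩ := exists_generatingField_of_mfderiv_mk_eq_zero hr hw
    have h1 := congrArg
      (fun w => Φ p.1 (mfderiv (𝓘(ℝ, EQ).prod 𝓘(ℝ, EX)) 𝓘(ℝ, EQ) Prod.fst p w)) he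
    simp only [connection_generatingField hr hΦ, map_sub, mfderiv_fst_tangentPair, hw1,
      sub_zero] at h1
    -- The lifts `(0, v)` and `w` differ by a generating vector on which `Φ` vanishes, so they
    -- coincide and `v` lies in `Hor` as well.
    rw [← h1, ← generatingLinear_apply, map_zero, sub_eq_zero] at he
    rw [he, mfderiv_snd_tangentPair] at hw2
    have h2 := (Submodule.disjoint_def.1
      (isCompl_verticalSpace (hπ.horizontal p.2)).disjoint) v hv hw2
    rw [h2, map_zero]
  · rw [codisjoint_iff, Submodule.eq_top_iff']
    intro u
    obtain ⟨w, rfl⟩ := mfderiv_mk_surjective hr p u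
    rw [mfderiv_mk_eq_add hr (Φ := Φ) hπ, Submodule.mem_sup]
    exact ⟨_, (mem_verticalQ hr hπ).2 ⟨_, Subtype.coe_prop _, rfl⟩, _,
      mfderiv_mk_horizontalPart_mem hr hΦ hπ p w, add_comm _ _⟩

theorem bijOn_fiberDeriv (hΦ : IsPrincipalConnection Φ)
    (hπ : IsEquivariantFamily EX ES G π Hor) (p : Q × X) :
    BijOn (fiberDeriv (EX := EX) hr p) (verticalSpace 𝓘(ℝ, EX) 𝓘(ℝ, ES) π p.2)
      (verticalQ hr hπ (AssocSpace.mk hr p)) :=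
  ⟨fun v hv => (mem_verticalQ hr hπ).2 ⟨v, hv, rfl⟩, (fiberDeriv_injective hr hΦ p).injOn,
    fun _ hu => (mem_verticalQ hr hπ).1 hu⟩

/-- The formula `P_Q ∘ q_* = P ∘ σ`, up to the identification. Applied to a bracket, it is the
source of the term `ω^a P ξ_a`. -/
theorem projAlong_verticalQ_mfderiv_mk (hΦ : IsPrincipalConnection Φ)
    (hπ : IsEquivariantFamily EX ES G π Hor) (p : Q × X)
    (w : TangentSpace (𝓘(ℝ, EQ).prod 𝓘(ℝ, EX)) p) :
    (projAlong (verticalQ hr hπ (AssocSpace.mk hr p)) (horizontalQ hr Φ Hor (AssocSpace.mk hr p))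
      (mfderiv (𝓘(ℝ, EQ).prod 𝓘(ℝ, EX)) (𝓘(ℝ, EM).prod 𝓘(ℝ, EX)) (AssocSpace.mk hr) p w) :
        TangentSpace (𝓘(ℝ, EM).prod 𝓘(ℝ, EX)) (AssocSpace.mk hr p)) =
      fiberDeriv hr p (projAlong (verticalSpace 𝓘(ℝ, EX) 𝓘(ℝ, ES) π p.2) (Hor p.2)
        (connectionShift Φ p w) : TangentSpace 𝓘(ℝ, EX) p.2) := by
  refine projAlong_eq_of_sub_mem (isCompl_verticalQ_horizontalQ hr hΦ hπ _)
    ((mem_verticalQ hr hπ).2 ⟨_, Subtype.coe_prop _, rfl⟩) ?_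
  rw [mfderiv_mk_eq_add hr (Φ := Φ) hπ, add_sub_cancel_right]
  exact mfderiv_mk_horizontalPart_mem hr hΦ hπ p w

theorem projAlong_horizontalQ_mfderiv_mk (hΦ : IsPrincipalConnection Φ)
    (hπ : IsEquivariantFamily EX ES G π Hor) (p : Q × X)
    (w : TangentSpace (𝓘(ℝ, EQ).prod 𝓘(ℝ, EX)) p) :
    (projAlong (horizontalQ hr Φ Hor (AssocSpace.mk hr p)) (verticalQ hr hπ (AssocSpace.mk hr p))
      (mfderiv (𝓘(ℝ, EQ).prod 𝓘(ℝ, EX)) (𝓘(ℝ, EM).prod 𝓘(ℝ, EX)) (AssocSpace.mk hr) p w) :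
        TangentSpace (𝓘(ℝ, EM).prod 𝓘(ℝ, EX)) (AssocSpace.mk hr p)) =
      mfderiv (𝓘(ℝ, EQ).prod 𝓘(ℝ, EX)) (𝓘(ℝ, EM).prod 𝓘(ℝ, EX)) (AssocSpace.mk hr) p
        (horizontalPart ES Φ π Hor p w) := by
  refine projAlong_eq_of_sub_mem (isCompl_verticalQ_horizontalQ hr hΦ hπ _).symm
    (mfderiv_mk_horizontalPart_mem hr hΦ hπ p w) ?_
  rw [mfderiv_mk_eq_add hr (Φ := Φ) hπ, add_sub_cancel_left]
  exact (mem_verticalQ hr hπ).2 ⟨_, Subtype.coe_prop _, rfl⟩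

end Splitting

end FamilySmooth

/-! ### Smoothness of the action fields and of the projection along `H_Q`. -/

section FamilyFields

open Filter Set

variable {EG : Type*} [NormedAddCommGroup EG] [NormedSpace ℝ EG]
  {EQ : Type*} [NormedAddCommGroup EQ] [NormedSpace ℝ EQ]
  {EM : Type*} [NormedAddCommGroup EM] [NormedSpace ℝ EM]
  {EX : Type*} [NormedAddCommGroup EX] [NormedSpace ℝ EX]
  {ES : Type*} [NormedAddCommGroup ES] [NormedSpace ℝ ES]
  {G : Type*} [TopologicalSpace G] [ChartedSpace EG G] [Group G] [LieGroup 𝓘(ℝ, EG) ∞ G]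
  {Q : Type*} [TopologicalSpace Q] [ChartedSpace EQ Q] [IsManifold 𝓘(ℝ, EQ) ∞ Q]
  [MulAction Gᵐᵒᵖ Q]
  {M : Type*} [TopologicalSpace M] [ChartedSpace EM M] [IsManifold 𝓘(ℝ, EM) ∞ M]
  {r : Q → M} (hr : IsPrincipalBundle EG EQ EM G r)
  {X : Type*} [TopologicalSpace X] [ChartedSpace EX X] [IsManifold 𝓘(ℝ, EX) ∞ X]
  [MulAction G X] [ContMDiffSMul 𝓘(ℝ, EG) 𝓘(ℝ, EX) ∞ G X]
  {S : Type*} [TopologicalSpace S] [ChartedSpace ES S] [IsManifold 𝓘(ℝ, ES) ∞ S]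
  [MulAction G S] [ContMDiffSMul 𝓘(ℝ, EG) 𝓘(ℝ, ES) ∞ G S]


variable {Φ : (z : Q) → TangentSpace 𝓘(ℝ, EQ) z →ₗ[ℝ] GroupLieAlgebra 𝓘(ℝ, EG) G}
  {π : X → S} {Hor : (x : X) → Submodule ℝ (TangentSpace 𝓘(ℝ, EX) x)}


section Along

variable {EZ : Type*} [NormedAddCommGroup EZ] [NormedSpace ℝ EZ]
  {HZ : Type*} [TopologicalSpace HZ] {J : ModelWithCorners ℝ EZ HZ}
  {Z : Type*} [TopologicalSpace Z] [ChartedSpace HZ Z] {z₀ : Z}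

/-- A smooth function with values in the tangent space at a point is a smooth field along the
constant map. -/
theorem ContMDiffAt.const_along (x : X) {c : Z → TangentSpace 𝓘(ℝ, EX) x}
    (hc : ContMDiffAt (M' := EX) J 𝓘(ℝ, EX) ∞ c z₀) :
    ContMDiffAt J 𝓘(ℝ, EX).tangent ∞ (fun z => (⟨x, c z⟩ : TangentBundle 𝓘(ℝ, EX) X)) z₀ := by
  rw [contMDiffAt_along_iff (b := fun _ => x) contMDiffAt_const]
  have h : ∀ L : EX →L[ℝ] EX, ContMDiffAt J 𝓘(ℝ, EX) ∞ (fun z => L (c z)) z₀ :=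
    fun L => L.contMDiff.contMDiffAt.comp z₀ hc
  exact h ((trivializationAt EX (TangentSpace 𝓘(ℝ, EX)) x).continuousLinearMapAt ℝ x)

/-- The value is the derivative of `(g, x) ↦ g⁻¹ • x` at `(1, b z)` on `(c z, 0)`, so joint
smoothness in the point and the Lie algebra element comes from smoothness of the action. -/
theorem ContMDiffAt.actionField_along {b : Z → X} (hb : ContMDiffAt J 𝓘(ℝ, EX) ∞ b z₀)
    {c : Z → GroupLieAlgebra 𝓘(ℝ, EG) G} (hc : ContMDiffAt (M' := EG) J 𝓘(ℝ, EG) ∞ c z₀) :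
    ContMDiffAt J 𝓘(ℝ, EX).tangent ∞
      (fun z => (⟨b z, actionField (b z) (c z)⟩ : TangentBundle 𝓘(ℝ, EX) X)) z₀ := by
  have ha : ContMDiff (𝓘(ℝ, EG).prod 𝓘(ℝ, EX)) 𝓘(ℝ, EX) ∞ (fun P : G × X => P.1⁻¹ • P.2) :=
    ((contMDiff_inv 𝓘(ℝ, EG) ∞).comp contMDiff_fst).smul contMDiff_snd
  have h1 := (ContMDiffAt.const_along (X := G) 1 hc).prodMk_along hb.zero_along
  have h2 := ContMDiffAt.mfderiv_along (b := fun z => ((1 : G), b z)) (ha.contMDiffAt) h1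
  refine h2.congr_of_eventuallyEq (Eventually.of_forall fun z => ?_)
  have h3 := mfderiv_comp_apply_of_eq (x := (1 : G)) (y := ((1 : G), b z))
    (f := fun g : G => (g, b z)) (g := fun P : G × X => P.1⁻¹ • P.2)
    (ha.contMDiffAt.mdifferentiableAt (by simp))
    (mdifferentiableAt_id.prodMk mdifferentiableAt_const) rfl (c z)
  have h4 : mfderiv 𝓘(ℝ, EG) (𝓘(ℝ, EG).prod 𝓘(ℝ, EX)) (fun g : G => (g, b z)) 1 (c z) =
      (c z, 0) := DFunLike.congr_fun mfderiv_prod_left (c z)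
  rw [h4] at h3
  exact Bundle.TotalSpace.ext (by simp) (@heq_of_eq EX _ _ h3)

theorem ContMDiffAt.fundamentalField_along (hr : IsPrincipalBundle EG EQ EM G r) {b : Z → Q}
    (hb : ContMDiffAt J 𝓘(ℝ, EQ) ∞ b z₀) {c : Z → GroupLieAlgebra 𝓘(ℝ, EG) G}
    (hc : ContMDiffAt (M' := EG) J 𝓘(ℝ, EG) ∞ c z₀) :
    ContMDiffAt J 𝓘(ℝ, EQ).tangent ∞
      (fun z => (⟨b z, fundamentalField EQ (b z) (c z)⟩ : TangentBundle 𝓘(ℝ, EQ) Q)) z₀ := by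
  have h1 := hb.zero_along.prodMk_along (ContMDiffAt.const_along (X := G) 1 hc)
  have h2 := ContMDiffAt.mfderiv_along (b := fun z => (b z, (1 : G)))
    (hr.smooth_action.contMDiffAt) h1
  refine h2.congr_of_eventuallyEq (Eventually.of_forall fun z => ?_)
  have h3 := mfderiv_comp_apply_of_eq (x := (1 : G)) (y := (b z, (1 : G)))
    (f := fun g : G => (b z, g)) (g := fun P : Q × G => op P.2 • P.1)
    (hr.smooth_action.contMDiffAt.mdifferentiableAt (by simp))
    (mdifferentiableAt_const.prodMk mdifferentiableAt_id) rfl (c z)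
  have h4 : mfderiv 𝓘(ℝ, EG) (𝓘(ℝ, EQ).prod 𝓘(ℝ, EG)) (fun g : G => (b z, g)) 1 (c z) =
      (0, c z) := DFunLike.congr_fun mfderiv_prod_right (c z)
  rw [h4] at h3
  exact Bundle.TotalSpace.ext (by simp) (@heq_of_eq EQ _ _ h3)

theorem ContMDiffAt.connection_along (hΦ : IsPrincipalConnection Φ) {b : Z → Q}
    {s : (z : Z) → TangentSpace 𝓘(ℝ, EQ) (b z)}
    (hs : ContMDiffAt J 𝓘(ℝ, EQ).tangent ∞
      (fun z => (⟨b z, s z⟩ : TangentBundle 𝓘(ℝ, EQ) Q)) z₀) :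
    ContMDiffAt (M' := EG) J 𝓘(ℝ, EG) ∞ (fun z => Φ (b z) (s z)) z₀ :=
  hΦ.smooth.contMDiffAt.comp z₀ hs

theorem ContMDiffAt.connectionShift_along (hΦ : IsPrincipalConnection Φ) {b : Z → Q × X}
    {s : (z : Z) → TangentSpace (𝓘(ℝ, EQ).prod 𝓘(ℝ, EX)) (b z)}
    (hs : ContMDiffAt J (𝓘(ℝ, EQ).prod 𝓘(ℝ, EX)).tangent ∞
      (fun z => (⟨b z, s z⟩ : TangentBundle (𝓘(ℝ, EQ).prod 𝓘(ℝ, EX)) (Q × X))) z₀) :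
    ContMDiffAt J 𝓘(ℝ, EX).tangent ∞
      (fun z => (⟨(b z).2, connectionShift Φ (b z) (s z)⟩ : TangentBundle 𝓘(ℝ, EX) X)) z₀ := by
  have h1 := ContMDiffAt.mfderiv_along (I' := 𝓘(ℝ, EX)) contMDiffAt_snd hs
  have h2 := ContMDiffAt.mfderiv_along (I' := 𝓘(ℝ, EQ)) contMDiffAt_fst hs
  exact h1.sub_along (ContMDiffAt.actionField_along h1.base_along (h2.connection_along hΦ))

end Along

/-- Stated in the total space because, for a local section `τ`, the points `[τ y]` and `y` are equal
but not by definition. -/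
theorem projAlong_verticalQ_of_mk_eq (hΦ : IsPrincipalConnection Φ)
    (hπ : IsEquivariantFamily EX ES G π Hor) {p : Q × X} {y : AssocSpace hr X}
    {u : TangentSpace (𝓘(ℝ, EM).prod 𝓘(ℝ, EX)) y}
    {w : TangentSpace (𝓘(ℝ, EQ).prod 𝓘(ℝ, EX)) p}
    (h : (⟨AssocSpace.mk hr p,
        mfderiv (𝓘(ℝ, EQ).prod 𝓘(ℝ, EX)) (𝓘(ℝ, EM).prod 𝓘(ℝ, EX)) (AssocSpace.mk hr) p w⟩ :
        TangentBundle (𝓘(ℝ, EM).prod 𝓘(ℝ, EX)) (AssocSpace hr X)) = ⟨y, u⟩) :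
    (⟨y, projAlong (verticalQ hr hπ y) (horizontalQ hr Φ Hor y) u⟩ :
        TangentBundle (𝓘(ℝ, EM).prod 𝓘(ℝ, EX)) (AssocSpace hr X)) =
      ⟨AssocSpace.mk hr p,
        mfderiv (𝓘(ℝ, EQ).prod 𝓘(ℝ, EX)) (𝓘(ℝ, EM).prod 𝓘(ℝ, EX)) (AssocSpace.mk hr) p
          (tangentPair 𝓘(ℝ, EQ) 𝓘(ℝ, EX) p
            (0, (projAlong (verticalSpace 𝓘(ℝ, EX) 𝓘(ℝ, ES) π p.2) (Hor p.2)
              (connectionShift Φ p w) : TangentSpace 𝓘(ℝ, EX) p.2)))⟩ := by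
  have hp : AssocSpace.mk hr p = y := congrArg Bundle.TotalSpace.proj h
  subst hp
  obtain rfl := eq_of_heq (Bundle.TotalSpace.mk.inj h).2
  rw [projAlong_verticalQ_mfderiv_mk hr hΦ hπ, fiberDeriv_eq]

/-- The projection onto the vertical tangent bundle of `X_Q → S_Q` along `H_Q` is smooth. -/
theorem contMDiffAt_projAlong_verticalQ [FiniteDimensional ℝ ES] (hΦ : IsPrincipalConnection Φ)
    (hπ : IsEquivariantFamily EX ES G π Hor) (y : AssocSpace hr X)
    {s : (y : AssocSpace hr X) → TangentSpace (𝓘(ℝ, EM).prod 𝓘(ℝ, EX)) y}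
    (hs : ContMDiffAt (𝓘(ℝ, EM).prod 𝓘(ℝ, EX)) (𝓘(ℝ, EM).prod 𝓘(ℝ, EX)).tangent ∞
      (fun y => (⟨y, s y⟩ : TangentBundle (𝓘(ℝ, EM).prod 𝓘(ℝ, EX)) (AssocSpace hr X))) y) :
    ContMDiffAt (𝓘(ℝ, EM).prod 𝓘(ℝ, EX)) (𝓘(ℝ, EM).prod 𝓘(ℝ, EX)).tangent ∞
      (fun y => (⟨y, projAlong (verticalQ hr hπ y) (horizontalQ hr Φ Hor y) (s y)⟩ :
        TangentBundle (𝓘(ℝ, EM).prod 𝓘(ℝ, EX)) (AssocSpace hr X))) y := by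
  obtain ⟨p, rfl⟩ := AssocSpace.mk_surjective hr y
  obtain ⟨τ, hτ, hp, hsec, -⟩ := AssocSpace.exists_mfderiv_local_section (EY := EX) hr p
  have h1 := ContMDiffAt.mfderiv_along (b := fun y => y) hτ hs
  have h2 := (h1.connectionShift_along hΦ).projAlong_ver_along hπ.smooth hπ.smooth_hor
    hπ.horizontal
  have h3 := ContMDiffAt.prodMk_along
    (ContMDiffAt.zero_along (I := 𝓘(ℝ, EQ)) (contMDiffAt_fst.comp _ hτ)) h2
  have h4 := ContMDiffAt.mfderiv_along (b := τ) (AssocSpace.contMDiff_mk (EY := EX) hr).contMDiffAt h3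
  refine h4.congr_of_eventuallyEq ?_
  -- The relation `q ∘ τ = id` is needed near each `y` close to the base point, in order to
  -- differentiate it at `y`.
  filter_upwards [eventually_eventually_nhds.2 hsec,
    (contMDiffAt_iff_contMDiffAt_nhds (by simp)).1
      (hτ.of_le (by simp : (1 : WithTop ℕ∞) ≤ ∞))] with y hy hτy
  refine projAlong_verticalQ_of_mk_eq hr hΦ hπ ?_
  have h5 := tangentMap_comp_at (I := 𝓘(ℝ, EM).prod 𝓘(ℝ, EX)) (I' := 𝓘(ℝ, EQ).prod 𝓘(ℝ, EX))
    (I'' := 𝓘(ℝ, EM).prod 𝓘(ℝ, EX)) (f := τ) (g := AssocSpace.mk hr (Y := X)) ⟨y, s y⟩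
    ((AssocSpace.contMDiff_mk (EY := EX) hr).contMDiffAt.mdifferentiableAt (by simp))
    (hτy.mdifferentiableAt (by simp))
  refine h5.symm.trans ?_
  have h6 : AssocSpace.mk hr ∘ τ =ᶠ[𝓝 y] id := hy
  refine Bundle.TotalSpace.ext hy.self_of_nhds
    (@heq_of_eq (EM × EX) _ _ ?_)
  refine (DFunLike.congr_fun h6.mfderiv_eq (s y)).trans ?_
  exact DFunLike.congr_fun mfderiv_id _

end FamilyFields

/-! ### Cartan's formula when the form is constant on the two fields. -/

section Const

variable {E : Type*} [NormedAddCommGroup E] [NormedSpace ℝ E] [FiniteDimensional ℝ E]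
  {H : Type*} [TopologicalSpace H] {I : ModelWithCorners ℝ E H}
  {Y : Type*} [TopologicalSpace Y] [ChartedSpace H Y] [IsManifold I ∞ Y]
  {F : Type*} [NormedAddCommGroup F] [NormedSpace ℝ F]
  {K : Type*} [NormedAddCommGroup K] [NormedSpace ℝ K] [CompleteSpace K]
  {L : Type*} [TopologicalSpace L] {J : ModelWithCorners ℝ K L} [J.Boundaryless]
  {N : Type*} [TopologicalSpace N] [ChartedSpace L N] [IsManifold J ∞ N]

/-- `dα(f_* U, f_* V) = -α(f_* [U, V])` if `α(f_* U)` and `α(f_* V)` are constant. -/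
theorem formDeriv_mfderiv_of_const {α : (y : Y) → TangentSpace I y →ₗ[ℝ] F} {f : N → Y} {n : N}
    (hα : ∀ e : TangentSpace I (f n),
      MDifferentiableAt I 𝓘(ℝ, F) (fun y' => α y' (FiberBundle.extend E e y')) (f n))
    (hf : ContMDiffAt J I 2 f n) {U V : (n : N) → TangentSpace J n}
    (hU : MDifferentiableAt J J.tangent (fun n => (⟨n, U n⟩ : TangentBundle J N)) n)
    (hV : MDifferentiableAt J J.tangent (fun n => (⟨n, V n⟩ : TangentBundle J N)) n) {c d : F}
    (hUc : ∀ n, α (f n) (mfderiv J I f n (U n)) = c)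
    (hVd : ∀ n, α (f n) (mfderiv J I f n (V n)) = d) :
    formDeriv α (f n) (mfderiv J I f n (U n)) (mfderiv J I f n (V n)) =
      -α (f n) (mfderiv J I f n (VectorField.mlieBracket J U V n)) := by
  have h := formDeriv_mfderiv hα hf hU hV
  simp only [hUc, hVd, mvfderiv_const] at h
  refine h.trans ?_
  change (0 : F) - 0 - _ = _
  rw [sub_zero, zero_sub]

end Const

/-! ### The curvature as the horizontal part of `dΦ`. -/

section CurvatureHorizontal

open Filter Set

variable {EG : Type*} [NormedAddCommGroup EG] [NormedSpace ℝ EG]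
  {EQ : Type*} [NormedAddCommGroup EQ] [NormedSpace ℝ EQ]
  {EM : Type*} [NormedAddCommGroup EM] [NormedSpace ℝ EM]
  {EX : Type*} [NormedAddCommGroup EX] [NormedSpace ℝ EX]
  {ES : Type*} [NormedAddCommGroup ES] [NormedSpace ℝ ES]
  {G : Type*} [TopologicalSpace G] [ChartedSpace EG G] [Group G] [LieGroup 𝓘(ℝ, EG) ∞ G]
  {Q : Type*} [TopologicalSpace Q] [ChartedSpace EQ Q] [IsManifold 𝓘(ℝ, EQ) ∞ Q]
  [MulAction Gᵐᵒᵖ Q]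
  {M : Type*} [TopologicalSpace M] [ChartedSpace EM M] [IsManifold 𝓘(ℝ, EM) ∞ M]
  {r : Q → M} (hr : IsPrincipalBundle EG EQ EM G r)

variable {Φ : (z : Q) → TangentSpace 𝓘(ℝ, EQ) z →ₗ[ℝ] GroupLieAlgebra 𝓘(ℝ, EG) G}

/-- The left-invariant field is the derivative of multiplication at `(g, 1)` on `(0, e)`. -/
theorem contMDiffAt_mulInvariantVectorField_infty (e : GroupLieAlgebra 𝓘(ℝ, EG) G) (g : G) :
    ContMDiffAt 𝓘(ℝ, EG) 𝓘(ℝ, EG).tangent ∞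
      (fun g : G => (⟨g, mulInvariantVectorField e g⟩ : TangentBundle 𝓘(ℝ, EG) G)) g := by
  have hm : ContMDiff (𝓘(ℝ, EG).prod 𝓘(ℝ, EG)) 𝓘(ℝ, EG) ∞ (fun P : G × G => P.1 * P.2) :=
    contMDiff_mul 𝓘(ℝ, EG) ∞
  have h1 := (ContMDiffAt.zero_along (I := 𝓘(ℝ, EG)) (contMDiffAt_id (x := g))).prodMk_along
    (ContMDiffAt.const_along (X := G) (J := 𝓘(ℝ, EG)) (z₀ := g) (c := fun _ => e) 1
      contMDiffAt_const)
  have h2 := ContMDiffAt.mfderiv_along (b := fun g => (g, (1 : G))) hm.contMDiffAt h1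
  refine h2.congr_of_eventuallyEq (Eventually.of_forall fun g => ?_)
  have h3 := mfderiv_comp_apply_of_eq (x := (1 : G)) (y := (g, (1 : G)))
    (f := fun h : G => (g, h)) (g := fun P : G × G => P.1 * P.2)
    (hm.contMDiffAt.mdifferentiableAt (by simp))
    (mdifferentiableAt_const.prodMk mdifferentiableAt_id) rfl e
  have h4 : mfderiv 𝓘(ℝ, EG) (𝓘(ℝ, EG).prod 𝓘(ℝ, EG)) (fun h : G => (g, h)) 1 e =
      (0, e) := DFunLike.congr_fun mfderiv_prod_right e
  rw [h4] at h3
  exact Bundle.TotalSpace.ext (by simp) (@heq_of_eq EG _ _ h3)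

theorem contMDiff_orbit (hr : IsPrincipalBundle EG EQ EM G r) (z : Q) :
    ContMDiff 𝓘(ℝ, EG) 𝓘(ℝ, EQ) ∞ (fun g : G => op g • z) :=
  hr.smooth_action.comp (contMDiff_const.prodMk contMDiff_id)

/-- Differentiate `z · (g h) = (z · g) · h` at `h = 1`: the orbit map carries left-invariant fields
to fundamental fields. -/
theorem mfderiv_orbit_mulInvariantVectorField (hr : IsPrincipalBundle EG EQ EM G r) (z : Q) (g : G)
    (e : GroupLieAlgebra 𝓘(ℝ, EG) G) :
    mfderiv 𝓘(ℝ, EG) 𝓘(ℝ, EQ) (fun g : G => op g • z) g (mulInvariantVectorField e g) =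
      fundamentalField EQ (op g • z) e := by
  have hm : ContMDiff 𝓘(ℝ, EG) 𝓘(ℝ, EG) ∞ (fun h : G => g * h) :=
    contMDiff_const.mul contMDiff_id
  have h1 := mfderiv_comp_apply_of_eq (x := (1 : G)) (y := g) (f := fun h : G => g * h)
    ((contMDiff_orbit hr z).contMDiffAt.mdifferentiableAt (by simp))
    (hm.contMDiffAt.mdifferentiableAt (by simp)) (mul_one g) e
  have h2 : (fun g : G => op g • z) ∘ (fun h : G => g * h) = fun h : G => op h • op g • z := by
    funext h
    rw [smul_smul, ← op_mul]
    rfl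
  rw [h2] at h1
  exact h1.symm

theorem connection_fundamentalField (hΦ : IsPrincipalConnection Φ) (z : Q)
    (e : GroupLieAlgebra 𝓘(ℝ, EG) G) : Φ z (fundamentalField EQ z e) = e :=
  hΦ.vertical z e

theorem mdifferentiableAt_connection_extend (hΦ : IsPrincipalConnection Φ) {z : Q}
    (v : TangentSpace 𝓘(ℝ, EQ) z) :
    MDifferentiableAt 𝓘(ℝ, EQ) 𝓘(ℝ, EG) (M' := EG)
      (fun z' => Φ z' (FiberBundle.extend EQ v z')) z :=
  ((contMDiffAt_extend_along v).connection_along hΦ).mdifferentiableAt (by simp)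

variable [FiniteDimensional ℝ EQ]

section Pullback

variable {K : Type*} [NormedAddCommGroup K] [NormedSpace ℝ K] [CompleteSpace K]
  {L : Type*} [TopologicalSpace L] {J : ModelWithCorners ℝ K L} [J.Boundaryless]
  {N : Type*} [TopologicalSpace N] [ChartedSpace L N] [IsManifold J ∞ N]

/-- `dΦ(f_* U, f_* V) = -Φ(f_* [U, V])` if `Φ(f_* U)` and `Φ(f_* V)` are constant. -/
theorem formDeriv_connection_mfderiv (hΦ : IsPrincipalConnection Φ) {f : N → Q} {n : N}
    (hf : ContMDiff J 𝓘(ℝ, EQ) ∞ f) {U V : (n : N) → TangentSpace J n}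
    (hU : MDifferentiableAt J J.tangent (fun n => (⟨n, U n⟩ : TangentBundle J N)) n)
    (hV : MDifferentiableAt J J.tangent (fun n => (⟨n, V n⟩ : TangentBundle J N)) n)
    {c d : GroupLieAlgebra 𝓘(ℝ, EG) G}
    (hUc : ∀ n, Φ (f n) (mfderiv J 𝓘(ℝ, EQ) f n (U n)) = c)
    (hVd : ∀ n, Φ (f n) (mfderiv J 𝓘(ℝ, EQ) f n (V n)) = d) :
    formDeriv (F := EG) Φ (f n) (mfderiv J 𝓘(ℝ, EQ) f n (U n)) (mfderiv J 𝓘(ℝ, EQ) f n (V n)) =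
      -Φ (f n) (mfderiv J 𝓘(ℝ, EQ) f n (VectorField.mlieBracket J U V n)) :=
  formDeriv_mfderiv_of_const (F := EG) (α := Φ)
    (fun e => mdifferentiableAt_connection_extend hΦ e) (contMDiff_infty.1 hf 2).contMDiffAt
    hU hV hUc hVd

end Pullback

variable [FiniteDimensional ℝ EG]

/-- Pull back along the orbit map. On left-invariant fields the pulled-back `Φ` is constant, so only
the bracket term remains, and the bracket of left-invariant fields at `1` defines the Lie bracket of
`𝔤`. -/
theorem formDeriv_connection_fundamentalField (hr : IsPrincipalBundle EG EQ EM G r)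
    (hΦ : IsPrincipalConnection Φ) (z : Q) (e e' : GroupLieAlgebra 𝓘(ℝ, EG) G) :
    formDeriv (F := EG) Φ z (fundamentalField EQ z e) (fundamentalField EQ z e') =
      -(⁅e, e'⁆ : GroupLieAlgebra 𝓘(ℝ, EG) G) := by
  have hf := contMDiff_orbit hr z
  have hΦe : ∀ (e : GroupLieAlgebra 𝓘(ℝ, EG) G) (g : G), Φ (op g • z)
      (mfderiv 𝓘(ℝ, EG) 𝓘(ℝ, EQ) (fun g : G => op g • z) g (mulInvariantVectorField e g)) = e := by
    intro e g
    rw [mfderiv_orbit_mulInvariantVectorField hr, connection_fundamentalField hΦ]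
  have h := formDeriv_connection_mfderiv hΦ hf (n := 1)
    ((contMDiffAt_mulInvariantVectorField_infty e 1).mdifferentiableAt (by simp))
    ((contMDiffAt_mulInvariantVectorField_infty e' 1).mdifferentiableAt (by simp))
    (hΦe e) (hΦe e')
  rw [mfderiv_orbit_mulInvariantVectorField hr, mfderiv_orbit_mulInvariantVectorField hr] at h
  have hz : op (1 : G) • z = z := by simp
  -- The base point of the orbit map is `op 1 • z`, which has to be transported to `z`.
  have h2 : ∀ z' : Q, z' = z → formDeriv (F := EG) Φ z' (fundamentalField EQ z' e)
      (fundamentalField EQ z' e') = formDeriv (F := EG) Φ z (fundamentalField EQ z e)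
      (fundamentalField EQ z e') := by
    rintro _ rfl; rfl
  refine (h2 _ hz).symm.trans (h.trans (congrArg Neg.neg ?_))
  have h3 : ∀ z' : Q, z' = z → Φ z' (mfderiv 𝓘(ℝ, EG) 𝓘(ℝ, EQ) (fun g : G => op g • z) 1 ⁅e, e'⁆) =
      ⁅e, e'⁆ := by
    rintro _ rfl
    exact hΦ.vertical _ _
  exact h3 _ hz

/-- Pull back along the action map `Q × G → Q`, using a left-invariant field on the factor `G` and a
horizontal field `A` on the factor `Q`. The form `Φ` is constant, with values `e` and `0`, on their
images, so it suffices that `Φ` vanish on the image of their bracket. -/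
theorem formDeriv_connection_fundamentalField_of_eq_zero (hr : IsPrincipalBundle EG EQ EM G r)
    (hΦ : IsPrincipalConnection Φ) (z : Q) (e : GroupLieAlgebra 𝓘(ℝ, EG) G)
    {v : TangentSpace 𝓘(ℝ, EQ) z} (hv : Φ z v = 0) :
    formDeriv (F := EG) Φ z (fundamentalField EQ z e) v = 0 := by
  -- The fundamental component is removed at every point, so that `A` is horizontal everywhere and
  -- not only at `z`.
  set A : (z' : Q) → TangentSpace 𝓘(ℝ, EQ) z' := fun z' => FiberBundle.extend EQ v z' -
    fundamentalField EQ z' (Φ z' (FiberBundle.extend EQ v z')) with hA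
  have hAs : ContMDiffAt 𝓘(ℝ, EQ) 𝓘(ℝ, EQ).tangent ∞
      (fun z' => (⟨z', A z'⟩ : TangentBundle 𝓘(ℝ, EQ) Q)) z :=
    (contMDiffAt_extend_along v).sub_along (ContMDiffAt.fundamentalField_along hr contMDiffAt_id
      ((contMDiffAt_extend_along v).connection_along hΦ))
  have hAΦ : ∀ z', Φ z' (A z') = 0 := fun z' => by
    rw [hA, map_sub, connection_fundamentalField hΦ, sub_self]
  have hAz : A z = v := by
    change FiberBundle.extend EQ v z - fundamentalField EQ z (Φ z (FiberBundle.extend EQ v z)) = v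
    rw [FiberBundle.extend_apply_self, hv, map_zero, sub_zero]
  set U : (n : Q × G) → TangentSpace (𝓘(ℝ, EQ).prod 𝓘(ℝ, EG)) n := fun n =>
    tangentPair 𝓘(ℝ, EQ) 𝓘(ℝ, EG) n (0, mulInvariantVectorField e n.2) with hU
  set V : (n : Q × G) → TangentSpace (𝓘(ℝ, EQ).prod 𝓘(ℝ, EG)) n := fun n =>
    tangentPair 𝓘(ℝ, EQ) 𝓘(ℝ, EG) n (A n.1, 0) with hV
  have hUs : MDifferentiableAt (𝓘(ℝ, EQ).prod 𝓘(ℝ, EG)) (𝓘(ℝ, EQ).prod 𝓘(ℝ, EG)).tangent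
      (fun n => (⟨n, U n⟩ : TangentBundle (𝓘(ℝ, EQ).prod 𝓘(ℝ, EG)) (Q × G))) (z, 1) :=
    (ContMDiffAt.prodMk_along (ContMDiffAt.zero_along (I := 𝓘(ℝ, EQ)) contMDiffAt_fst)
      (ContMDiffAt.comp (z, (1 : G))
        (g := fun g : G => (⟨g, mulInvariantVectorField e g⟩ : TangentBundle 𝓘(ℝ, EG) G))
        (f := fun n : Q × G => n.2)
        (contMDiffAt_mulInvariantVectorField_infty e 1) contMDiffAt_snd)).mdifferentiableAt (by simp)
  have hVs : MDifferentiableAt (𝓘(ℝ, EQ).prod 𝓘(ℝ, EG)) (𝓘(ℝ, EQ).prod 𝓘(ℝ, EG)).tangent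
      (fun n => (⟨n, V n⟩ : TangentBundle (𝓘(ℝ, EQ).prod 𝓘(ℝ, EG)) (Q × G))) (z, 1) :=
    (ContMDiffAt.prodMk_along (ContMDiffAt.comp (z, (1 : G))
        (g := fun z' : Q => (⟨z', A z'⟩ : TangentBundle 𝓘(ℝ, EQ) Q)) (f := fun n : Q × G => n.1)
        hAs contMDiffAt_fst)
      (ContMDiffAt.zero_along (I := 𝓘(ℝ, EG)) contMDiffAt_snd)).mdifferentiableAt (by simp)
  set B := VectorField.mlieBracket (𝓘(ℝ, EQ).prod 𝓘(ℝ, EG)) U V (z, 1) with hB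
  have ha := hr.smooth_action
  have hf : ∀ (n : Q × G) (w : TangentSpace (𝓘(ℝ, EQ).prod 𝓘(ℝ, EG)) n),
      mfderiv (𝓘(ℝ, EQ).prod 𝓘(ℝ, EG)) 𝓘(ℝ, EQ) (fun n : Q × G => op n.2 • n.1) n w =
      mfderiv 𝓘(ℝ, EQ) 𝓘(ℝ, EQ) (fun z' : Q => op n.2 • z') n.1
        (mfderiv (𝓘(ℝ, EQ).prod 𝓘(ℝ, EG)) 𝓘(ℝ, EQ) Prod.fst n w) +
      mfderiv 𝓘(ℝ, EG) 𝓘(ℝ, EQ) (fun g : G => op g • n.1) n.2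
        (mfderiv (𝓘(ℝ, EQ).prod 𝓘(ℝ, EG)) 𝓘(ℝ, EG) Prod.snd n w) := by
    intro n w
    have h1 := mfderiv_prod_eq_add_apply (v := w) (ha.contMDiffAt.mdifferentiableAt (by simp))
    rw [mfderiv_fst, mfderiv_snd]
    exact h1
  have hUf : ∀ n : Q × G, Φ (op n.2 • n.1) (mfderiv (𝓘(ℝ, EQ).prod 𝓘(ℝ, EG)) 𝓘(ℝ, EQ)
      (fun n : Q × G => op n.2 • n.1) n (U n)) = e := by
    intro n
    rw [hf, hU, mfderiv_fst_tangentPair, mfderiv_snd_tangentPair, map_zero, zero_add,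
      mfderiv_orbit_mulInvariantVectorField hr, connection_fundamentalField hΦ]
  have hVf : ∀ n : Q × G, Φ (op n.2 • n.1) (mfderiv (𝓘(ℝ, EQ).prod 𝓘(ℝ, EG)) 𝓘(ℝ, EQ)
      (fun n : Q × G => op n.2 • n.1) n (V n)) = 0 := by
    intro n
    rw [hf, hV, mfderiv_fst_tangentPair, mfderiv_snd_tangentPair, map_zero, add_zero]
    refine (hΦ.equivariant n.2 n.1 _).trans ?_
    rw [hAΦ]
    exact map_zero _
  -- The same pair `U`, `V` is used for three maps: the action, the projection to `Q`, and the orbit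
  -- map of `z`. Each of the last two kills one of the fields, so `Φ` vanishes on the images of the
  -- bracket `B` under them; the bracket itself is never computed.
  have h1 := formDeriv_connection_mfderiv hΦ ha hUs hVs hUf hVf
  have h2 := formDeriv_connection_mfderiv hΦ (f := Prod.fst) (c := 0) (d := 0) contMDiff_fst
    hUs hVs (fun n => by rw [hU, mfderiv_fst_tangentPair, map_zero])
    (fun n => by rw [hV, mfderiv_fst_tangentPair, hAΦ])
  have ho : ContMDiff (𝓘(ℝ, EQ).prod 𝓘(ℝ, EG)) 𝓘(ℝ, EQ) ∞ (fun n : Q × G => op n.2 • z) :=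
    (contMDiff_orbit hr z).comp contMDiff_snd
  have hod : ∀ (n : Q × G) (w : TangentSpace (𝓘(ℝ, EQ).prod 𝓘(ℝ, EG)) n),
      mfderiv (𝓘(ℝ, EQ).prod 𝓘(ℝ, EG)) 𝓘(ℝ, EQ) (fun n : Q × G => op n.2 • z) n w =
      mfderiv 𝓘(ℝ, EG) 𝓘(ℝ, EQ) (fun g : G => op g • z) n.2
        (mfderiv (𝓘(ℝ, EQ).prod 𝓘(ℝ, EG)) 𝓘(ℝ, EG) Prod.snd n w) := fun n w =>
    mfderiv_comp_apply n (g := fun g : G => op g • z)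
      ((contMDiff_orbit hr z).contMDiffAt.mdifferentiableAt (by simp)) mdifferentiableAt_snd w
  have h3 := formDeriv_connection_mfderiv hΦ (c := e) (d := 0) ho hUs hVs
    (fun n => by rw [hod, hU, mfderiv_snd_tangentPair,
      mfderiv_orbit_mulInvariantVectorField hr, connection_fundamentalField hΦ])
    (fun n => by rw [hod, hV, mfderiv_snd_tangentPair, map_zero, map_zero])
  have h4 : Φ z (mfderiv (𝓘(ℝ, EQ).prod 𝓘(ℝ, EG)) 𝓘(ℝ, EQ) Prod.fst (z, 1) B) = 0 := by
    rw [hU, mfderiv_fst_tangentPair, map_zero] at h2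
    exact neg_eq_zero.1 h2.symm
  have h5 : Φ (op (1 : G) • z) (mfderiv 𝓘(ℝ, EG) 𝓘(ℝ, EQ) (fun g : G => op g • z) 1
      (mfderiv (𝓘(ℝ, EQ).prod 𝓘(ℝ, EG)) 𝓘(ℝ, EG) Prod.snd (z, 1) B)) = 0 := by
    rw [hod _ (V (z, 1)), hV, mfderiv_snd_tangentPair, map_zero, map_zero, hod] at h3
    exact neg_eq_zero.1 h3.symm
  have h6 : Φ (op (1 : G) • z) (mfderiv 𝓘(ℝ, EQ) 𝓘(ℝ, EQ) (fun z' : Q => op (1 : G) • z') z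
      (mfderiv (𝓘(ℝ, EQ).prod 𝓘(ℝ, EG)) 𝓘(ℝ, EQ) Prod.fst (z, 1) B)) = 0 := by
    refine (hΦ.equivariant 1 z _).trans ?_
    rw [h4]
    exact map_zero _
  have h7 : Φ (op (1 : G) • z) (mfderiv (𝓘(ℝ, EQ).prod 𝓘(ℝ, EG)) 𝓘(ℝ, EQ)
      (fun n : Q × G => op n.2 • n.1) (z, 1) B) = 0 := by
    -- The derivative of the action at `(z, 1)` is the sum of translation of the `Q`-component and
    -- the orbit derivative of the `G`-component; `Φ` vanishes on each.
    rw [hf, map_add, h5, h6, add_zero]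
  have h8 : formDeriv (F := EG) Φ (op (1 : G) • z) (fundamentalField EQ (op (1 : G) • z) e)
      (mfderiv 𝓘(ℝ, EQ) 𝓘(ℝ, EQ) (fun z' : Q => op (1 : G) • z') z v) = 0 := by
    rw [hf, hf, hU, hV, mfderiv_fst_tangentPair, mfderiv_snd_tangentPair, mfderiv_fst_tangentPair,
      mfderiv_snd_tangentPair, map_zero, map_zero, zero_add, add_zero,
      mfderiv_orbit_mulInvariantVectorField hr, hAz] at h1
    refine h1.trans (neg_eq_zero.2 ?_)
    exact h7
  have h9 : ∀ k : Q → Q, k = id → formDeriv (F := EG) Φ (k z) (fundamentalField EQ (k z) e)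
      (mfderiv 𝓘(ℝ, EQ) 𝓘(ℝ, EQ) k z v) = formDeriv (F := EG) Φ z (fundamentalField EQ z e) v := by
    rintro _ rfl
    rw [mfderiv_id]
    rfl
  exact (h9 (fun z' => op (1 : G) • z') (funext fun z' => by simp)).symm.trans h8

theorem formDeriv_swap {E : Type*} [NormedAddCommGroup E] [NormedSpace ℝ E] [FiniteDimensional ℝ E]
    {H : Type*} [TopologicalSpace H] {I : ModelWithCorners ℝ E H}
    {Y : Type*} [TopologicalSpace Y] [ChartedSpace H Y] [IsManifold I ∞ Y]
    {F : Type*} [NormedAddCommGroup F] [NormedSpace ℝ F] (α : (y : Y) → TangentSpace I y →ₗ[ℝ] F)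
    (y : Y) (u v : TangentSpace I y) : formDeriv α y u v = -formDeriv α y v u := by
  rw [formDeriv_apply, formDeriv_apply, ← Finset.sum_neg_distrib]
  exact Finset.sum_congr rfl fun _ _ => (neg_sub _ _).symm

/-- The curvature of a connection is the horizontal part of its exterior derivative. -/
theorem curvatureForm_eq (hr : IsPrincipalBundle EG EQ EM G r)
    (hΦ : IsPrincipalConnection Φ) (z : Q) (u v : TangentSpace 𝓘(ℝ, EQ) z) :
    curvatureForm Φ z u v = formDeriv (F := EG) Φ z (u - fundamentalField EQ z (Φ z u))
      (v - fundamentalField EQ z (Φ z v)) := by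
  have h0 : ∀ u : TangentSpace 𝓘(ℝ, EQ) z, Φ z (u - fundamentalField EQ z (Φ z u)) = 0 := fun u => by
    rw [map_sub, connection_fundamentalField hΦ, sub_self]
  have h1 := extDerivOneForm_eq_formDeriv (F := EG) (α := Φ) (y := z)
    (fun e => mdifferentiableAt_connection_extend hΦ e) u v
  set a := u - fundamentalField EQ z (Φ z u) with ha
  set b := v - fundamentalField EQ z (Φ z v) with hb
  have hu : u = a + fundamentalField EQ z (Φ z u) := (sub_add_cancel _ _).symm
  have hv : v = b + fundamentalField EQ z (Φ z v) := (sub_add_cancel _ _).symm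
  have h3 := formDeriv_connection_fundamentalField hr hΦ z (Φ z u) (Φ z v)
  have h4 := formDeriv_connection_fundamentalField_of_eq_zero hr hΦ z (Φ z u) (h0 v)
  have h5 := formDeriv_connection_fundamentalField_of_eq_zero hr hΦ z (Φ z v) (h0 u)
  have h6 : formDeriv (F := EG) Φ z a (fundamentalField EQ z (Φ z v)) = 0 :=
    (formDeriv_swap (F := EG) Φ z _ _).trans (neg_eq_zero.2 h5)
  have h7 : formDeriv (F := EG) Φ z u v = formDeriv (F := EG) Φ z
      (a + fundamentalField EQ z (Φ z u)) (b + fundamentalField EQ z (Φ z v)) :=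
    congrArg₂ (fun x y => formDeriv (F := EG) Φ z x y) hu hv
  -- The bracket is recast in the model space, where the values of `formDeriv` live.
  let c : EG := (-⁅Φ z u, Φ z v⁆ : GroupLieAlgebra 𝓘(ℝ, EG) G)
  have h8 : formDeriv (F := EG) Φ z u v = formDeriv (F := EG) Φ z a b + c := by
    refine h7.trans ?_
    simp only [map_add, LinearMap.add_apply]
    -- The mixed terms vanish, and the term on two fundamental vectors is `-[Φ u, Φ v]`, which the
    -- quadratic term of the curvature cancels.
    rw [h6, h4, add_zero, zero_add]
    exact congrArg (formDeriv (F := EG) Φ z a b + ·) h3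
  refine (congrArg (fun w : GroupLieAlgebra 𝓘(ℝ, EG) G => w + ⁅Φ z u, Φ z v⁆)
    (h1.trans h8)).trans ?_
  exact neg_add_cancel_right (G := GroupLieAlgebra 𝓘(ℝ, EG) G) _ _

end CurvatureHorizontal

/-! ### Linear algebra of the four-term formula. -/

section FormulaAlgebra

variable {V A A' 𝔤 ι : Type*} [AddCommGroup V] [Module ℝ V] [AddCommGroup A] [Module ℝ A]
  [AddCommGroup A'] [Module ℝ A'] [AddCommGroup 𝔤] [Module ℝ 𝔤] [Fintype ι]

/-- The four-term expression is the expansion of `B` after the substitution `w ↦ w - ξ(f w)`, the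
basis sums collapsing to values at `f u`, `f v` and `κ u v`. -/
theorem frobeniusFormula_eq (b : Module.Basis ι ℝ 𝔤) (f : V →ₗ[ℝ] 𝔤) (ξ : 𝔤 →ₗ[ℝ] V)
    (B : V →ₗ[ℝ] V →ₗ[ℝ] A) (hB : ∀ u v, B u v = -B v u) (κ : V → V → 𝔤) (L : 𝔤 →ₗ[ℝ] A)
    (u v : V) :
    frobeniusFormula (fun a η => b.coord a (f η)) (fun a η ζ => b.coord a (κ η ζ))
      (fun a => ξ (b a)) (fun η ζ => B η ζ) (fun a => L (b a)) u v =
      B (u - ξ (f u)) (v - ξ (f v)) - L (κ u v) := by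
  have h1 : ∀ (w : 𝔤) (g : 𝔤 →ₗ[ℝ] A), ∑ a, b.coord a w • g (b a) = g w := fun w g => by
    simp only [← map_smul, ← map_sum, Module.Basis.coord_apply, b.sum_repr]
  have h2 : ∀ w v, ∑ a, b.coord a w • B (ξ (b a)) v = B (ξ w) v := fun w v =>
    h1 w ((B.flip v).comp ξ)
  have h3 : ∀ w v, ∑ a, b.coord a w • B v (ξ (b a)) = B v (ξ w) := fun w v =>
    h1 w ((B v).comp ξ)
  have h4 : ∀ w w', ∑ a, ∑ c, (b.coord a w * b.coord c w') • B (ξ (b a)) (ξ (b c)) =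
      B (ξ w) (ξ w') := fun w w' => by
    simp only [mul_smul, ← Finset.smul_sum, h3, h2]
  simp only [frobeniusFormula, wedgeOneOne, contract, Finset.sum_sub_distrib, sub_smul, smul_eq_mul,
    h2, h4, h1]
  -- The antisymmetrized double sum counts `B(ξ(f u), ξ(f v))` twice, since `B` is alternating; the
  -- factor `½` corrects this.
  rw [hB (ξ (f v)) (ξ (f u)), sub_neg_eq_add, ← two_smul ℝ, smul_smul, hB (ξ (f v)) u]
  norm_num
  abel

theorem map_frobeniusFormula (L : A →ₗ[ℝ] A') (φ : ι → V → ℝ) (curv : ι → V → V → ℝ) (ξ : ι → V)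
    (T : V → V → A) (τ : ι → A) (u v : V) :
    L (frobeniusFormula φ curv ξ T τ u v) =
      frobeniusFormula φ curv ξ (fun u v => L (T u v)) (fun a => L (τ a)) u v := by
  simp only [frobeniusFormula, wedgeOneOne, contract, map_add, map_sub, map_smul, map_sum]

end FormulaAlgebra

/-! ### Tensoriality of the Frobenius tensor. -/

section FrobeniusBilinear

variable {E : Type*} [NormedAddCommGroup E] [NormedSpace ℝ E] [FiniteDimensional ℝ E]
  {H : Type*} [TopologicalSpace H] {I : ModelWithCorners ℝ E H} [I.Boundaryless]
  {Y : Type*} [TopologicalSpace Y] [ChartedSpace H Y] [IsManifold I ∞ Y]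
  {Ver Hor : (y : Y) → Submodule ℝ (TangentSpace I y)}

/-- The Frobenius tensor is bilinear and alternating, and vanishes on vertical vectors. -/
theorem exists_bilinear_frobeniusTensor {y : Y} (hc : ∀ y, IsCompl (Ver y) (Hor y))
    (hP : ∀ e : TangentSpace I y, MDifferentiableAt I I.tangent (fun y' =>
      (⟨y', projAlong (Ver y') (Hor y') (FiberBundle.extend E e y')⟩ : TangentBundle I Y)) y) :
    ∃ B : TangentSpace I y →ₗ[ℝ] TangentSpace I y →ₗ[ℝ] Ver y,
      (∀ u v, B u v = frobeniusTensor I Ver Hor y u v) ∧ (∀ u v, B u v = -B v u) ∧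
      ∀ u ∈ Ver y, B u = 0 := by
  have hT := frobeniusTensor_eq_formDeriv hc hP
  refine ⟨LinearMap.mk₂ ℝ (fun u v => frobeniusTensor I Ver Hor y u v) ?_ ?_ ?_ ?_, fun u v => rfl,
    ?_, ?_⟩
  · intro u u' v
    apply Subtype.ext
    simp only [Submodule.coe_add, hT, map_add, LinearMap.add_apply]
    rfl
  · intro c u v
    apply Subtype.ext
    simp only [Submodule.coe_smul, hT, map_smul, LinearMap.smul_apply]
    rfl
  · intro u v v'
    apply Subtype.ext
    simp only [Submodule.coe_add, hT, map_add]
    rfl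
  · intro c u v
    apply Subtype.ext
    simp only [Submodule.coe_smul, hT, map_smul]
    rfl
  · intro u v
    apply Subtype.ext
    refine (hT u v).trans ((formDeriv_swap (F := E) _ y _ _).trans ?_)
    exact congrArg Neg.neg (hT v u).symm
  · intro u hu
    ext v
    refine (congrArg Subtype.val (LinearMap.mk₂_apply _ _ _ _)).trans ((hT u v).trans ?_)
    rw [(projAlong_eq_zero (hc y).symm).2 hu, ZeroMemClass.coe_zero, map_zero]
    rfl

end FrobeniusBilinear

/-! ### The formula for the pullback of `T_Q`. -/

section MainFormula

open Filter Set

variable {EG : Type*} [NormedAddCommGroup EG] [NormedSpace ℝ EG]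
  {EQ : Type*} [NormedAddCommGroup EQ] [NormedSpace ℝ EQ]
  {EM : Type*} [NormedAddCommGroup EM] [NormedSpace ℝ EM]
  {EX : Type*} [NormedAddCommGroup EX] [NormedSpace ℝ EX]
  {ES : Type*} [NormedAddCommGroup ES] [NormedSpace ℝ ES]
  {G : Type*} [TopologicalSpace G] [ChartedSpace EG G] [Group G] [LieGroup 𝓘(ℝ, EG) ∞ G]
  {Q : Type*} [TopologicalSpace Q] [ChartedSpace EQ Q] [IsManifold 𝓘(ℝ, EQ) ∞ Q]
  [MulAction Gᵐᵒᵖ Q]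
  {M : Type*} [TopologicalSpace M] [ChartedSpace EM M] [IsManifold 𝓘(ℝ, EM) ∞ M]
  {r : Q → M} (hr : IsPrincipalBundle EG EQ EM G r)
  {X : Type*} [TopologicalSpace X] [ChartedSpace EX X] [IsManifold 𝓘(ℝ, EX) ∞ X]
  [MulAction G X] [ContMDiffSMul 𝓘(ℝ, EG) 𝓘(ℝ, EX) ∞ G X]
  {S : Type*} [TopologicalSpace S] [ChartedSpace ES S] [IsManifold 𝓘(ℝ, ES) ∞ S]
  [MulAction G S] [ContMDiffSMul 𝓘(ℝ, EG) 𝓘(ℝ, ES) ∞ G S]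


variable {Φ : (z : Q) → TangentSpace 𝓘(ℝ, EQ) z →ₗ[ℝ] GroupLieAlgebra 𝓘(ℝ, EG) G}
  {π : X → S} {Hor : (x : X) → Submodule ℝ (TangentSpace 𝓘(ℝ, EX) x)}



theorem exists_bilinear_frobeniusTensor_family [FiniteDimensional ℝ EX] [FiniteDimensional ℝ ES]
    (hπ : IsEquivariantFamily EX ES G π Hor) (x : X) :
    ∃ B : TangentSpace 𝓘(ℝ, EX) x →ₗ[ℝ] TangentSpace 𝓘(ℝ, EX) x →ₗ[ℝ]
        verticalSpace 𝓘(ℝ, EX) 𝓘(ℝ, ES) π x,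
      (∀ u v, B u v =
        frobeniusTensor 𝓘(ℝ, EX) (verticalSpace 𝓘(ℝ, EX) 𝓘(ℝ, ES) π) Hor x u v) ∧
      (∀ u v, B u v = -B v u) ∧ ∀ u ∈ verticalSpace 𝓘(ℝ, EX) 𝓘(ℝ, ES) π x, B u = 0 :=
  exists_bilinear_frobeniusTensor (fun x => isCompl_verticalSpace (hπ.horizontal x)) fun e =>
    ((contMDiffAt_extend_along e).projAlong_ver_along hπ.smooth hπ.smooth_hor
      hπ.horizontal).mdifferentiableAt (by simp)

/-- Here the substitution is `w ↦ w - ξ(Φ(w_Q))` on `Q × X`, whose `X`-component is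
`connectionShift`. This closed form replaces the sums in every later argument. -/
theorem frobeniusRHS_eq [FiniteDimensional ℝ EX] [FiniteDimensional ℝ ES] {ι : Type*} [Fintype ι]
    (b : Module.Basis ι ℝ (GroupLieAlgebra 𝓘(ℝ, EG) G)) (hr : IsPrincipalBundle EG EQ EM G r)
    (hπ : IsEquivariantFamily EX ES G π Hor) (p : Q × X)
    (η ζ : TangentSpace (𝓘(ℝ, EQ).prod 𝓘(ℝ, EX)) p) :
    frobeniusRHS ES b Φ π Hor p η ζ =
      frobeniusTensor 𝓘(ℝ, EX) (verticalSpace 𝓘(ℝ, EX) 𝓘(ℝ, ES) π) Hor p.2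
        (connectionShift Φ p η) (connectionShift Φ p ζ) -
      projAlong (verticalSpace 𝓘(ℝ, EX) 𝓘(ℝ, ES) π p.2) (Hor p.2)
        (actionField p.2 (curvatureForm Φ p.1
          (mfderiv (𝓘(ℝ, EQ).prod 𝓘(ℝ, EX)) 𝓘(ℝ, EQ) Prod.fst p η)
          (mfderiv (𝓘(ℝ, EQ).prod 𝓘(ℝ, EX)) 𝓘(ℝ, EQ) Prod.fst p ζ))) := by
  obtain ⟨B, hB, hBa, -⟩ := exists_bilinear_frobeniusTensor_family hπ p.2
  set s := (mfderiv (𝓘(ℝ, EQ).prod 𝓘(ℝ, EX)) 𝓘(ℝ, EX) Prod.snd p).toLinearMap with hs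
  set f := (mfderiv (𝓘(ℝ, EQ).prod 𝓘(ℝ, EX)) 𝓘(ℝ, EQ) Prod.fst p).toLinearMap with hf
  have h := frobeniusFormula_eq b (Φ p.1 ∘ₗ f) (generatingLinear EQ EX p) (B.compl₁₂ s s)
    (fun u v => hBa _ _) (fun η ζ => curvatureForm Φ p.1 (f η) (f ζ))
    (projAlong (verticalSpace 𝓘(ℝ, EX) 𝓘(ℝ, ES) π p.2) (Hor p.2) ∘ₗ actionLinear EX p.2) η ζ
  have hT : (fun η ζ => B.compl₁₂ s s η ζ) = frobeniusPullback ES π Hor p := by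
    funext η ζ
    exact hB _ _
  rw [hT] at h
  have hκ : ∀ η, s (η - generatingLinear EQ EX p ((Φ p.1 ∘ₗ f) η)) = connectionShift Φ p η := by
    intro η
    rw [map_sub]
    exact congrArg (s η - ·) (mfderiv_snd_generatingField hr p _)
  rw [LinearMap.compl₁₂_apply, hκ, hκ, hB] at h
  exact h

theorem ContMDiffAt.horizontalPart_along [FiniteDimensional ℝ ES]
    (hr : IsPrincipalBundle EG EQ EM G r) (hΦ : IsPrincipalConnection Φ)
    (hπ : IsEquivariantFamily EX ES G π Hor) {p : Q × X}
    {s : (n : Q × X) → TangentSpace (𝓘(ℝ, EQ).prod 𝓘(ℝ, EX)) n}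
    (hs : ContMDiffAt (𝓘(ℝ, EQ).prod 𝓘(ℝ, EX)) (𝓘(ℝ, EQ).prod 𝓘(ℝ, EX)).tangent ∞
      (fun n => (⟨n, s n⟩ : TangentBundle (𝓘(ℝ, EQ).prod 𝓘(ℝ, EX)) (Q × X))) p) :
    ContMDiffAt (𝓘(ℝ, EQ).prod 𝓘(ℝ, EX)) (𝓘(ℝ, EQ).prod 𝓘(ℝ, EX)).tangent ∞
      (fun n => (⟨n, horizontalPart ES Φ π Hor n (s n)⟩ :
        TangentBundle (𝓘(ℝ, EQ).prod 𝓘(ℝ, EX)) (Q × X))) p := by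
  have h1 := ContMDiffAt.mfderiv_along (I' := 𝓘(ℝ, EQ)) contMDiffAt_fst hs
  have h2 := h1.sub_along (ContMDiffAt.fundamentalField_along hr h1.base_along
    (h1.connection_along hΦ))
  have h3 := (ContMDiffAt.connectionShift_along (b := fun n => n) hΦ hs).projAlong_hor_along
    hπ.smooth hπ.smooth_hor hπ.horizontal
  exact h2.prodMk_along h3

/-- The core computation: `T_Q`, `T` and `ω` are all read off from one bracket `B` of two fields
with values in `ker Φ ⊕ Hor`, by Cartan's formula for `q` and the projections to `X` and `Q`. -/
theorem frobeniusQ_mfderiv_mk [FiniteDimensional ℝ EG] [FiniteDimensional ℝ EQ]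
    [FiniteDimensional ℝ EM] [FiniteDimensional ℝ EX] [FiniteDimensional ℝ ES]
    (hΦ : IsPrincipalConnection Φ) (hπ : IsEquivariantFamily EX ES G π Hor) (p : Q × X)
    (η ζ : TangentSpace (𝓘(ℝ, EQ).prod 𝓘(ℝ, EX)) p) :
    (frobeniusQ hr hπ Φ (AssocSpace.mk hr p)
        (mfderiv (𝓘(ℝ, EQ).prod 𝓘(ℝ, EX)) (𝓘(ℝ, EM).prod 𝓘(ℝ, EX)) (AssocSpace.mk hr) p η)
        (mfderiv (𝓘(ℝ, EQ).prod 𝓘(ℝ, EX)) (𝓘(ℝ, EM).prod 𝓘(ℝ, EX)) (AssocSpace.mk hr) p ζ) :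
        TangentSpace (𝓘(ℝ, EM).prod 𝓘(ℝ, EX)) (AssocSpace.mk hr p)) =
      fiberDeriv hr p
        ((frobeniusTensor 𝓘(ℝ, EX) (verticalSpace 𝓘(ℝ, EX) 𝓘(ℝ, ES) π) Hor p.2
          (connectionShift Φ p η) (connectionShift Φ p ζ) -
        projAlong (verticalSpace 𝓘(ℝ, EX) 𝓘(ℝ, ES) π p.2) (Hor p.2)
          (actionField p.2 (curvatureForm Φ p.1
            (mfderiv (𝓘(ℝ, EQ).prod 𝓘(ℝ, EX)) 𝓘(ℝ, EQ) Prod.fst p η)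
            (mfderiv (𝓘(ℝ, EQ).prod 𝓘(ℝ, EX)) 𝓘(ℝ, EQ) Prod.fst p ζ))) :
          verticalSpace 𝓘(ℝ, EX) 𝓘(ℝ, ES) π p.2) : TangentSpace 𝓘(ℝ, EX) p.2) := by
  set W : TangentSpace (𝓘(ℝ, EQ).prod 𝓘(ℝ, EX)) p → (n : Q × X) → TangentSpace (𝓘(ℝ, EQ).prod 𝓘(ℝ, EX)) n := fun w n =>
    horizontalPart ES Φ π Hor n (FiberBundle.extend (EQ × EX) w n) with hW
  have hWp : ∀ w, W w p = horizontalPart ES Φ π Hor p w := fun w =>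
    congrArg (horizontalPart ES Φ π Hor p) (FiberBundle.extend_apply_self _ _)
  have hWs : ∀ w, MDifferentiableAt (𝓘(ℝ, EQ).prod 𝓘(ℝ, EX)) (𝓘(ℝ, EQ).prod 𝓘(ℝ, EX)).tangent
      (fun n => (⟨n, W w n⟩ : TangentBundle (𝓘(ℝ, EQ).prod 𝓘(ℝ, EX)) (Q × X))) p := fun w =>
    (ContMDiffAt.horizontalPart_along hr hΦ hπ
      (contMDiffAt_extend_along w)).mdifferentiableAt (by simp)
  set B := VectorField.mlieBracket (𝓘(ℝ, EQ).prod 𝓘(ℝ, EX)) (W η) (W ζ) p with hB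
  have hfst : ∀ w n, Φ n.1 (mfderiv (𝓘(ℝ, EQ).prod 𝓘(ℝ, EX)) 𝓘(ℝ, EQ) Prod.fst n (W w n)) = 0 := fun w n => by
    change Φ n.1 (mfderiv (𝓘(ℝ, EQ).prod 𝓘(ℝ, EX)) 𝓘(ℝ, EQ) Prod.fst n (horizontalPart ES Φ π Hor n _)) = 0
    rw [horizontalPart, mfderiv_fst_tangentPair, map_sub, connection_fundamentalField hΦ,
      sub_self]
  have hsnd : ∀ w n, mfderiv (𝓘(ℝ, EQ).prod 𝓘(ℝ, EX)) 𝓘(ℝ, EX) Prod.snd n (W w n) ∈ Hor n.2 := fun w n => by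
    change mfderiv (𝓘(ℝ, EQ).prod 𝓘(ℝ, EX)) 𝓘(ℝ, EX) Prod.snd n (horizontalPart ES Φ π Hor n _) ∈ Hor n.2
    rw [horizontalPart, mfderiv_snd_tangentPair]
    exact Subtype.coe_prop _
  have h1 := frobeniusTensor_mfderiv (I := 𝓘(ℝ, EM).prod 𝓘(ℝ, EX)) (J := 𝓘(ℝ, EQ).prod 𝓘(ℝ, EX))
    (f := AssocSpace.mk hr (Y := X)) (p := p) (isCompl_verticalQ_horizontalQ hr hΦ hπ)
    (fun e => (contMDiffAt_projAlong_verticalQ hr hΦ hπ _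
      (contMDiffAt_extend_along e)).mdifferentiableAt (by simp))
    (contMDiff_infty.1 (AssocSpace.contMDiff_mk (EY := EX) hr) 2).contMDiffAt (hWs η) (hWs ζ)
    (Eventually.of_forall fun n => mfderiv_mk_horizontalPart_mem hr hΦ hπ n _)
    (Eventually.of_forall fun n => mfderiv_mk_horizontalPart_mem hr hΦ hπ n _)
    ((projAlong_horizontalQ_mfderiv_mk hr hΦ hπ p η).trans (by rw [hWp]))
    ((projAlong_horizontalQ_mfderiv_mk hr hΦ hπ p ζ).trans (by rw [hWp]))
  have h2 : ∀ w, (projAlong (Hor p.2) (verticalSpace 𝓘(ℝ, EX) 𝓘(ℝ, ES) π p.2)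
      (connectionShift Φ p w) : TangentSpace 𝓘(ℝ, EX) p.2) =
      mfderiv (𝓘(ℝ, EQ).prod 𝓘(ℝ, EX)) 𝓘(ℝ, EX) Prod.snd p (W w p) := fun w => by
    rw [hWp, horizontalPart, mfderiv_snd_tangentPair]
  have h3 := frobeniusTensor_mfderiv (I := 𝓘(ℝ, EX)) (J := 𝓘(ℝ, EQ).prod 𝓘(ℝ, EX))
    (Ver := verticalSpace 𝓘(ℝ, EX) 𝓘(ℝ, ES) π) (Hor := Hor) (f := (Prod.snd : Q × X → X)) (p := p)
    (fun x => isCompl_verticalSpace (hπ.horizontal x))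
    (fun e => ((contMDiffAt_extend_along e).projAlong_ver_along hπ.smooth hπ.smooth_hor
      hπ.horizontal).mdifferentiableAt (by simp))
    contMDiffAt_snd (hWs η) (hWs ζ) (Eventually.of_forall (hsnd η)) (Eventually.of_forall (hsnd ζ))
    (h2 η) (h2 ζ)
  have h4 := formDeriv_connection_mfderiv hΦ (f := (Prod.fst : Q × X → Q)) (c := 0) (d := 0)
    contMDiff_fst (hWs η) (hWs ζ) (hfst η) (hfst ζ)
  have h5 : curvatureForm Φ p.1 (mfderiv (𝓘(ℝ, EQ).prod 𝓘(ℝ, EX)) 𝓘(ℝ, EQ) Prod.fst p η)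
      (mfderiv (𝓘(ℝ, EQ).prod 𝓘(ℝ, EX)) 𝓘(ℝ, EQ) Prod.fst p ζ) = -Φ p.1 (mfderiv (𝓘(ℝ, EQ).prod 𝓘(ℝ, EX)) 𝓘(ℝ, EQ) Prod.fst p B) := by
    rw [curvatureForm_eq hr hΦ]
    refine Eq.trans ?_ h4
    rw [hWp, hWp, horizontalPart, horizontalPart, mfderiv_fst_tangentPair, mfderiv_fst_tangentPair]
  change (frobeniusTensor (𝓘(ℝ, EM).prod 𝓘(ℝ, EX)) (verticalQ hr hπ) (horizontalQ hr Φ Hor)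
    (AssocSpace.mk hr p) _ _ : TangentSpace (𝓘(ℝ, EM).prod 𝓘(ℝ, EX)) (AssocSpace.mk hr p)) = _
  -- With `T_Q = -P_Q q_* B`, the shift formula for `P_Q ∘ q_*` splits off `-P B_X`, which is `T`,
  -- and `P ξ_{Φ(B_Q)}`, which is `-P ξ_ω`.
  rw [h1, h3, h5, ← actionLinear_apply, map_neg, map_neg, sub_neg_eq_add, Submodule.coe_neg,
    projAlong_verticalQ_mfderiv_mk hr hΦ hπ, connectionShift_apply, map_sub, ← map_neg,
    actionLinear_apply, ← Submodule.coe_neg, neg_sub, ← sub_eq_neg_add]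

end MainFormula

/-! ### Basicness of the right-hand side, and the Clifford module `E_Q`. -/

section Invariance

open Filter Set

variable {EG : Type*} [NormedAddCommGroup EG] [NormedSpace ℝ EG]
  {EQ : Type*} [NormedAddCommGroup EQ] [NormedSpace ℝ EQ]
  {EM : Type*} [NormedAddCommGroup EM] [NormedSpace ℝ EM]
  {EX : Type*} [NormedAddCommGroup EX] [NormedSpace ℝ EX]
  {ES : Type*} [NormedAddCommGroup ES] [NormedSpace ℝ ES]
  {G : Type*} [TopologicalSpace G] [ChartedSpace EG G] [Group G] [LieGroup 𝓘(ℝ, EG) ∞ G]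
  {Q : Type*} [TopologicalSpace Q] [ChartedSpace EQ Q] [IsManifold 𝓘(ℝ, EQ) ∞ Q]
  [MulAction Gᵐᵒᵖ Q]
  {M : Type*} [TopologicalSpace M] [ChartedSpace EM M] [IsManifold 𝓘(ℝ, EM) ∞ M]
  {r : Q → M} (hr : IsPrincipalBundle EG EQ EM G r)
  {X : Type*} [TopologicalSpace X] [ChartedSpace EX X] [IsManifold 𝓘(ℝ, EX) ∞ X]
  [MulAction G X] [ContMDiffSMul 𝓘(ℝ, EG) 𝓘(ℝ, EX) ∞ G X]
  {S : Type*} [TopologicalSpace S] [ChartedSpace ES S] [IsManifold 𝓘(ℝ, ES) ∞ S]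
  [MulAction G S] [ContMDiffSMul 𝓘(ℝ, EG) 𝓘(ℝ, ES) ∞ G S]


variable {Φ : (z : Q) → TangentSpace 𝓘(ℝ, EQ) z →ₗ[ℝ] GroupLieAlgebra 𝓘(ℝ, EG) G}
  {π : X → S} {Hor : (x : X) → Submodule ℝ (TangentSpace 𝓘(ℝ, EX) x)}



/-- The right-hand side vanishes on vectors whose component in `Q` is tangent to the orbit and
whose shift is vertical. -/
theorem frobeniusRHS_eq_zero [FiniteDimensional ℝ EG] [FiniteDimensional ℝ EQ]
    [FiniteDimensional ℝ EX] [FiniteDimensional ℝ ES]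
    {ι : Type*} [Fintype ι] (b : Module.Basis ι ℝ (GroupLieAlgebra 𝓘(ℝ, EG) G))
    (hr : IsPrincipalBundle EG EQ EM G r) (hΦ : IsPrincipalConnection Φ)
    (hπ : IsEquivariantFamily EX ES G π Hor) (p : Q × X)
    {η : TangentSpace (𝓘(ℝ, EQ).prod 𝓘(ℝ, EX)) p}
    (h1 : mfderiv (𝓘(ℝ, EQ).prod 𝓘(ℝ, EX)) 𝓘(ℝ, EQ) Prod.fst p η =
      fundamentalField EQ p.1
        (Φ p.1 (mfderiv (𝓘(ℝ, EQ).prod 𝓘(ℝ, EX)) 𝓘(ℝ, EQ) Prod.fst p η)))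
    (h2 : connectionShift Φ p η ∈ verticalSpace 𝓘(ℝ, EX) 𝓘(ℝ, ES) π p.2)
    (ζ : TangentSpace (𝓘(ℝ, EQ).prod 𝓘(ℝ, EX)) p) :
    frobeniusRHS ES b Φ π Hor p η ζ = 0 ∧ frobeniusRHS ES b Φ π Hor p ζ η = 0 := by
  obtain ⟨B, hB, hBa, hB0⟩ := exists_bilinear_frobeniusTensor_family hπ p.2
  have h3 := sub_eq_zero.2 h1
  -- The two hypotheses kill one term each: `T` vanishes on vertical vectors, and the curvature sees
  -- only the horizontal part in `Q`, which is zero.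
  rw [frobeniusRHS_eq b hr hπ, frobeniusRHS_eq b hr hπ, ← hB, ← hB, hBa (connectionShift Φ p ζ),
    hB0 _ h2, curvatureForm_eq hr hΦ, curvatureForm_eq hr hΦ, h3, map_zero, LinearMap.zero_apply,
    map_zero]
  have h4 : projAlong (verticalSpace 𝓘(ℝ, EX) 𝓘(ℝ, ES) π p.2) (Hor p.2)
      (actionField p.2 (0 : GroupLieAlgebra 𝓘(ℝ, EG) G)) = 0 := by
    rw [← actionLinear_apply, map_zero, map_zero]
  constructor
  · exact (congrArg (fun w => (0 : verticalSpace 𝓘(ℝ, EX) 𝓘(ℝ, ES) π p.2) - w) h4).trans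
      (sub_zero _)
  · exact (congrArg (fun w => -(0 : verticalSpace 𝓘(ℝ, EX) 𝓘(ℝ, ES) π p.2) - w) h4).trans
      (by rw [neg_zero, sub_zero])

/-- Makes the identification of vertical spaces independent of the representative: changing `(z, x)`
along the orbit moves `v` by the derivative of `g⁻¹`. -/
theorem fiberDeriv_orbitTranslation (g : G) (p : Q × X) (v : TangentSpace 𝓘(ℝ, EX) p.2) :
    (⟨AssocSpace.mk hr (op g • p.1, g⁻¹ • p.2), fiberDeriv hr (op g • p.1, g⁻¹ • p.2)
        (mfderiv 𝓘(ℝ, EX) 𝓘(ℝ, EX) (fun x : X => g⁻¹ • x) p.2 v)⟩ :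
      TangentBundle (𝓘(ℝ, EM).prod 𝓘(ℝ, EX)) (AssocSpace hr X)) =
    ⟨AssocSpace.mk hr p, fiberDeriv hr p v⟩ := by
  have h1 := mfderiv_mk_orbitTranslation hr g p (tangentPair 𝓘(ℝ, EQ) 𝓘(ℝ, EX) p (0, v))
  have h2 : mfderiv (𝓘(ℝ, EQ).prod 𝓘(ℝ, EX)) (𝓘(ℝ, EQ).prod 𝓘(ℝ, EX))
      (fun p' : Q × X => (op g • p'.1, g⁻¹ • p'.2)) p (tangentPair 𝓘(ℝ, EQ) 𝓘(ℝ, EX) p (0, v)) =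
      tangentPair 𝓘(ℝ, EQ) 𝓘(ℝ, EX) (op g • p.1, g⁻¹ • p.2)
        (0, mfderiv 𝓘(ℝ, EX) 𝓘(ℝ, EX) (fun x : X => g⁻¹ • x) p.2 v) := by
    apply tangent_prod_ext
    · rw [mfderiv_fst_orbitTranslation hr, mfderiv_fst_tangentPair, mfderiv_fst_tangentPair]
      exact map_zero _
    · rw [mfderiv_snd_orbitTranslation hr, mfderiv_snd_tangentPair, mfderiv_snd_tangentPair]
  rw [h2, ← fiberDeriv_eq, ← fiberDeriv_eq] at h1
  exact h1

theorem frobeniusQ_congr (hπ : IsEquivariantFamily EX ES G π Hor) {y y' : AssocSpace hr X}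
    {u v : TangentSpace (𝓘(ℝ, EM).prod 𝓘(ℝ, EX)) y}
    {u' v' : TangentSpace (𝓘(ℝ, EM).prod 𝓘(ℝ, EX)) y'}
    (hu : (⟨y, u⟩ : TangentBundle (𝓘(ℝ, EM).prod 𝓘(ℝ, EX)) (AssocSpace hr X)) = ⟨y', u'⟩)
    (hv : (⟨y, v⟩ : TangentBundle (𝓘(ℝ, EM).prod 𝓘(ℝ, EX)) (AssocSpace hr X)) = ⟨y', v'⟩) :
    (⟨y, frobeniusQ hr hπ Φ y u v⟩ :
      TangentBundle (𝓘(ℝ, EM).prod 𝓘(ℝ, EX)) (AssocSpace hr X)) =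
      ⟨y', frobeniusQ hr hπ Φ y' u' v'⟩ := by
  have hy : y = y' := congrArg Bundle.TotalSpace.proj hu
  subst hy
  obtain rfl := eq_of_heq (Bundle.TotalSpace.mk.inj hu).2
  obtain rfl := eq_of_heq (Bundle.TotalSpace.mk.inj hv).2
  rfl

/-- Freeness of the action: in a local trivialization `g` acts by right multiplication on the group
component. -/
theorem IsPrincipalBundle.eq_one_of_smul_eq (hr : IsPrincipalBundle EG EQ EM G r) {z : Q} {g : G} (h : op g • z = z) : g = 1 := by
  have h1 := hr.triv_action (r z) (hr.mem_triv (r z)) g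
  rw [h] at h1
  exact mul_eq_left.1 (congrArg Prod.snd h1).symm

section CliffordModule

variable {E : X → Type*} [∀ x, AddCommGroup (E x)] [∀ x, Module ℂ (E x)]
  (C : EquivariantCliffordModule EX ES G π E)

/-- An element relating two representatives over the same `z` fixes `z`, so it is `1`. -/
theorem EquivariantCliffordModule.mkQ_injective (p : Q × X) :
    Function.Injective (C.mkQ hr p) := by
  intro e e' h
  obtain ⟨g, hg⟩ := (AssocSpace.mk_eq_iff hr).1 h
  have h1 : g = 1 := hr.eq_one_of_smul_eq (congrArg Prod.fst hg).symm
  subst h1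
  have h2 := congrArg Prod.snd hg
  rw [inv_one] at h2
  replace h2 : (⟨p.2, e'⟩ : Σ x, E x) = ⟨p.2, e⟩ := h2.trans (C.act_one p.2 e)
  exact (eq_of_heq (Sigma.mk.inj h2).2).symm

/-- Independence of the choice made in `cQ`: two representations of the same data differ by some
`g`, injectivity of `fiberDeriv` forces the vertical lifts to correspond under `g⁻¹`, and
equivariance of `c` makes the products agree in the quotient. -/
theorem EquivariantCliffordModule.cQ_mk (hΦ : IsPrincipalConnection Φ)
    (hπ : IsEquivariantFamily EX ES G π Hor) (p : Q × X)
    {w : verticalQ hr hπ (AssocSpace.mk hr p)}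
    {v : verticalSpace 𝓘(ℝ, EX) 𝓘(ℝ, ES) π p.2}
    (hw : (w : TangentSpace (𝓘(ℝ, EM).prod 𝓘(ℝ, EX)) (AssocSpace.mk hr p)) =
      fiberDeriv hr p (v : TangentSpace 𝓘(ℝ, EX) p.2))
    (e : E p.2) :
    C.cQ hr hπ (AssocSpace.mk hr p) w (C.mkQ hr p e) = C.mkQ hr p (C.c p.2 v e) := by
  have h : ∃ (t : C.TotalQ hr) (p' : Q × X) (v' : verticalSpace 𝓘(ℝ, EX) 𝓘(ℝ, ES) π p'.2)
      (e' : E p'.2), (⟨AssocSpace.mk hr p, w⟩ :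
        TangentBundle (𝓘(ℝ, EM).prod 𝓘(ℝ, EX)) (AssocSpace hr X))
        = ⟨AssocSpace.mk hr p', fiberDeriv hr p' v'⟩ ∧
      C.mkQ hr p e = C.mkQ hr p' e' ∧ t = C.mkQ hr p' (C.c p'.2 v' e') :=
    ⟨_, p, v, e, by rw [hw], rfl, rfl⟩
  rw [EquivariantCliffordModule.cQ, dif_pos h]
  obtain ⟨⟨z', x'⟩, v', e', h1, h2, h3⟩ := h.choose_spec
  rw [h3]
  -- The element of `E_Q` alone determines `g`, since it records both the point of `Q × X` and the
  -- vector up to the action.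
  obtain ⟨g, hg⟩ := (AssocSpace.mk_eq_iff hr).1 h2
  have hz : z' = op g • p.1 := congrArg Prod.fst hg
  have hx : (⟨x', e'⟩ : Σ x, E x) = ⟨g⁻¹ • p.2, C.act g⁻¹ p.2 e⟩ := congrArg Prod.snd hg
  subst hz
  obtain rfl : x' = g⁻¹ • p.2 := (Sigma.mk.inj hx).1
  obtain rfl := eq_of_heq (Sigma.mk.inj hx).2
  rw [hw, ← fiberDeriv_orbitTranslation hr g] at h1
  have h4 := fiberDeriv_injective hr hΦ _ (eq_of_heq (Bundle.TotalSpace.mk.inj h1).2)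
  have h5 := C.c_equivariant g⁻¹ p.2 v v' e h4.symm
  change AssocSpace.mk hr ((op g • p.1, ⟨g⁻¹ • p.2, C.c _ v' (C.act g⁻¹ p.2 e)⟩) : Q × C.Total) = _
  rw [← h5]
  exact AssocSpace.mk_action hr g ((p.1, ⟨p.2, C.c p.2 v e⟩) : Q × C.Total)

end CliffordModule

end Invariance

/-! ### The theorem. -/

theorem mainTheorem4
    {EG : Type*} [NormedAddCommGroup EG] [NormedSpace ℝ EG] [FiniteDimensional ℝ EG]
    {EQ : Type*} [NormedAddCommGroup EQ] [NormedSpace ℝ EQ] [FiniteDimensional ℝ EQ]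
    {EM : Type*} [NormedAddCommGroup EM] [NormedSpace ℝ EM] [FiniteDimensional ℝ EM]
    {EX : Type*} [NormedAddCommGroup EX] [NormedSpace ℝ EX] [FiniteDimensional ℝ EX]
    {ES : Type*} [NormedAddCommGroup ES] [NormedSpace ℝ ES] [FiniteDimensional ℝ ES]
    -- a Lie group `G` with a basis `(e_a)` of its Lie algebra
    {G : Type*} [TopologicalSpace G] [ChartedSpace EG G] [Group G] [LieGroup 𝓘(ℝ, EG) ∞ G]
    {ι : Type*} [Fintype ι] (b : Module.Basis ι ℝ (GroupLieAlgebra 𝓘(ℝ, EG) G))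
    -- a principal `G`-bundle `r : Q → M` with a connection `Φ`
    {Q : Type*} [TopologicalSpace Q] [ChartedSpace EQ Q] [IsManifold 𝓘(ℝ, EQ) ∞ Q]
    [MulAction Gᵐᵒᵖ Q]
    {M : Type*} [TopologicalSpace M] [ChartedSpace EM M] [IsManifold 𝓘(ℝ, EM) ∞ M]
    {r : Q → M} (hr : IsPrincipalBundle EG EQ EM G r)
    (Φ : (z : Q) → TangentSpace 𝓘(ℝ, EQ) z →ₗ[ℝ] GroupLieAlgebra 𝓘(ℝ, EG) G)
    (hΦ : IsPrincipalConnection Φ)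
    -- a `G`-equivariant family `π : X → S` with an invariant horizontal distribution
    {X : Type*} [TopologicalSpace X] [ChartedSpace EX X] [IsManifold 𝓘(ℝ, EX) ∞ X]
    [MulAction G X] [ContMDiffSMul 𝓘(ℝ, EG) 𝓘(ℝ, EX) ∞ G X]
    {S : Type*} [TopologicalSpace S] [ChartedSpace ES S] [IsManifold 𝓘(ℝ, ES) ∞ S]
    [MulAction G S] [ContMDiffSMul 𝓘(ℝ, EG) 𝓘(ℝ, ES) ∞ G S]
    {π : X → S} {Hor : (x : X) → Submodule ℝ (TangentSpace 𝓘(ℝ, EX) x)}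
    (hπ : IsEquivariantFamily EX ES G π Hor) :
    -- `H_Q` is a complement of the vertical tangent bundle of `X_Q → S_Q`
    (∀ y : AssocSpace hr X, IsCompl (verticalQ hr hπ y) (horizontalQ hr Φ Hor y)) ∧
    -- `T(X/S)_x` is identified with `T(X_Q/S_Q)_{[z, x]}`
    (∀ p : Q × X, Set.BijOn (fiberDeriv (EX := EX) hr p)
      (verticalSpace 𝓘(ℝ, EX) 𝓘(ℝ, ES) π p.2) (verticalQ hr hπ (AssocSpace.mk hr p))) ∧
    -- the right-hand side is basic: horizontal for the action of `G` on `Q × X` ...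
    (∀ (p : Q × X) (e : GroupLieAlgebra 𝓘(ℝ, EG) G)
      (ζ : TangentSpace (𝓘(ℝ, EQ).prod 𝓘(ℝ, EX)) p),
      frobeniusRHS ES b Φ π Hor p (generatingField p e) ζ = 0 ∧
      frobeniusRHS ES b Φ π Hor p ζ (generatingField p e) = 0) ∧
    -- ... and invariant
    (∀ (g : G) (p : Q × X) (η ζ : TangentSpace (𝓘(ℝ, EQ).prod 𝓘(ℝ, EX)) p),
      (frobeniusRHS ES b Φ π Hor (op g • p.1, g⁻¹ • p.2)
        (mfderiv (𝓘(ℝ, EQ).prod 𝓘(ℝ, EX)) (𝓘(ℝ, EQ).prod 𝓘(ℝ, EX))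
          (fun p' : Q × X => (op g • p'.1, g⁻¹ • p'.2)) p η)
        (mfderiv (𝓘(ℝ, EQ).prod 𝓘(ℝ, EX)) (𝓘(ℝ, EQ).prod 𝓘(ℝ, EX))
          (fun p' : Q × X => (op g • p'.1, g⁻¹ • p'.2)) p ζ) :
        TangentSpace 𝓘(ℝ, EX) (g⁻¹ • p.2)) =
      mfderiv 𝓘(ℝ, EX) 𝓘(ℝ, EX) (fun x : X => g⁻¹ • x) p.2
        (frobeniusRHS ES b Φ π Hor p η ζ : TangentSpace 𝓘(ℝ, EX) p.2)) ∧
    -- the right-hand side is annihilated by vertical tangent vectors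
    (∀ (p : Q × X) (η ζ : TangentSpace (𝓘(ℝ, EQ).prod 𝓘(ℝ, EX)) p),
      mfderiv (𝓘(ℝ, EQ).prod 𝓘(ℝ, EX)) 𝓘(ℝ, EQ) Prod.fst p η = 0 →
      mfderiv (𝓘(ℝ, EQ).prod 𝓘(ℝ, EX)) 𝓘(ℝ, EX) Prod.snd p η ∈
        verticalSpace 𝓘(ℝ, EX) 𝓘(ℝ, ES) π p.2 →
      frobeniusRHS ES b Φ π Hor p η ζ = 0 ∧ frobeniusRHS ES b Φ π Hor p ζ η = 0) ∧
    -- `q^* T_Q = T - φ^a ι_a T + ½ φ^a φ^b ι_b ι_a T - ω^a P ξ_a`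
    (∀ (p : Q × X) (η ζ : TangentSpace (𝓘(ℝ, EQ).prod 𝓘(ℝ, EX)) p),
      (frobeniusQ hr hπ Φ (AssocSpace.mk hr p)
        (mfderiv (𝓘(ℝ, EQ).prod 𝓘(ℝ, EX)) (𝓘(ℝ, EM).prod 𝓘(ℝ, EX)) (AssocSpace.mk hr) p η)
        (mfderiv (𝓘(ℝ, EQ).prod 𝓘(ℝ, EX)) (𝓘(ℝ, EM).prod 𝓘(ℝ, EX)) (AssocSpace.mk hr) p ζ) :
        TangentSpace (𝓘(ℝ, EM).prod 𝓘(ℝ, EX)) (AssocSpace.mk hr p)) =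
      fiberDeriv hr p (frobeniusRHS ES b Φ π Hor p η ζ : TangentSpace 𝓘(ℝ, EX) p.2)) ∧
    -- `q^* c(T_Q) = c(T) - φ^a ι_a c(T) + ½ φ^a φ^b ι_b ι_a c(T) - ω^a c(P ξ_a)`
    (∀ {E : X → Type*} [∀ x, AddCommGroup (E x)] [∀ x, Module ℂ (E x)]
      (C : EquivariantCliffordModule EX ES G π E) (p : Q × X),
      Function.Injective (C.mkQ hr p) ∧
      ∀ (η ζ : TangentSpace (𝓘(ℝ, EQ).prod 𝓘(ℝ, EX)) p) (e : E p.2),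
        C.cQ hr hπ (AssocSpace.mk hr p)
          (frobeniusQ hr hπ Φ (AssocSpace.mk hr p)
            (mfderiv (𝓘(ℝ, EQ).prod 𝓘(ℝ, EX)) (𝓘(ℝ, EM).prod 𝓘(ℝ, EX)) (AssocSpace.mk hr) p η)
            (mfderiv (𝓘(ℝ, EQ).prod 𝓘(ℝ, EX)) (𝓘(ℝ, EM).prod 𝓘(ℝ, EX)) (AssocSpace.mk hr) p ζ))
          (C.mkQ hr p e) =
        C.mkQ hr p (C.frobeniusRHS b Φ Hor p η ζ e)) := by
  have hQ : ∀ (p : Q × X) (η ζ : TangentSpace (𝓘(ℝ, EQ).prod 𝓘(ℝ, EX)) p),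
      (frobeniusQ hr hπ Φ (AssocSpace.mk hr p)
        (mfderiv (𝓘(ℝ, EQ).prod 𝓘(ℝ, EX)) (𝓘(ℝ, EM).prod 𝓘(ℝ, EX)) (AssocSpace.mk hr) p η)
        (mfderiv (𝓘(ℝ, EQ).prod 𝓘(ℝ, EX)) (𝓘(ℝ, EM).prod 𝓘(ℝ, EX)) (AssocSpace.mk hr) p ζ) :
        TangentSpace (𝓘(ℝ, EM).prod 𝓘(ℝ, EX)) (AssocSpace.mk hr p)) =
      fiberDeriv hr p (frobeniusRHS ES b Φ π Hor p η ζ : TangentSpace 𝓘(ℝ, EX) p.2) := by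
    intro p η ζ
    rw [frobeniusQ_mfderiv_mk hr hΦ hπ, frobeniusRHS_eq b hr hπ]
  refine ⟨isCompl_verticalQ_horizontalQ hr hΦ hπ, bijOn_fiberDeriv hr hΦ hπ, ?_, ?_, ?_, hQ, ?_⟩
  · intro p e ζ
    refine frobeniusRHS_eq_zero b hr hΦ hπ p ?_ ?_ ζ
    · rw [connection_generatingField hr hΦ, mfderiv_fst_generatingField hr]
    · rw [connectionShift_apply, connection_generatingField hr hΦ, mfderiv_snd_generatingField hr,
        sub_self]
      exact zero_mem _
  · intro g p η ζ
    -- Translating `η`, `ζ` along the orbit does not change their images under `q`, hence not `T_Q`.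
    -- The formula `hQ` at both points then forces equality after the injective identification.
    have h1 := frobeniusQ_congr hr (Φ := Φ) hπ (mfderiv_mk_orbitTranslation hr g p η)
      (mfderiv_mk_orbitTranslation hr g p ζ)
    rw [hQ, hQ, ← fiberDeriv_orbitTranslation hr g p] at h1
    exact fiberDeriv_injective hr hΦ _ (eq_of_heq (Bundle.TotalSpace.mk.inj h1).2)
  · intro p η ζ h1 h2
    refine frobeniusRHS_eq_zero b hr hΦ hπ p ?_ ?_ ζ
    · rw [h1, map_zero, map_zero]
    · rw [connectionShift_apply, h1, map_zero, ← actionLinear_apply, map_zero, sub_zero]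
      exact h2
  · intro E _ _ C p
    refine ⟨C.mkQ_injective hr p, fun η ζ e => ?_⟩
    -- By `hQ` the vertical lift of `T_Q` is the right-hand side; linearity of `c` carries it
    -- through the sums.
    rw [C.cQ_mk hr hΦ hπ p (hQ p η ζ)]
    refine congrArg (fun L : Module.End ℂ (E p.2) => C.mkQ hr p (L e)) ?_
    exact map_frobeniusFormula (C.c p.2) _ _ _ _ _ _ _
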